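/- Let $k$ be an algebraically closed field of characteristic different from $2$ and let $X$ be a smooth complete (irreducible) curve of genus $g$ over $k$, with canonical divisor $K$. Let $\mathfrak b$ be a nonspecial divisor on $X$, i.e. $h^0(\mathcal O_X(K-\mathfrak b))=0$, of degree $\deg \mathfrak b\ge 2g-2$. Let $S_{\mathfrak b}=\mathbb P(\mathcal O_X\oplus\mathcal O_X(K-\mathfrak b))$ be the associated canonical ruled surface, $\pi:S_{\mathfrak b}\to X$ its ruling, and $X_1\subset S_{\mathfrak b}$ the section of $\pi$ defined by the quotient $\mathcal O_X\oplus\mathcal O_X(K-\mathfrak b)\to\mathcal O_X$; thus $X_1\sim X_0+(\mathfrak b-K)f$, where $X_0$ is the section of minimal self-intersection defined by the quotient onto $\mathcal O_X(K-\mathfrak b)$ and $f$ is a fibre of $\pi$. Let $B$ be a (possibly empty) finite set of distinct points of $X$ whose sum is linearly equivalent to $2\mathfrak b-2K$. Then there is a smooth irreducible curve $C$ in the linear system $|2X_1|$ such that the restriction $\gamma=\pi|_C:C\to X$ of the ruling is a $2:1$ map (finite, surjective, of degree $2$) whose branch points in $X$ are exactly the points of $B$. Moreover $C$ is unique up to isomorphism: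 if $C,C'\in|2X_1|$ are two integral curves such that the restrictions $\gamma,\gamma'$ of the ruling are $2:1$ maps with set of branch points $B$, then there is an isomorphism $e:C\to C'$ with $\gamma'\circ e=\gamma$. -/

import Mathlib

open CategoryTheory CategoryTheory.Limits AlgebraicGeometry TopologicalSpace HomogeneousLocalization
universe u

namespace RuledDoubleCover
section ProjLocalization
variable {A B σ τ : Type u} [CommRing A] [CommRing B] [SetLike σ A] [AddSubgroupClass σ A]
  [SetLike τ B] [AddSubgroupClass τ B] {𝒜 : ℕ → σ} {ℬ : ℕ → τ} [GradedRing 𝒜] [GradedRing ℬ]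

theorem val_fromZeroRingHom (S : Submonoid A) (a : 𝒜 0) :
    (fromZeroRingHom 𝒜 S a).val = Localization.mk (a : A) 1 := rfl

theorem away_isLocalization (φ : 𝒜 →+*ᵍ ℬ) (hinj : Function.Injective φ) (a : 𝒜 0)
    (u : ℬ 0) (hu : φ a * u = 1)
    (hsurj : ∀ n, ∀ b ∈ ℬ n, ∃ N : ℕ, ∃ x ∈ 𝒜 n, φ a ^ N * b = φ x)
    {m : ℕ} {s : A} (hs : s ∈ 𝒜 m) :
    letI := (Away.map φ s).toAlgebra
    IsLocalization.Away (fromZeroRingHom 𝒜 (Submonoid.powers s) a) (Away ℬ (φ s)) := by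
  let := (Away.map φ s).toAlgebra
  have hmap : ∀ c : 𝒜 0, Away.map φ s (fromZeroRingHom 𝒜 (Submonoid.powers s) c) =
      fromZeroRingHom ℬ (Submonoid.powers (φ s)) ⟨φ c, Graded.map_mem φ c.2⟩ := by
    intro c
    apply val_injective
    rw [val_fromZeroRingHom]
    change Localization.mk (φ c) ⟨φ 1, _⟩ = _
    congr 1
    exact Subtype.ext (map_one φ)
  have key : fromZeroRingHom ℬ (Submonoid.powers (φ s)) ⟨φ a, Graded.map_mem φ a.2⟩ *
      fromZeroRingHom ℬ (Submonoid.powers (φ s)) u = 1 := by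
    rw [← map_mul, ← map_one (fromZeroRingHom ℬ (Submonoid.powers (φ s)))]
    congr 1
    exact Subtype.ext hu
  constructor; constructor
  · rintro ⟨_, N, rfl⟩
    simp only [map_pow]
    refine IsUnit.pow _ ?_
    rw [RingHom.algebraMap_toAlgebra, hmap]
    exact IsUnit.of_mul_eq_one _ key
  · intro z
    obtain ⟨n, b, hb, rfl⟩ := Away.mk_surjective ℬ (Graded.map_mem φ hs) z
    obtain ⟨N, x, hx, e⟩ := hsurj _ b hb
    refine ⟨⟨Away.mk 𝒜 hs n x hx, ⟨_, N, rfl⟩⟩, ?_⟩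
    rw [RingHom.algebraMap_toAlgebra]
    simp only [map_pow, hmap, Away.map_mk]
    apply val_injective
    simp only [val_mul, val_pow, val_fromZeroRingHom, Away.val_mk, Localization.mk_pow,
      Localization.mk_mul, ← e]
    rw [Localization.mk_eq_mk_iff, Localization.r_iff_exists]
    refine ⟨1, ?_⟩
    simp
    ring
  · intro y y' h
    refine ⟨1, ?_⟩
    simp only [OneMemClass.coe_one, one_mul]
    rw [RingHom.algebraMap_toAlgebra] at h
    obtain ⟨n, x, hx, rfl⟩ := Away.mk_surjective 𝒜 hs y
    obtain ⟨n', x', hx', rfl⟩ := Away.mk_surjective 𝒜 hs y'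
    apply val_injective
    have h := congrArg HomogeneousLocalization.val h
    simp only [Away.map_mk, Away.val_mk, Localization.mk_eq_mk_iff, Localization.r_iff_exists] at h ⊢
    obtain ⟨⟨_, c, rfl⟩, hc⟩ := h
    refine ⟨⟨_, c, rfl⟩, hinj ?_⟩
    simpa using hc

theorem projMap_isOpenImmersion (φ : 𝒜 →+*ᵍ ℬ) (hφ : HomogeneousIdeal.irrelevant ℬ ≤
      (HomogeneousIdeal.irrelevant 𝒜).map φ) (hinj : Function.Injective φ) (a : 𝒜 0)
    (u : ℬ 0) (hu : φ a * u = 1)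
    (hsurj : ∀ n, ∀ b ∈ ℬ n, ∃ N : ℕ, ∃ x ∈ 𝒜 n, φ a ^ N * b = φ x) :
    IsOpenImmersion (Proj.map φ hφ) ∧
      ∀ p : Proj 𝒜, p ∈ Set.range (Proj.map φ hφ) ↔ a ∉ (Proj.toSpecZero 𝒜 p).asIdeal := by
  have himm {m : ℕ} (s : A) (hs : s ∈ 𝒜 m) :
      IsOpenImmersion (Spec.map (CommRingCat.ofHom (Away.map φ s))) := by
    let := (Away.map φ s).toAlgebra
    have := away_isLocalization φ hinj a u hu hsurj hs
    exact IsOpenImmersion.of_isLocalization (fromZeroRingHom 𝒜 (Submonoid.powers s) a)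
  have hrange {m : ℕ} (s : A) (hs : s ∈ 𝒜 m) (q : Spec (CommRingCat.of (Away 𝒜 s))) :
      q ∈ Set.range (Spec.map (CommRingCat.ofHom (Away.map φ s))) ↔
        fromZeroRingHom 𝒜 (Submonoid.powers s) a ∉ q.asIdeal := by
    let := (Away.map φ s).toAlgebra
    have := away_isLocalization φ hinj a u hu hsurj hs
    exact Set.ext_iff.mp (PrimeSpectrum.localization_away_comap_range (Away ℬ (φ s))
      (fromZeroRingHom 𝒜 (Submonoid.powers s) a)) q
  have hpb {m : ℕ} (hm : 0 < m) (s : A) (hs : s ∈ 𝒜 m) : IsPullback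
      (Spec.map (CommRingCat.ofHom (Away.map φ s)))
      (Proj.awayι ℬ (φ s) (Graded.map_mem φ hs) hm)
      (Proj.awayι 𝒜 s hs hm) (Proj.map φ hφ) := by
    apply IsOpenImmersion.isPullback
    · exact Proj.awayι_comp_map φ hφ hm _ hs
    · rw [Proj.opensRange_awayι, Proj.opensRange_awayι, Proj.map_preimage_basicOpen]
  refine ⟨?_, fun p ↦ ?_⟩
  · refine (IsZariskiLocalAtTarget.iff_of_openCover (P := @IsOpenImmersion)
      (Proj.affineOpenCover 𝒜).openCover).mpr ?_
    rintro ⟨⟨m, hm⟩, ⟨s, hs⟩⟩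
    replace hs : s ∈ 𝒜 m := hs
    change IsOpenImmersion (pullback.snd (Proj.map φ hφ) (Proj.awayι 𝒜 s hs hm))
    have h := (hpb hm s hs).flip
    have := himm s hs
    have e : pullback.snd (Proj.map φ hφ) (Proj.awayι 𝒜 s hs hm) =
        h.isoPullback.inv ≫ Spec.map (CommRingCat.ofHom (Away.map φ s)) :=
      (h.isoPullback_inv_snd).symm
    rw [e]
    exact IsOpenImmersion.comp _ _
  · obtain ⟨⟨⟨m, hm⟩, ⟨s, hs⟩⟩, q, hq⟩ := (Proj.affineOpenCover 𝒜).openCover.exists_eq p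
    replace hs : s ∈ 𝒜 m := hs
    change Spec (CommRingCat.of (Away 𝒜 s)) at q
    change Proj.awayι 𝒜 s hs hm q = p at hq
    have h1 : p ∈ Set.range (Proj.map φ hφ) ↔
        q ∈ Set.range (Spec.map (CommRingCat.ofHom (Away.map φ s))) := by
      constructor
      · rintro ⟨z, hz⟩
        obtain ⟨w, hw, -⟩ := Scheme.exists_preimage_of_isPullback
          (hpb hm s hs) q z (by rw [hq, hz])
        exact ⟨w, hw⟩
      · rintro ⟨w, rfl⟩
        refine ⟨Proj.awayι ℬ (φ s) (Graded.map_mem φ hs) hm w, ?_⟩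
        rw [← hq, ← Scheme.Hom.comp_apply, ← (hpb hm s hs).w, Scheme.Hom.comp_apply]
    rw [h1, hrange s hs, ← hq, ← Scheme.Hom.comp_apply, Proj.awayι_toSpecZero]
    rfl

end ProjLocalization
end RuledDoubleCover

namespace RuledDoubleCover

/-- A nonsingular curve: an integral Noetherian scheme of dimension one whose local rings are all
regular. Over an algebraically closed field this is the same as smoothness. -/
class IsNonsingularCurve (X : Scheme.{u}) : Prop extends IsIntegral X, IsNoetherian X where
  regular : ∀ x : X, IsRegularLocalRing (X.presheaf.stalk x)
  dim_eq_one : topologicalKrullDim X = 1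

theorem isDVR_stalk {X : Scheme.{u}} [IsNonsingularCurve X] (x : X) (hx : Order.coheight x = 1) :
    IsDiscreteValuationRing (X.presheaf.stalk x) := by
  have h := IsNonsingularCurve.regular x
  have hdim : ringKrullDim (X.presheaf.stalk x) = 1 := by
    rw [ringKrullDim_stalk_eq_coheight, hx]; rfl
  have h1 := h.spanFinrank_maximalIdeal
  rw [hdim] at h1
  have h2 : (IsLocalRing.maximalIdeal (X.presheaf.stalk x)).spanFinrank = 1 := by exact_mod_cast h1
  have hnf : ¬ IsField (X.presheaf.stalk x) := by
    intro hf
    have := ringKrullDim_eq_zero_of_isField hf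
    rw [hdim] at this
    exact one_ne_zero this
  exact ((IsDiscreteValuationRing.TFAE (X.presheaf.stalk x) hnf).out 0 4).mpr
    ((Submodule.spanFinrank_eq_one_iff _).mp h2).1

/-- The prime divisors (closed points) of a curve: the points of codimension one. -/
abbrev PrimeDivisor (X : Scheme.{u}) : Type u := {x : X // Order.coheight x = 1}
/-- Weil divisors. -/
abbrev Divisor (X : Scheme.{u}) : Type u := PrimeDivisor X →₀ ℤ

variable {X : Scheme.{u}} [IsNonsingularCurve X]

theorem ord_one' (x : X) : Scheme.ord (1 : X.functionField) x = 0 := by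
  have := Scheme.ord_mul (x := x) (one_ne_zero (α := X.functionField)) one_ne_zero
  rw [mul_one] at this
  omega

theorem ord_neg' (f : X.functionField) (x : X) : Scheme.ord (-f) x = Scheme.ord f x := by
  by_cases hf : f = 0
  · simp [hf]
  have h1 := Scheme.ord_mul (x := x) (f := (-1 : X.functionField)) (g := -1) (by simp) (by simp)
  rw [neg_one_mul, neg_neg, ord_one'] at h1
  rw [← neg_one_mul, Scheme.ord_mul (by simp) hf]
  omega

/-- The sections of `O(D)` over `U`: the rational functions `f` with `div f + D ≥ 0` on `U`. -/
def Divisor.sections (D : Divisor X) (U : X.Opens) : AddSubgroup X.functionField where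
  carrier := {f | f ≠ 0 → ∀ x : PrimeDivisor X, x.1 ∈ U → 0 ≤ Scheme.ord f x.1 + D x}
  zero_mem' h := absurd rfl h
  add_mem' {f g} hf hg hfg x hx := by
    by_cases hf0 : f = 0
    · subst hf0; simp only [zero_add] at *; exact hg hfg x hx
    by_cases hg0 : g = 0
    · subst hg0; simp only [add_zero] at *; exact hf hfg x hx
    have := isDVR_stalk x.1 x.2
    have h := Scheme.ord_add (x := x.1) hfg
    have h1 := hf hf0 x hx
    have h2 := hg hg0 x hx
    rcases min_le_iff.mp h with h | h <;> omega
  neg_mem' {f} hf hf0 x hx := by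
    rw [ord_neg']
    exact hf (by simpa using hf0) x hx

theorem mem_sections {D : Divisor X} {U : X.Opens} {f : X.functionField} :
    f ∈ D.sections U ↔ (f ≠ 0 → ∀ x : PrimeDivisor X, x.1 ∈ U → 0 ≤ Scheme.ord f x.1 + D x) :=
  Iff.rfl

theorem sections_anti (D : Divisor X) {U V : X.Opens} (h : V ≤ U) :
    D.sections U ≤ D.sections V := fun _ hf hf0 x hx ↦ hf hf0 x (h hx)

theorem mul_mem_sections {D E : Divisor X} {U : X.Opens} {f g : X.functionField}
    (hf : f ∈ D.sections U) (hg : g ∈ E.sections U) : f * g ∈ (D + E).sections U := by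
  intro hfg x hx
  have hf0 := left_ne_zero_of_mul hfg
  have hg0 := right_ne_zero_of_mul hfg
  have h1 := hf hf0 x hx
  have h2 := hg hg0 x hx
  rw [Scheme.ord_mul hf0 hg0, Finsupp.add_apply]
  omega

theorem zero_le_ord_germ {U : X.Opens} [Nonempty U] {a : Γ(X, U)} (ha : a ≠ 0) {x : X}
    (hx : x ∈ U) : 0 ≤ Scheme.ord (X.germToFunctionField U a) x := by
  have h := Scheme.ord_le_smul (x := x) hx ha (1 : X.functionField)
  rw [ord_one', Algebra.smul_def, mul_one] at h
  exact h

theorem germ_mem_sections {U : X.Opens} [Nonempty U] (a : Γ(X, U)) :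
    X.germToFunctionField U a ∈ (0 : Divisor X).sections U := by
  intro ha x hx
  have ha0 : a ≠ 0 := by rintro rfl; simp at ha
  simpa using zero_le_ord_germ ha0 hx

theorem finite_ord_ne_zero (f : X.functionField) (hf : f ≠ 0) :
    {x : PrimeDivisor X | Scheme.ord f x.1 ≠ 0}.Finite := by
  obtain ⟨W, -, a, hW, rfl, ha⟩ := exists_isUnit_germ_eq X f hf
  obtain ⟨S, hS, hSc, hSirr, hSU⟩ := NoetherianSpace.exists_finite_set_isClosed_irreducible
    (W.isOpen.isClosed_compl)
  have hgen : genericPoint X ∈ W :=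
    ((genericPoint_spec X).mem_open_set_iff W.isOpen).mpr (by simpa using hW)
  have key : ∀ x : PrimeDivisor X, Scheme.ord (X.germToFunctionField W a) x.1 ≠ 0 →
      closure {x.1} ∈ S := by
    intro x hx
    have hxW : x.1 ∈ (W : Set X)ᶜ := fun h ↦ hx (Scheme.ord_of_isUnit ha h)
    rw [hSU] at hxW
    obtain ⟨T, hT, hxT⟩ := hxW
    obtain ⟨t, ht⟩ := QuasiSober.sober (hSirr T hT) (hSc T hT)
    have htx : x.1 ≤ t := ht.specializes hxT
    have htW : t ∈ (W : Set X)ᶜ := by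
      rw [hSU]; exact ⟨T, hT, ht.mem⟩
    have htop : t ≠ ⊤ := by
      rintro rfl
      exact htW hgen
    have hxt : x.1 = t := by
      by_contra hne
      have hlt : x.1 < t := lt_iff_le_not_ge.mpr ⟨htx, fun h ↦
        hne (Specializes.antisymm (show x.1 ⤳ t from h) (show t ⤳ x.1 from htx)).eq⟩
      have h1 := Order.coheight_add_one_le hlt
      rw [x.2] at h1
      have h2 : Order.coheight t = 0 := by
        by_contra h0
        have : (1 : ℕ∞) ≤ Order.coheight t := Order.one_le_iff_ne_zero.mpr h0
        have h3 := (add_le_add_left this 1).trans h1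
        exact absurd h3 (by decide)
      rw [Order.coheight_eq_zero] at h2
      have h3 : (⊤ : X) ≤ t := h2 le_top
      have h4 : t ≤ (⊤ : X) := le_top
      exact htop (Specializes.antisymm (show t ⤳ (⊤ : X) from h3) (show (⊤ : X) ⤳ t from h4)).eq
    rw [hxt, ht.def]
    exact hT
  refine Set.Finite.of_finite_image (hS.subset ?_) (f := fun x : PrimeDivisor X ↦ closure {x.1}) ?_
  · rintro _ ⟨x, hx, rfl⟩
    exact key x hx
  · intro x _ y _ hxy
    exact Subtype.ext (inseparable_iff_closure_eq.mpr hxy).eq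

theorem one_le_ord {U : X.Opens} [Nonempty U] (a : Γ(X, U)) (ha : a ≠ 0) (x : PrimeDivisor X)
    (hx : x.1 ∈ U) (hxa : x.1 ∉ X.basicOpen a) : 1 ≤ Scheme.ord (X.germToFunctionField U a) x.1 := by
  have := isDVR_stalk x.1 x.2
  have h0 := zero_le_ord_germ ha hx
  by_contra h
  have h1 : Scheme.ord (X.germToFunctionField U a) x.1 = 0 := by omega
  have hne : X.germToFunctionField U a ≠ 0 := by
    rwa [Ne, map_eq_zero_iff _ (X.germToFunctionField_injective U)]
  rw [Scheme.ord_eq_iff x.2 hne, ← Scheme.algebraMap_germ_eq_germToFunctionField X hx] at h1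
  refine hxa ((X.mem_basicOpen a x.1 hx).mpr ?_)
  exact (Ring.isUnit_iff_ordFrac_one_of_isDiscreteValuationRing (K := X.functionField)).mpr h1

theorem exists_pow_mul_mem_sections (D : Divisor X) {U : X.Opens} [Nonempty U] (a : Γ(X, U))
    (ha : a ≠ 0) {f : X.functionField} (hf : f ∈ D.sections (X.basicOpen a)) :
    ∃ N : ℕ, ∀ M ≥ N, X.germToFunctionField U a ^ M * f ∈ D.sections U := by
  by_cases hf0 : f = 0
  · exact ⟨0, fun M _ ↦ by simp [hf0, zero_mem]⟩
  have hne : X.germToFunctionField U a ≠ 0 := by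
    rwa [Ne, map_eq_zero_iff _ (X.germToFunctionField_injective U)]
  have hpow : ∀ (M : ℕ) (x : X), Scheme.ord (X.germToFunctionField U a ^ M) x =
      M * Scheme.ord (X.germToFunctionField U a) x := by
    intro M x
    induction M with
    | zero => simp [ord_one']
    | succ n ih =>
      rw [pow_succ, Scheme.ord_mul (pow_ne_zero _ hne) hne, ih]
      push_cast; ring
  have hfin : ({x : PrimeDivisor X | Scheme.ord f x.1 ≠ 0} ∪ {x | D x ≠ 0}).Finite :=
    (finite_ord_ne_zero f hf0).union (D.support.finite_toSet.subset fun x hx ↦ by simpa using hx)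
  refine ⟨hfin.toFinset.sup fun x ↦ (Scheme.ord f x.1 + D x).natAbs, fun M hM _ x hx ↦ ?_⟩
  rw [Scheme.ord_mul (pow_ne_zero _ hne) hf0, hpow]
  by_cases hxa : x.1 ∈ X.basicOpen a
  · have h1 := hf hf0 x hxa
    have h2 : 0 ≤ M * Scheme.ord (X.germToFunctionField U a) x.1 :=
      mul_nonneg (by positivity) (zero_le_ord_germ ha hx)
    omega
  · have h2 : (M : ℤ) * 1 ≤ M * Scheme.ord (X.germToFunctionField U a) x.1 :=
      mul_le_mul_of_nonneg_left (one_le_ord a ha x hx hxa) (by positivity)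
    by_cases hxT : x ∈ hfin.toFinset
    · have h3 := (Finset.le_sup (f := fun x : PrimeDivisor X ↦
        (Scheme.ord f x.1 + D x).natAbs) hxT).trans hM
      omega
    · simp only [Set.Finite.mem_toFinset, Set.mem_union, Set.mem_ofPred_eq, not_or, not_not] at hxT
      rw [hxT.1, hxT.2]
      have : (0 : ℤ) ≤ M := by positivity
      omega

end RuledDoubleCover

namespace RuledDoubleCover
section SymAlg
variable {X : Scheme.{u}} [IsNonsingularCurve X] (D : Divisor X) (U : X.Opens) [Nonempty U]

theorem one_mem_sections : (1 : X.functionField) ∈ (0 : Divisor X).sections U := by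
  simpa using germ_mem_sections (1 : Γ(X, U))

/-- The symmetric algebra of `O s ⊕ O(D) t` over a nonempty open set `U`, as the ring of polynomials
in two variables `s` (index `0`) and `t` (index `1`) over the function field whose coefficient at
`s ^ i * t ^ j` is a section of `O(j D)` over `U`. -/
def symAlg : Subring (MvPolynomial (Fin 2) X.functionField) where
  carrier := {P | ∀ m, P.coeff m ∈ (m 1 • D).sections U}
  zero_mem' m := by simp [zero_mem]
  one_mem' m := by
    rw [MvPolynomial.coeff_one]
    split_ifs with h
    · subst h; simpa using one_mem_sections U
    · exact zero_mem _
  add_mem' hP hQ m := by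
    rw [MvPolynomial.coeff_add]
    exact add_mem (hP m) (hQ m)
  neg_mem' hP m := by
    rw [MvPolynomial.coeff_neg]
    exact neg_mem (hP m)
  mul_mem' {P Q} hP hQ m := by
    rw [MvPolynomial.coeff_mul]
    refine sum_mem fun p hp ↦ ?_
    have h := mul_mem_sections (hP p.1) (hQ p.2)
    rw [Finset.HasAntidiagonal.mem_antidiagonal] at hp
    rwa [← add_smul, ← Finsupp.add_apply, hp] at h

theorem mem_symAlg {P : MvPolynomial (Fin 2) X.functionField} :
    P ∈ symAlg D U ↔ ∀ m, P.coeff m ∈ (m 1 • D).sections U := Iff.rfl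

/-- The homogeneous elements of degree `n` of the symmetric algebra. -/
def symGrading (n : ℕ) : AddSubgroup (symAlg D U) where
  carrier := {P | P.1.IsHomogeneous n}
  zero_mem' := MvPolynomial.isHomogeneous_zero _ _ _
  add_mem' hP hQ := hP.add hQ
  neg_mem' hP := (MvPolynomial.homogeneousSubmodule (Fin 2) X.functionField n).neg_mem hP

theorem mem_symGrading {n : ℕ} {P : symAlg D U} :
    P ∈ symGrading D U n ↔ P.1.IsHomogeneous n := Iff.rfl

theorem homogeneousComponent_mem_symAlg (n : ℕ) {P : MvPolynomial (Fin 2) X.functionField}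
    (hP : P ∈ symAlg D U) : MvPolynomial.homogeneousComponent n P ∈ symAlg D U := by
  intro m
  rw [MvPolynomial.coeff_homogeneousComponent]
  split_ifs
  · exact hP m
  · exact zero_mem _

instance symGrading_gradedMonoid : SetLike.GradedMonoid (symGrading D U) where
  one_mem := MvPolynomial.isHomogeneous_one _ _
  mul_mem _ _ _ _ hP hQ := MvPolynomial.IsHomogeneous.mul hP hQ

theorem symGrading_isInternal : DirectSum.IsInternal (symGrading D U) := by
  have hcoe (x : DirectSum ℕ fun n ↦ symGrading D U n) (n : ℕ) :
      MvPolynomial.homogeneousComponent n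
        (DirectSum.coeAddMonoidHom (symGrading D U) x).1 = (x n).1.1 := by
    induction x using DirectSum.induction_on with
    | zero => simp
    | of i x =>
      rw [DirectSum.coeAddMonoidHom_of, MvPolynomial.homogeneousComponent_of_mem x.2]
      by_cases h : n = i
      · subst h; simp
      · rw [if_neg (fun e ↦ h e), DirectSum.of_eq_of_ne _ _ _ h]; rfl
    | add x y hx hy =>
      rw [map_add, Subring.coe_add, map_add, hx, hy]; rfl
  constructor
  · intro x y h
    refine DFinsupp.ext fun n ↦ Subtype.ext (Subtype.ext ?_)
    rw [← hcoe, ← hcoe, h]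
  · intro P
    refine ⟨∑ n ∈ Finset.range (P.1.totalDegree + 1), DirectSum.of (fun n ↦ symGrading D U n) n
      ⟨⟨_, homogeneousComponent_mem_symAlg D U n P.2⟩,
        MvPolynomial.homogeneousComponent_isHomogeneous n P.1⟩, Subtype.ext ?_⟩
    rw [map_sum]
    simp only [DirectSum.coeAddMonoidHom_of]
    rw [AddSubmonoidClass.coe_finsetSum]
    exact MvPolynomial.sum_homogeneousComponent P.1

noncomputable instance symGrading_gradedRing : GradedRing (symGrading D U) where
  toDecomposition := (symGrading_isInternal D U).chooseDecomposition

/-- Restriction of the symmetric algebra to a smaller open set. -/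
noncomputable def symRestrict {U V : X.Opens} [Nonempty U] [Nonempty V] (h : V ≤ U) :
    symGrading D U →+*ᵍ symGrading D V where
  __ := Subring.inclusion (show symAlg D U ≤ symAlg D V from fun _ hP m ↦ sections_anti _ h (hP m))
  map_mem hP := hP

/-- The structure map from the regular functions on `U` to the symmetric algebra. -/
noncomputable def symC : Γ(X, U) →+* symGrading D U 0 where
  toFun a := ⟨⟨MvPolynomial.C (X.germToFunctionField U a), fun m ↦ by
    rw [MvPolynomial.coeff_C]
    split_ifs with h
    · subst h; simpa using germ_mem_sections a
    · exact zero_mem _⟩, MvPolynomial.isHomogeneous_C _ _⟩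
  map_one' := by ext1; ext1; simp
  map_zero' := by ext1; ext1; simp
  map_mul' a b := by ext1; ext1; simp
  map_add' a b := by ext1; ext1; simp

end SymAlg
end RuledDoubleCover

namespace RuledDoubleCover
section ProjOverBase
variable {A B σ τ : Type u} [CommRing A] [CommRing B] [SetLike σ A] [AddSubgroupClass σ A]
  [SetLike τ B] [AddSubgroupClass τ B] {𝒜 : ℕ → σ} {ℬ : ℕ → τ} [GradedRing 𝒜] [GradedRing ℬ]

theorem projMap_toSpecZero (φ : 𝒜 →+*ᵍ ℬ) (hφ : HomogeneousIdeal.irrelevant ℬ ≤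
      (HomogeneousIdeal.irrelevant 𝒜).map φ) :
    Proj.map φ hφ ≫ Proj.toSpecZero 𝒜 =
      Proj.toSpecZero ℬ ≫ Spec.map (CommRingCat.ofHom φ.gradedZeroRingHom) := by
  refine (Proj.mapAffineOpenCover φ hφ).openCover.hom_ext _ _ fun s ↦ ?_
  obtain ⟨⟨m, hm⟩, ⟨t, ht⟩⟩ := s
  replace ht : t ∈ 𝒜 m := ht
  change Proj.awayι ℬ (φ t) (φ.2 ht) hm ≫ _ = Proj.awayι ℬ (φ t) (φ.2 ht) hm ≫ _
  rw [Proj.awayι_comp_map_assoc φ hφ hm _ ht, Proj.awayι_toSpecZero,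
    Proj.awayι_toSpecZero_assoc, ← Spec.map_comp, ← Spec.map_comp]
  congr 1
  ext c
  change Localization.mk (φ c) ⟨φ 1, _⟩ = Localization.mk (φ c) 1
  congr 1
  exact Subtype.ext (map_one φ)

end ProjOverBase

section Charts
variable (X : Scheme.{u})

/-- Nonempty affine open subsets of `X`, ordered by inclusion as basic open subsets. -/
abbrev ChartIndex : Type u := {U : X.AffineZariskiSite // Nonempty U.toOpens}

instance (U : ChartIndex X) : Nonempty U.1.toOpens := U.2

variable {X} in
theorem ChartIndex.le {U V : ChartIndex X} (h : V ≤ U) : V.1.toOpens ≤ U.1.toOpens :=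
  Scheme.AffineZariskiSite.toOpens_mono h

/-- The cover of a scheme by its nonempty affine open subsets. -/
noncomputable abbrev chartCover : X.OpenCover where
  I₀ := ChartIndex X
  X U := U.1.toOpens
  f U := U.1.toOpens.ι
  mem₀ := by
    rw [Scheme.presieve₀_mem_precoverage_iff]
    refine ⟨fun x ↦ ?_, inferInstance⟩
    obtain ⟨U, hxU⟩ := TopologicalSpace.Opens.mem_iSup.mp
      ((iSup_affineOpens_eq_top X).ge (Set.mem_univ x))
    exact ⟨⟨U, ⟨x, hxU⟩⟩, ⟨x, hxU⟩, rfl⟩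

theorem chartCover_directed {U V : ChartIndex X}
    (x : ↥(pullback U.1.toOpens.ι V.1.toOpens.ι)) :
    ∃ (W : ChartIndex X) (hU : W ≤ U) (hV : W ≤ V) (y : W.1.toOpens),
      pullback.lift (X.homOfLE (ChartIndex.le hU)) (X.homOfLE (ChartIndex.le hV))
        (by simp) y = x := by
  let a := (pullback.fst U.1.toOpens.ι V.1.toOpens.ι ≫ U.1.toOpens.ι) x
  have haU : a ∈ U.1.toOpens := (pullback.fst U.1.toOpens.ι V.1.toOpens.ι x).2
  have haV : a ∈ V.1.toOpens := by
    unfold a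
    rw [pullback.condition]
    exact (pullback.snd U.1.toOpens.ι V.1.toOpens.ι x).2
  obtain ⟨f, g, e, hxf⟩ := exists_basicOpen_le_affine_inter U.1.2 V.1.2 _ ⟨haU, haV⟩
  let W : ChartIndex X := ⟨U.1.basicOpen f, ⟨a, hxf⟩⟩
  have hWU : W ≤ U := U.1.basicOpen_le f
  have hWV : W ≤ V := ⟨g, e.symm⟩
  have haW : a ∈ W.1.toOpens := hxf
  refine ⟨W, hWU, hWV, ⟨a, haW⟩, ?_⟩
  apply (pullback.fst U.1.toOpens.ι V.1.toOpens.ι ≫ U.1.toOpens.ι).isOpenEmbedding.injective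
  refine (Scheme.Hom.comp_apply (pullback.lift _ _ _) _ _).symm.trans ?_
  rw [pullback.lift_fst_assoc, Scheme.homOfLE_ι]
  rfl

noncomputable instance : (chartCover X).LocallyDirected where
  trans f := X.homOfLE (ChartIndex.le f.le)
  trans_id U := by simp
  trans_comp f g := by simp
  w f := by simp
  directed {U V} x := by
    obtain ⟨W, hU, hV, y, hy⟩ := chartCover_directed X x
    exact ⟨W, homOfLE hU, homOfLE hV, y, hy⟩

end Charts

section RuledSurface
variable {X : Scheme.{u}} [IsNonsingularCurve X] (D : Divisor X)

theorem symRestrict_val {U V : X.Opens} [Nonempty U] [Nonempty V] (h : V ≤ U) (P : symAlg D U) :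
    (symRestrict D h P).1 = P.1 := rfl

theorem symRestrict_injective {U V : X.Opens} [Nonempty U] [Nonempty V] (h : V ≤ U) :
    Function.Injective (symRestrict D h) := by
  intro P Q e
  refine Subtype.ext ?_
  rw [← symRestrict_val D h, e, symRestrict_val]

theorem symC_val (U : X.Opens) [Nonempty U] (a : Γ(X, U)) :
    (symC D U a).1.1 = MvPolynomial.C (X.germToFunctionField U a) := rfl

theorem symRestrict_symC {U V : X.Opens} [Nonempty U] [Nonempty V] (h : V ≤ U) (a : Γ(X, U)) :
    symRestrict D h (symC D U a) = symC D V (X.presheaf.map (homOfLE h).op a) := by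
  refine Subtype.ext ?_
  rw [symRestrict_val, symC_val, symC_val]
  congr 1
  exact (X.presheaf.germ_res_apply (homOfLE h) _ _ a).symm

theorem exists_pow_mul_eq_symRestrict {U V : X.Opens} [Nonempty U] [Nonempty V] (h : V ≤ U)
    (a : Γ(X, U)) (ha : X.basicOpen a = V) (n : ℕ) (P : symAlg D V) (hP : P ∈ symGrading D V n) :
    ∃ N : ℕ, ∃ Q ∈ symGrading D U n,
      symRestrict D h (symC D U a) ^ N * P = symRestrict D h Q := by
  have ha0 : a ≠ 0 := by
    rintro rfl
    obtain ⟨x, hx⟩ := ‹Nonempty V›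
    rw [← ha] at hx
    simp at hx
  have hc : ∀ m, ∃ N : ℕ, ∀ M ≥ N, X.germToFunctionField U a ^ M * P.1.coeff m ∈
      (m 1 • D).sections U := fun m ↦ by
    refine exists_pow_mul_mem_sections (m 1 • D) a ha0 ?_
    rw [ha]
    exact (mem_symAlg D _).mp P.2 m
  choose N hN using hc
  have key : MvPolynomial.C (X.germToFunctionField U a) ^ P.1.support.sup N * P.1 ∈
      symAlg D U := by
    intro m
    rw [← map_pow, MvPolynomial.coeff_C_mul]
    by_cases hm : m ∈ P.1.support
    · exact hN m _ (Finset.le_sup hm)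
    · rw [MvPolynomial.notMem_support_iff.mp hm, mul_zero]
      exact zero_mem _
  refine ⟨P.1.support.sup N, ⟨_, key⟩, ?_, ?_⟩
  · rw [mem_symGrading] at hP ⊢
    have := (MvPolynomial.isHomogeneous_C (Fin 2)
      (X.germToFunctionField U a ^ P.1.support.sup N)).mul hP
    rw [zero_add, map_pow] at this
    exact this
  · apply Subtype.ext
    rw [Subring.coe_mul, Subring.coe_pow, symRestrict_val, symRestrict_val, symC_val]

theorem exists_symC_mul_eq_one {U V : X.Opens} [Nonempty U] [Nonempty V] (h : V ≤ U)
    (a : Γ(X, U)) (ha : X.basicOpen a = V) :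
    ∃ u : symGrading D V 0, symRestrict D h (symC D U a) * (u : symAlg D V) = 1 := by
  have hu : IsUnit (X.presheaf.map (homOfLE h).op a) := by
    subst ha
    exact RingedSpace.isUnit_res_basicOpen _ a
  obtain ⟨b, hb⟩ := hu.exists_right_inv
  refine ⟨symC D V b, ?_⟩
  rw [symRestrict_symC, ← SetLike.GradeZero.coe_mul, ← map_mul, hb, map_one,
    SetLike.GradeZero.coe_one]

theorem irrelevant_le_map_symRestrict {U V : ChartIndex X} (h : V ≤ U) :
    HomogeneousIdeal.irrelevant (symGrading D V.1.toOpens) ≤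
      (HomogeneousIdeal.irrelevant (symGrading D U.1.toOpens)).map
        (symRestrict D (ChartIndex.le h)) := by
  obtain ⟨a, ha⟩ := id h
  obtain ⟨u, hu⟩ := exists_symC_mul_eq_one D (ChartIndex.le h) a ha
  rw [← toIdeal_le_toIdeal_iff, HomogeneousIdeal.toIdeal_irrelevant_le]
  intro i hi P hP
  obtain ⟨N, Q, hQ, e⟩ := exists_pow_mul_eq_symRestrict D (ChartIndex.le h) a ha i P hP
  have hPQ : P = (u : symAlg D V.1.toOpens) ^ N * symRestrict D (ChartIndex.le h) Q := by
    rw [← e, ← mul_assoc, ← mul_pow, mul_comm (u : symAlg D V.1.toOpens), hu, one_pow, one_mul]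
  rw [hPQ]
  refine Ideal.mul_mem_left _ _ (Ideal.mem_map_of_mem _ ?_)
  exact HomogeneousIdeal.mem_irrelevant_of_mem _ hi hQ

/-- The projective line bundle `P(O ⊕ O(D))` over an affine open subset. -/
noncomputable def chartProj (U : ChartIndex X) :
    Proj (symGrading D U.1.toOpens) ⟶ U.1.toOpens.toScheme :=
  Proj.toSpecZero _ ≫ Spec.map (CommRingCat.ofHom (symC D U.1.toOpens)) ≫ U.1.2.isoSpec.inv

/-- The transition map between the projective line bundles over two affine open subsets. -/
noncomputable def chartMap {U V : ChartIndex X} (h : V ≤ U) :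
    Proj (symGrading D V.1.toOpens) ⟶ Proj (symGrading D U.1.toOpens) :=
  Proj.map (symRestrict D (ChartIndex.le h)) (irrelevant_le_map_symRestrict D h)

theorem chartProj_ι (U : ChartIndex X) : chartProj D U ≫ U.1.toOpens.ι =
    Proj.toSpecZero _ ≫ Spec.map (CommRingCat.ofHom (symC D U.1.toOpens)) ≫ U.1.2.fromSpec := by
  rw [chartProj, Category.assoc, Category.assoc]
  rfl

theorem chartMap_chartProj {U V : ChartIndex X} (h : V ≤ U) :
    chartMap D h ≫ chartProj D U = chartProj D V ≫ X.homOfLE (ChartIndex.le h) := by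
  rw [← cancel_mono U.1.toOpens.ι, Category.assoc, Category.assoc, Scheme.homOfLE_ι,
    chartProj_ι, chartProj_ι, chartMap, ← Category.assoc, projMap_toSpecZero, Category.assoc,
    ← U.1.2.map_fromSpec V.1.2 (homOfLE (ChartIndex.le h)).op, ← Spec.map_comp_assoc,
    ← Spec.map_comp_assoc]
  congr 3
  refine CommRingCat.hom_ext (RingHom.ext fun a ↦ Subtype.ext ?_)
  exact symRestrict_symC D (ChartIndex.le h) a

theorem isPullback_chartMap {U V : ChartIndex X} (h : V ≤ U) :
    IsOpenImmersion (chartMap D h) ∧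
    IsPullback (chartMap D h) (chartProj D V) (chartProj D U) (X.homOfLE (ChartIndex.le h)) := by
  obtain ⟨a, ha⟩ := id h
  obtain ⟨u, hu⟩ := exists_symC_mul_eq_one D (ChartIndex.le h) a ha
  obtain ⟨h1, h2⟩ := projMap_isOpenImmersion (symRestrict D (ChartIndex.le h))
    (irrelevant_le_map_symRestrict D h) (symRestrict_injective D _) (symC D U.1.toOpens a) u hu
    (exists_pow_mul_eq_symRestrict D (ChartIndex.le h) a ha)
  have : IsOpenImmersion (chartMap D h) := h1
  refine ⟨h1, (IsOpenImmersion.isPullback _ _ _ _ (chartMap_chartProj D h) ?_).flip⟩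
  ext p
  refine Iff.trans ?_ (h2 p).symm
  have e1 : chartProj D U p ∈ (X.homOfLE (ChartIndex.le h)).opensRange ↔
      (chartProj D U ≫ U.1.toOpens.ι) p ∈ V.1.toOpens := by
    rw [Scheme.opensRange_homOfLE]
    rfl
  refine e1.trans ?_
  have e2 := U.1.2.fromSpec_preimage_basicOpen a
  have ha' : X.basicOpen a = V.1.toOpens := ha
  rw [chartProj_ι, ← ha']
  have e3 := SetLike.ext_iff.mp e2
    (Spec.map (CommRingCat.ofHom (symC D U.1.toOpens)) (Proj.toSpecZero _ p))
  exact e3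

/-- The gluing datum of the projective bundle `P(O ⊕ O(D))`. -/
noncomputable def ruledGluing : (chartCover X).RelativeGluingData where
  functor :=
    { obj U := Proj (symGrading D U.1.toOpens)
      map f := chartMap D f.le
      map_id U := Proj.map_id
      map_comp f g := by
        exact Proj.map_comp (symRestrict D (ChartIndex.le g.le)) (symRestrict D (ChartIndex.le f.le))
          (irrelevant_le_map_symRestrict D g.le) (irrelevant_le_map_symRestrict D f.le) }
  natTrans :=
    { app U := chartProj D U
      naturality _ _ f := chartMap_chartProj D f.le }
  equifibered _ _ f := (isPullback_chartMap D f.le).2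

/-- The ruled surface `P(O ⊕ O(D))` over the curve `X`. -/
noncomputable def ruledSurface : Scheme.{u} := (ruledGluing D).glued

/-- The ruling `P(O ⊕ O(D)) ⟶ X`. -/
noncomputable def ruling : ruledSurface D ⟶ X := (ruledGluing D).toBase

/-- The open immersion of the part of the ruled surface that lies over an affine open subset. -/
noncomputable def ruledChart (U : ChartIndex X) :
    Proj (symGrading D U.1.toOpens) ⟶ ruledSurface D := (ruledGluing D).cover.f U

instance (U : ChartIndex X) : IsOpenImmersion (ruledChart D U) :=
  (ruledGluing D).cover.map_prop U

end RuledSurface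
end RuledDoubleCover

namespace RuledDoubleCover

section LinearSystems

/-- Linear equivalence of effective Cartier divisors given by ideal sheaves `I` and `J`:
`I` and `J` are isomorphic as sheaves of modules, that is, there are linear isomorphisms between
their sections over all affine open sets which are compatible with restriction. -/
def IdealSheafIso {S : Scheme.{u}} (I J : S.IdealSheafData) : Prop :=
  ∃ e : ∀ U : S.affineOpens, I.ideal U ≃ₗ[Γ(S, U)] J.ideal U,
    ∀ (U V : S.affineOpens) (h : V.1 ≤ U.1) (f : I.ideal U) (g : I.ideal V),
      S.presheaf.map (homOfLE h).op f.1 = g.1 →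
        S.presheaf.map (homOfLE h).op (e U f).1 = (e V g).1

variable {X : Scheme.{u}} [IsNonsingularCurve X] (D : Divisor X)

/-- The element `h t` of degree one of the symmetric algebra, for a section `h` of `O(D)`. -/
noncomputable def symT (U : X.Opens) [Nonempty U] (h : D.sections U) : symAlg D U :=
  ⟨MvPolynomial.monomial (Finsupp.single 1 1) h.1, fun m ↦ by
    rw [MvPolynomial.coeff_monomial]
    split_ifs with e
    · subst e; simp
    · exact zero_mem _⟩

/-- The complement of the curve `t = 0` in the ruled surface `P(O s ⊕ O(D) t)`. -/
noncomputable def infinityCompl : (ruledSurface D).Opens :=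
  ⨆ (U : ChartIndex X) (h : D.sections U.1.toOpens),
    ruledChart D U ''ᵁ Proj.basicOpen (symGrading D U.1.toOpens) (symT D U.1.toOpens h)

/-- The curve `X₁ : t = 0` in the ruled surface `P(O s ⊕ O(D) t)` (with the reduced structure). It is
the section of the ruling that corresponds to the quotient `O ⊕ O(D) ⟶ O`, and it is
linearly equivalent to `X₀ - D f`, where `X₀` is the section `s = 0`. -/
noncomputable def sectionOne : (ruledSurface D).IdealSheafData :=
  Scheme.IdealSheafData.vanishingIdeal (infinityCompl D).compl

/-- The complete linear system `|2 X₁|`. -/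
def linearSystemTwoXOne : Set (ruledSurface D).IdealSheafData :=
  {C | IdealSheafIso C (sectionOne D ^ 2)}

end LinearSystems

section Covers

/-- The branch locus of a morphism: the images of the points at which it is ramified. -/
def branchLocus {C X : Scheme.{u}} (γ : C ⟶ X) : Set X :=
  {x | ∃ c : C, γ c = x ∧ ¬ (γ.stalkMap c).hom.FormallyUnramified}

/-- A `2:1` map onto `X` from an integral scheme: a finite surjective morphism of degree two. -/
structure IsTwoToOne {C X : Scheme.{u}} [IsIntegral C] (γ : C ⟶ X) : Prop where
  finite : IsFinite γ
  surjective : Surjective γ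
  degree : γ.residueDegree (genericPoint C) = 2

variable {X : Scheme.{u}} [IsNonsingularCurve X] {D : Divisor X}

/-- The restriction of the ruling to a closed subscheme of the ruled surface. -/
noncomputable def restrictedRuling (C : (ruledSurface D).IdealSheafData) : C.subscheme ⟶ X :=
  C.subschemeι ≫ ruling D

/-- Integral curves in the linear system `|2 X₁|` on which the ruling is a `2:1` map with branch
locus `B`. -/
structure IsDoubleCoverWithBranch (C : (ruledSurface D).IdealSheafData)
    (B : Finset (PrimeDivisor X)) : Prop where
  mem_linearSystem : C ∈ linearSystemTwoXOne D
  isIntegral : IsIntegral C.subscheme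
  isTwoToOne : IsTwoToOne (restrictedRuling C)
  branchLocus_eq : branchLocus (restrictedRuling C) = Subtype.val '' (B : Set (PrimeDivisor X))

end Covers

section Curves
variable {X : Scheme.{u}} [IsNonsingularCurve X]

/-- The degree of a divisor (on a curve over an algebraically closed field). -/
def Divisor.degree (D : Divisor X) : ℤ := D.sum fun _ n ↦ n

/-- The reduced divisor of a finite set of points. -/
noncomputable def Divisor.ofPoints (B : Finset (PrimeDivisor X)) : Divisor X :=
  ∑ x ∈ B, Finsupp.single x 1

/-- Linear equivalence of divisors. -/
def LinearlyEquivalent (D E : Divisor X) : Prop :=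
  ∃ f : X.functionField, f ≠ 0 ∧ ∀ x : PrimeDivisor X, Scheme.ord f x.1 = D x - E x

variable {k : Type u} [Field k] (p : X ⟶ Spec (.of k))

/-- The function field of `X`, as an extension of the base field. -/
def FunctionFieldOver (_ : X ⟶ Spec (.of k)) : Type u := X.functionField

noncomputable instance : Field (FunctionFieldOver p) := inferInstanceAs (Field X.functionField)

noncomputable instance : Algebra k (FunctionFieldOver p) :=
  have : Nonempty (⊤ : X.Opens) := ⟨⟨genericPoint X, trivial⟩⟩
  (RingHom.comp (X.germToFunctionField ⊤).hom
    (RingHom.comp p.appTop.hom (Scheme.ΓSpecIso (.of k)).inv.hom)).toAlgebra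

/-- The rational functions that are regular at `x`. -/
noncomputable def regularAt (x : X) : Subring (FunctionFieldOver p) :=
  (algebraMap (X.presheaf.stalk x) X.functionField).range

/-- The vector space of rational differentials which are regular everywhere. -/
noncomputable def regularDifferentials : Submodule k Ω[FunctionFieldOver p⁄k] :=
  ⨅ x : X, Submodule.span k
    {ω | ∃ a ∈ regularAt p x, ∃ b ∈ regularAt p x, ω = a • KaehlerDifferential.D k _ b}

/-- The genus: the dimension of the space of regular differentials. -/
noncomputable def genus : ℕ := Module.finrank k (regularDifferentials p)

/-- `K` is the divisor of a nonzero rational differential `ω`: if `t` is a uniformizer at `x`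
and `ω = f dt`, then `K` has multiplicity `ord f` at `x`. -/
def IsCanonicalDivisor (K : Divisor X) : Prop :=
  ∃ ω : Ω[FunctionFieldOver p⁄k], ω ≠ 0 ∧ ∀ (x : PrimeDivisor X) (t : FunctionFieldOver p),
    Scheme.ord (X := X) t x.1 = 1 →
      ∃ f : FunctionFieldOver p, f ≠ 0 ∧ ω = f • KaehlerDifferential.D k _ t ∧
        Scheme.ord (X := X) f x.1 = K x

/-- `b` is nonspecial: `K - b` has no nonzero global sections, for `K` canonical. -/
def IsNonspecial (b : Divisor X) : Prop :=
  ∀ K : Divisor X, IsCanonicalDivisor p K → (K - b).sections ⊤ = ⊥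

end Curves
end RuledDoubleCover

open RuledDoubleCover

set_option linter.unusedSectionVars false


/-! Write D = K - b, so that the surface is P(O s ⊕ O(D) t) and X₁ is the curve t = 0, and put θ =
t/s. A curve in |2X₁| is cut out by a quadratic equation g₀θ² + g₁θ + g₂ = 0 whose coefficient gᵢ is
a global section of O(-iD) (`exists_equation`). If the curve C is integral and 2:1 over X, then θ is
not in k(X), so g₀ ≠ 0. As a global function on a proper curve over an algebraically closed field,
g₀ is a nonzero constant. Hence C misses the section s = 0. Since 2 is invertible the square can be
completed: ρ = θ + g₁/(2g₀) satisfies ρ² = δ with δ in k(X), and the functions on C are O ⊕ O(D)ρ.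
This is the content of `exists_isSqrtCover`, and `IsSqrtCover` packages the result.

The cover is then controlled by δ alone. Where h generates O(D), the coordinate ring of C is A ⊕ A y
with y = hρ and y² = d = δh². It is ramified exactly where d is not a unit, so the branch locus is
the support of div δ - 2D (`mem_branchLocus_iff`). If that divisor is reduced, A ⊕ A y is integrally
closed and C is nonsingular (`isNonsingularCurve`). Multiplying δ by the square of an everywhere
invertible function does not change the cover (`exists_iso`).

Existence: by hypothesis there is f with div f = B + 2D. It is not a square: a square root g would
have 2 div g = B + 2D with B reduced, forcing div g = D, and g⁻¹ would be a nonzero section of O(K -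
b) (`sq_ne_of_isNonspecial`). So θ = √f generates a quadratic extension of k(X), and the closure of
the point t/s = √f is the required curve. It is linearly equivalent to 2X₁ because 1 - f/(t/s)² has
divisor C - 2X₁ (`ker_affinePoint_mem_linearSystem`).

Uniqueness: if the branch locus is B, then div δ - 2D is effective and contains B, so δ/f is a
global regular function, hence a constant, hence a square (`exists_sq_mul_eq`). Two such covers
therefore differ by a constant square and are isomorphic over X.

Throughout, functions on different open sets are compared inside one field L, by evaluating them
with `evalAt` at an L-valued point. If the point is dominant, nothing is lost. Linear equivalence
then becomes multiplication by an element of L, and an isomorphism over X becomes an equality of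
subrings of L. -/

namespace RuledDoubleCover
-- Evaluation of functions at ring-valued and field-valued points
section EvalAt
variable {S T : Scheme.{u}} {R L : Type u} [CommRing R] [Field L]

/-- The value of a section over `W` at an `R`-valued point which lies in `W`. -/
noncomputable def evalAt (ψ : Spec (.of R) ⟶ S) (W : S.Opens) (h : ⊤ ≤ ψ ⁻¹ᵁ W) : Γ(S, W) →+* R :=
  (ψ.appLE W ⊤ h ≫ (Scheme.ΓSpecIso (.of R)).hom).hom

theorem evalAt_res (ψ : Spec (.of R) ⟶ S) {V W : S.Opens} (hV : ⊤ ≤ ψ ⁻¹ᵁ V) (hW : ⊤ ≤ ψ ⁻¹ᵁ W)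
    (i : Opposite.op W ⟶ Opposite.op V) (f : Γ(S, W)) :
    evalAt ψ V hV (S.presheaf.map i f) = evalAt ψ W hW f := by
  rw [evalAt, evalAt, ← Scheme.Hom.map_appLE ψ hV i]
  rfl

theorem evalAt_comp (ψ : Spec (.of R) ⟶ S) (g : S ⟶ T) (W : T.Opens) (h : ⊤ ≤ (ψ ≫ g) ⁻¹ᵁ W)
    (h' : ⊤ ≤ ψ ⁻¹ᵁ g ⁻¹ᵁ W) (f : Γ(T, W)) :
    evalAt (ψ ≫ g) W h f = evalAt ψ (g ⁻¹ᵁ W) h' (g.app W f) := by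
  rw [evalAt, evalAt, Scheme.Hom.comp_appLE]
  rfl

theorem evalAt_congr {ψ ψ' : Spec (.of R) ⟶ S} (e : ψ = ψ') {W : S.Opens} (h : ⊤ ≤ ψ ⁻¹ᵁ W)
    (h' : ⊤ ≤ ψ' ⁻¹ᵁ W) (f : Γ(S, W)) : evalAt ψ W h f = evalAt ψ' W h' f := by
  subst e; rfl

theorem evalAt_specMap {R' : Type u} [CommRing R'] (φ : R →+* R') (ψ : Spec (.of R) ⟶ S)
    (W : S.Opens) (h : ⊤ ≤ ψ ⁻¹ᵁ W) (h' : ⊤ ≤ (Spec.map (CommRingCat.ofHom φ) ≫ ψ) ⁻¹ᵁ W)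
    (f : Γ(S, W)) :
    evalAt (Spec.map (CommRingCat.ofHom φ) ≫ ψ) W h' f = φ (evalAt ψ W h f) := by
  have : (Spec.map (CommRingCat.ofHom φ) ≫ ψ).appLE W ⊤ h' ≫ (Scheme.ΓSpecIso (.of R')).hom =
      (ψ.appLE W ⊤ h ≫ (Scheme.ΓSpecIso (.of R)).hom) ≫ CommRingCat.ofHom φ := by
    rw [Category.assoc, ← Scheme.ΓSpecIso_naturality, ← Category.assoc]
    congr 1
  exact congr($this f)

theorem evalAt_bijective (ψ : Spec (.of R) ⟶ S) [IsOpenImmersion ψ]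
    (h : ⊤ ≤ ψ ⁻¹ᵁ ψ.opensRange) : Function.Bijective (evalAt ψ ψ.opensRange h) := by
  have : IsIso (ψ.appLE ψ.opensRange ⊤ h) := by
    rw [Scheme.Hom.appLE]
    have : IsIso (ψ.app ψ.opensRange) := Scheme.Hom.isIso_app ψ _ le_rfl
    have e : ψ ⁻¹ᵁ ψ.opensRange = ⊤ := top_le_iff.mp h
    have : IsIso (homOfLE h) := ⟨homOfLE e.le, rfl, rfl⟩
    infer_instance
  have h2 : IsIso (ψ.appLE ψ.opensRange ⊤ h ≫ (Scheme.ΓSpecIso (.of R)).hom) := inferInstance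
  exact ConcreteCategory.bijective_of_isIso _

/-- A map into an affine scheme is the same as a ring homomorphism, so a point landing in an affine
open set is recovered from its values. Equalities between points of the surface are proved this way.
-/
theorem specMap_evalAt_fromSpec (ψ : Spec (.of R) ⟶ S) {W : S.Opens} (hW : IsAffineOpen W)
    (h : ⊤ ≤ ψ ⁻¹ᵁ W) : Spec.map (CommRingCat.ofHom (evalAt ψ W h)) ≫ hW.fromSpec = ψ := by
  have : CommRingCat.ofHom (evalAt ψ W h) = ψ.appLE W ⊤ h ≫ (Scheme.ΓSpecIso (.of R)).hom := rfl
  rw [this, Spec.map_comp, Category.assoc, hW.SpecMap_appLE_fromSpec ψ (isAffineOpen_top _)]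
  rw [IsAffineOpen.fromSpec_top, SpecMap_ΓSpecIso_hom, ← Category.assoc, Scheme.toSpecΓ_isoSpec_inv,
    Category.id_comp]

theorem isUnit_evalAt_iff (ψ : Spec (.of R) ⟶ S) (W : S.Opens) (h : ⊤ ≤ ψ ⁻¹ᵁ W) (f : Γ(S, W)) :
    IsUnit (evalAt ψ W h f) ↔ ⊤ ≤ ψ ⁻¹ᵁ S.basicOpen f := by
  have e : evalAt ψ W h f =
    (Scheme.ΓSpecIso (.of R)).commRingCatIsoToRingEquiv (ψ.appLE W ⊤ h f) := rfl
  have e2 := Scheme.basicOpen_appLE ψ ⊤ W h f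
  rw [top_inf_eq] at e2
  rw [e, MulEquiv.isUnit_map, ← e2]
  constructor
  · intro hu
    rw [Scheme.basicOpen_of_isUnit _ hu]
  · intro hu
    refine RingedSpace.isUnit_of_isUnit_germ _ _ _ fun x hx ↦ ?_
    exact (Scheme.mem_basicOpen _ _ x hx).mp (hu hx)

theorem evalAt_ne_zero_iff (ψ : Spec (.of L) ⟶ S) (W : S.Opens) (h : ⊤ ≤ ψ ⁻¹ᵁ W) (f : Γ(S, W)) :
    evalAt ψ W h f ≠ 0 ↔ ⊤ ≤ ψ ⁻¹ᵁ S.basicOpen f := by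
  rw [← isUnit_evalAt_iff ψ W h, isUnit_iff_ne_zero]

instance subsingleton_spec_field : Subsingleton (Spec (.of L)) :=
  inferInstanceAs (Subsingleton (PrimeSpectrum L))

theorem top_le_preimage_of_mem (ψ : Spec (.of L) ⟶ S) {W : S.Opens} {x : Spec (.of L)}
    (h : ψ x ∈ W) : ⊤ ≤ ψ ⁻¹ᵁ W := by
  intro y _
  rwa [Subsingleton.elim y x]

theorem top_le_preimage (ψ : Spec (.of L) ⟶ S) [IsDominant ψ] (W : S.Opens) [hW : Nonempty W] :
    ⊤ ≤ ψ ⁻¹ᵁ W := by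
  obtain ⟨w⟩ := hW
  obtain ⟨x, hx⟩ := ψ.denseRange.exists_mem_open W.isOpen ⟨w.1, w.2⟩
  exact top_le_preimage_of_mem ψ hx

/-- The locus where a nonzero function on an integral scheme does not vanish is a nonempty open set,
which a dominant point must meet. -/
theorem evalAt_injective [IsIntegral S] (ψ : Spec (.of L) ⟶ S) [IsDominant ψ] (W : S.Opens)
    (h : ⊤ ≤ ψ ⁻¹ᵁ W) : Function.Injective (evalAt ψ W h) := by
  rw [injective_iff_map_eq_zero]
  intro f hf
  by_contra hne
  have hb : S.basicOpen f ≠ ⊥ := fun e ↦ hne (by rwa [basicOpen_eq_bot_iff] at e)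
  have : Nonempty (S.basicOpen f) := by
    obtain ⟨x, hx⟩ := (Opens.ne_bot_iff_nonempty _).mp hb
    exact ⟨x, hx⟩
  exact (evalAt_ne_zero_iff ψ W h f).mpr (top_le_preimage ψ _) hf

end EvalAt

/-! ### Linear equivalence of ideal sheaves as multiplication by an element of a field -/

theorem exists_res_eq_pow_mul {S : Scheme.{u}} (J : S.IdealSheafData) (W : S.affineOpens)
    (r : Γ(S, W.1)) (c : Γ(S, S.basicOpen r)) (hc : c ∈ J.ideal (S.affineBasicOpen r)) :
    ∃ n : ℕ, ∃ a ∈ J.ideal W, S.presheaf.map (homOfLE (S.basicOpen_le r)).op a =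
      S.presheaf.map (homOfLE (S.basicOpen_le r)).op r ^ n * c := by
  have := W.2.isLocalization_basicOpen r
  rw [← J.map_ideal_basicOpen] at hc
  obtain ⟨⟨a, ⟨_, n, rfl⟩⟩, h⟩ :=
    (IsLocalization.mem_map_algebraMap_iff (Submonoid.powers r) Γ(S, S.basicOpen r)).mp hc
  refine ⟨n, a.1, a.2, ?_⟩
  rw [← map_pow, mul_comm]
  exact h.symm

section LinearEquivalence
variable {S : Scheme.{u}} [IsIntegral S] {L : Type u} [Field L] (ψ : Spec (.of L) ⟶ S)
  [IsDominant ψ]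

/-- Quantifying the hypothesis over `h` admits the empty open set: no `h` exists there, but the ring
of sections is zero. -/
theorem evalAt_eq_imp (φ : L) (hφ : φ ≠ 0) {W : S.Opens} {a b : Γ(S, W)}
    (H : ∀ h, evalAt ψ W h a * φ = evalAt ψ W h b * φ) : a = b := by
  by_cases hW : Nonempty W
  · exact evalAt_injective ψ W (top_le_preimage ψ W) (mul_right_cancel₀ hφ (H _))
  · have : W = ⊥ := by
      by_contra hne
      obtain ⟨x, hx⟩ := (Opens.ne_bot_iff_nonempty _).mp hne
      exact hW ⟨x, hx⟩
    subst this
    exact Subsingleton.elim _ _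

/-- Membership of φ·a in the image of `I` can be tested locally. The functions r on W such that rφa
comes from `I.ideal W` form an ideal; the hypothesis on the cover puts into it functions whose
nonvanishing loci cover W, so it contains 1. -/
theorem exists_evalAt_eq_mul_of_cover {I J : S.IdealSheafData} (φ : L) {ι : Type*}
    (V : ι → S.affineOpens) (hV : ⨆ i, (V i).1 = ⊤)
    (H : ∀ i (h : ⊤ ≤ ψ ⁻¹ᵁ (V i).1), ∀ a ∈ J.ideal (V i), ∃ b ∈ I.ideal (V i),
      evalAt ψ _ h b = evalAt ψ _ h a * φ) (W : S.affineOpens) (a : Γ(S, W)) (ha : a ∈ J.ideal W) :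
    ∃ b ∈ I.ideal W, ∀ h, evalAt ψ _ h b = evalAt ψ _ h a * φ := by
  by_cases hW : Nonempty W.1
  swap
  · have : ∀ h : ⊤ ≤ ψ ⁻¹ᵁ W.1, False := fun h ↦
      hW ⟨⟨_, h (x := (⊥ : PrimeSpectrum L)) trivial⟩⟩
    exact ⟨0, zero_mem _, fun h ↦ (this h).elim⟩
  have hW' := top_le_preimage ψ W.1
  let T : Ideal Γ(S, W.1) :=
    { carrier := {r | ∃ b ∈ I.ideal W, evalAt ψ _ hW' b = evalAt ψ _ hW' r * (evalAt ψ _ hW' a * φ)}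
      zero_mem' := ⟨0, zero_mem _, by simp⟩
      add_mem' := by
        rintro r s ⟨b, hb, e⟩ ⟨c, hc, f⟩
        exact ⟨b + c, add_mem hb hc, by rw [map_add, map_add, e, f, add_mul]⟩
      smul_mem' := by
        rintro c r ⟨b, hb, e⟩
        exact ⟨c * b, Ideal.mul_mem_left _ _ hb, by rw [smul_eq_mul, map_mul, map_mul, e, mul_assoc]⟩ }
  suffices hT : (1 : Γ(S, W.1)) ∈ T by
    obtain ⟨b, hb, e⟩ := hT
    exact ⟨b, hb, fun h ↦ by rw [e]; simp⟩
  have key : ∀ x : W.1, ∃ r : Γ(S, W.1), r ∈ T ∧ x.1 ∈ S.basicOpen r := by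
    rintro ⟨x, hxW⟩
    obtain ⟨i, hi⟩ := Opens.mem_iSup.mp (hV.ge (Set.mem_univ x))
    obtain ⟨r, r', e, hxr⟩ := exists_basicOpen_le_affine_inter W.2 (V i).2 _ ⟨hxW, hi⟩
    have hxr' : x ∈ S.basicOpen r' := e ▸ hxr
    have : Nonempty (V i).1 := ⟨x, hi⟩
    have : Nonempty (S.basicOpen r) := ⟨x, hxr⟩
    have hVi := top_le_preimage ψ (V i).1
    have hr := top_le_preimage ψ (S.basicOpen r)
    have hr' : ⊤ ≤ ψ ⁻¹ᵁ (S.basicOpen r') := e ▸ hr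
    have hle : S.basicOpen r' ≤ W.1 := e ▸ S.basicOpen_le r
    -- The hypothesis concerns sections over all of `V i`, whereas `a` is only available near x. A
    -- power of `r'` clears the denominator and is divided out again after multiplying by φ, since
    -- `r'` is invertible on its basic open set.
    obtain ⟨m, a', ha', ea'⟩ := exists_res_eq_pow_mul J (V i) r'
      (S.presheaf.map (homOfLE hle).op a) (J.ideal_le_comap_ideal (U := S.affineBasicOpen r') hle ha)
    obtain ⟨b', hb', eb'⟩ := H i hVi a' ha'
    have hunit : IsUnit (S.presheaf.map (homOfLE (S.basicOpen_le r')).op r') :=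
      RingedSpace.isUnit_res_basicOpen _ r'
    obtain ⟨v, hv⟩ := hunit.exists_left_inv
    have hb'' : v ^ m * S.presheaf.map (homOfLE (S.basicOpen_le r')).op b' ∈
        I.ideal (S.affineBasicOpen r') := Ideal.mul_mem_left _ _
      (I.ideal_le_comap_ideal (U := S.affineBasicOpen r') (S.basicOpen_le r') hb')
    have eb'' : evalAt ψ _ hr' (v ^ m * S.presheaf.map (homOfLE (S.basicOpen_le r')).op b') =
        evalAt ψ _ hW' a * φ := by
      have h1 := congrArg (evalAt ψ _ hr') ea'
      have h2 := congrArg (evalAt ψ _ hr') hv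
      simp only [map_mul, map_pow, evalAt_res ψ hr' hVi, evalAt_res ψ hr' hW', map_one] at h1 h2 ⊢
      rw [eb', h1, ← mul_assoc, ← mul_assoc, ← mul_pow, h2, one_pow, one_mul]
    have hb3 : ∃ c : Γ(S, S.basicOpen r), c ∈ I.ideal (S.affineBasicOpen r) ∧ evalAt ψ _ hr c = evalAt ψ _ hW' a * φ := by
      have e' : S.affineBasicOpen r = S.affineBasicOpen r' := Subtype.ext e
      have hr2 : ⊤ ≤ ψ ⁻¹ᵁ (S.affineBasicOpen r).1 := hr
      change ∃ c ∈ I.ideal (S.affineBasicOpen r), evalAt ψ _ hr2 c = _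
      revert hr2
      rw [e']
      exact fun hr2 ↦ ⟨_, hb'', eb''⟩
    obtain ⟨c, hc, ec⟩ := hb3
    obtain ⟨n, b, hb, eb⟩ := exists_res_eq_pow_mul I W r c hc
    refine ⟨r ^ n, ⟨b, hb, ?_⟩, ?_⟩
    · have h1 := congrArg (evalAt ψ _ hr) eb
      simp only [map_mul, map_pow, evalAt_res ψ hr hW'] at h1
      rw [h1, ec, map_pow]
    · refine (S.mem_basicOpen _ _ hxW).mpr ?_
      rw [map_pow]
      exact ((S.mem_basicOpen _ _ hxW).mp hxr).pow n
  choose r hr hxr using key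
  have : Ideal.span (Set.range r) = ⊤ := by
    rw [← W.2.self_le_iSup_basicOpen_iff]
    exact fun x hxV ↦ Opens.mem_iSup.mpr ⟨⟨_, _, rfl⟩, hxr ⟨x, hxV⟩⟩
  rw [← Ideal.eq_top_iff_one, eq_top_iff, ← this, Ideal.span_le]
  rintro _ ⟨x, rfl⟩
  exact hr x

/-- Multiplication by φ inside L is injective and compatible with restriction. The hypotheses `H`
and `H'` give, after globalization, that it carries J into I and that its inverse carries I into J.
-/
theorem idealSheafIso_of_cover {I J : S.IdealSheafData} (φ : L) (hφ : φ ≠ 0) {ι : Type*}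
    (V : ι → S.affineOpens) (hV : ⨆ i, (V i).1 = ⊤)
    (H : ∀ i (h : ⊤ ≤ ψ ⁻¹ᵁ (V i).1), ∀ a ∈ J.ideal (V i), ∃ b ∈ I.ideal (V i),
      evalAt ψ _ h b = evalAt ψ _ h a * φ)
    (H' : ∀ i (h : ⊤ ≤ ψ ⁻¹ᵁ (V i).1), ∀ b ∈ I.ideal (V i), ∃ a ∈ J.ideal (V i),
      evalAt ψ _ h b = evalAt ψ _ h a * φ) : IdealSheafIso I J := by
  have h1 := exists_evalAt_eq_mul_of_cover ψ φ V hV H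
  have h2 := exists_evalAt_eq_mul_of_cover ψ (I := J) (J := I) φ⁻¹ V hV fun i h b hb ↦ by
    obtain ⟨a, ha, e⟩ := H' i h b hb
    exact ⟨a, ha, by rw [e, mul_inv_cancel_right₀ hφ]⟩
  choose f hf hf' using h1
  choose g hg hg' using h2
  let F (W : S.affineOpens) : J.ideal W →ₗ[Γ(S, W)] I.ideal W :=
    { toFun a := ⟨f W a.1 a.2, hf W a.1 a.2⟩
      map_add' a b := Subtype.ext <| evalAt_eq_imp ψ 1 one_ne_zero fun h ↦ by
        simp only [Submodule.coe_add, map_add, hf']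
        ring
      map_smul' c a := Subtype.ext <| evalAt_eq_imp ψ 1 one_ne_zero fun h ↦ by
        simp only [Submodule.coe_smul, smul_eq_mul, map_mul, hf', RingHom.id_apply]
        ring }
  have hF (W : S.affineOpens) : Function.Bijective (F W) := by
    constructor
    · intro a b hab
      refine Subtype.ext (evalAt_eq_imp ψ φ hφ fun h ↦ ?_)
      rw [← hf' W a.1 a.2, ← hf' W b.1 b.2]
      exact congrArg (fun x : I.ideal W ↦ evalAt ψ _ h x.1) hab
    · intro b
      refine ⟨⟨g W b.1 b.2, hg W b.1 b.2⟩, Subtype.ext (evalAt_eq_imp ψ 1 one_ne_zero fun h ↦ ?_)⟩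
      change evalAt ψ _ h (f W _ _) * 1 = _
      rw [hf', hg', inv_mul_cancel_right₀ hφ, mul_one]
  refine ⟨fun W ↦ (LinearEquiv.ofBijective (F W) (hF W)).symm, fun U V h b c hbc ↦ ?_⟩
  obtain ⟨a, rfl⟩ := (hF U).2 b
  obtain ⟨d, rfl⟩ := (hF V).2 c
  have e1 : (LinearEquiv.ofBijective (F U) (hF U)).symm (F U a) = a :=
    (LinearEquiv.ofBijective (F U) (hF U)).symm_apply_apply a
  have e2 : (LinearEquiv.ofBijective (F V) (hF V)).symm (F V d) = d :=
    (LinearEquiv.ofBijective (F V) (hF V)).symm_apply_apply d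
  rw [e1, e2]
  refine evalAt_eq_imp ψ φ hφ fun hh ↦ ?_
  have hU : ⊤ ≤ ψ ⁻¹ᵁ U.1 := hh.trans (ψ.preimage_mono h)
  rw [evalAt_res ψ hh hU, ← hf' U a.1 a.2 hU, ← hf' V d.1 d.2 hh,
    ← evalAt_res ψ hh hU (homOfLE h).op]
  exact congrArg _ hbc

/-- Linearity gives b · e(b₀) = e(b b₀) = b₀ · e(b), so the ratio b / e(b) is the same for all
nonzero local sections b. Fixing one b₀ with e(b₀) ≠ 0 gives φ = b₀ / e(b₀); nonvanishing of J is
needed to choose it. -/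
theorem exists_evalAt_eq_mul_of_idealSheafIso {I J : S.IdealSheafData} (e : IdealSheafIso I J)
    (hJ : ∀ W : S.affineOpens, Nonempty W.1 → J.ideal W ≠ ⊥) :
    ∃ φ : L, φ ≠ 0 ∧ ∀ (W : S.affineOpens) (h : ⊤ ≤ ψ ⁻¹ᵁ W.1),
      (∀ a ∈ J.ideal W, ∃ b ∈ I.ideal W, evalAt ψ _ h b = evalAt ψ _ h a * φ) ∧
      ∀ b ∈ I.ideal W, ∃ a ∈ J.ideal W, evalAt ψ _ h b = evalAt ψ _ h a * φ := by
  obtain ⟨e, he⟩ := e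
  obtain ⟨_, ⟨W₀, hW₀, rfl⟩, hξ, -⟩ := S.isBasis_affineOpens.exists_subset_of_mem_open
    (Set.mem_univ (genericPoint S)) isOpen_univ
  let W₀ : S.affineOpens := ⟨W₀, hW₀⟩
  have : Nonempty W₀.1 := ⟨_, hξ⟩
  have h₀ := top_le_preimage ψ W₀.1
  obtain ⟨a₀, ha₀, hne⟩ := (Submodule.ne_bot_iff _).mp (hJ W₀ this)
  let b₀ : I.ideal W₀ := (e W₀).symm ⟨a₀, ha₀⟩
  have hb₀ : b₀.1 ≠ 0 := fun h ↦ hne <| by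
    have : b₀ = 0 := Subtype.ext h
    have := (LinearEquiv.symm_apply_eq (e W₀)).mp this
    rw [map_zero] at this
    exact congrArg Subtype.val this
  have hinj := evalAt_injective ψ W₀.1 h₀
  have hne' : evalAt ψ _ h₀ a₀ ≠ 0 := by rwa [Ne, map_eq_zero_iff _ hinj]
  have hb₀' : evalAt ψ _ h₀ b₀.1 ≠ 0 := by rwa [Ne, map_eq_zero_iff _ hinj]
  have key : ∀ (W : S.affineOpens) (h : ⊤ ≤ ψ ⁻¹ᵁ W.1) (b : I.ideal W),
      evalAt ψ _ h b.1 * evalAt ψ _ h₀ a₀ = evalAt ψ _ h (e W b).1 * evalAt ψ _ h₀ b₀.1 := by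
    intro W h b
    obtain ⟨_, ⟨V, hV, rfl⟩, hξ', hVle⟩ := S.isBasis_affineOpens.exists_subset_of_mem_open
      (show ψ (⊥ : PrimeSpectrum L) ∈ W.1 ⊓ W₀.1 from ⟨h trivial, h₀ trivial⟩) (W.1 ⊓ W₀.1).isOpen
    let V : S.affineOpens := ⟨V, hV⟩
    have hVW : V.1 ≤ W.1 := fun x hx ↦ (hVle hx).1
    have hVW₀ : V.1 ≤ W₀.1 := fun x hx ↦ (hVle hx).2
    have hV' : ⊤ ≤ ψ ⁻¹ᵁ V.1 := top_le_preimage_of_mem ψ hξ'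
    let b' : I.ideal V := ⟨_, I.ideal_le_comap_ideal hVW b.2⟩
    let b₀' : I.ideal V := ⟨_, I.ideal_le_comap_ideal hVW₀ b₀.2⟩
    have e1 := he W V hVW b b' rfl
    have e2 := he W₀ V hVW₀ b₀ b₀' rfl
    have e3 : e V (b'.1 • b₀') = e V (b₀'.1 • b') := by
      congr 1
      exact Subtype.ext (mul_comm _ _)
    rw [map_smul, map_smul] at e3
    have e4 := congrArg (fun x : J.ideal V ↦ evalAt ψ _ hV' x.1) e3
    simp only [Submodule.coe_smul, smul_eq_mul, map_mul] at e4
    have e5 : (e W₀ b₀).1 = a₀ := by simp [b₀]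
    rw [← e1, ← e2, e5, evalAt_res ψ hV' h, evalAt_res ψ hV' h₀] at e4
    have e6 : evalAt ψ _ hV' b'.1 = evalAt ψ _ h b.1 := evalAt_res ψ hV' h _ _
    have e7 : evalAt ψ _ hV' b₀'.1 = evalAt ψ _ h₀ b₀.1 := evalAt_res ψ hV' h₀ _ _
    rw [e4, e7, evalAt_res ψ hV' h, mul_comm]
  have key' : ∀ (W : S.affineOpens) (h : ⊤ ≤ ψ ⁻¹ᵁ W.1) (b : I.ideal W),
      evalAt ψ _ h b.1 = evalAt ψ _ h (e W b).1 * (evalAt ψ _ h₀ b₀.1 / evalAt ψ _ h₀ a₀) := by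
    intro W h b
    rw [← mul_div_assoc, ← key, mul_div_cancel_right₀ _ hne']
  refine ⟨_, div_ne_zero hb₀' hne', fun W h ↦ ⟨fun a ha ↦ ?_, fun b hb ↦ ?_⟩⟩
  · exact ⟨_, ((e W).symm ⟨a, ha⟩).2, by rw [key', LinearEquiv.apply_symm_apply]⟩
  · exact ⟨_, (e W ⟨b, hb⟩).2, key' W h ⟨b, hb⟩⟩

end LinearEquivalence

/-! ### Morphisms over a base from inclusions of subrings of a field -/

section Gluing
variable {C C' X : Scheme.{u}} {L : Type u} [Field L]

theorem isDominant_of_comp_isOpenImmersion {Y Z W : Scheme.{u}} (f : Y ⟶ Z) (g : Z ⟶ W)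
    [IsOpenImmersion g] [IsDominant (f ≫ g)] : IsDominant f := by
  refine ⟨dense_iff_inter_open.mpr fun V hV ⟨v, hv⟩ ↦ ?_⟩
  obtain ⟨x, z, hz, e⟩ := (f ≫ g).denseRange.exists_mem_open
    (g.isOpenEmbedding.isOpenMap V hV) ⟨g v, v, hv, rfl⟩
  rw [Scheme.Hom.comp_apply] at e
  exact ⟨f x, (g.isOpenEmbedding.injective e) ▸ hz, x, rfl⟩

/-- Over each affine U the inclusion of subrings of L is a ring map from functions on C' to
functions on C, hence a morphism over U. On overlaps two such morphisms agree at a dominant point;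
the overlap is reduced and `γ'` is separated, so they agree everywhere. -/
theorem exists_hom_of_range_le [IsIntegral C] (γ : C ⟶ X) (γ' : C' ⟶ X) [IsAffineHom γ]
    [IsAffineHom γ'] (ψ : Spec (.of L) ⟶ C) [IsDominant ψ] (ψ' : Spec (.of L) ⟶ C')
    (e : ψ ≫ γ = ψ' ≫ γ') {ι : Type u} (U : ι → X.affineOpens) (hU : ⨆ i, (U i).1 = ⊤)
    (hψ : ∀ i, ⊤ ≤ ψ ⁻¹ᵁ γ ⁻¹ᵁ (U i).1) (hψ' : ∀ i, ⊤ ≤ ψ' ⁻¹ᵁ γ' ⁻¹ᵁ (U i).1)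
    (H : ∀ i, (evalAt ψ' _ (hψ' i)).range ≤ (evalAt ψ _ (hψ i)).range) :
    ∃ f : C ⟶ C', f ≫ γ' = γ ∧ ψ ≫ f = ψ' := by
  have hbij (i) : Function.Bijective (evalAt ψ _ (hψ i)).rangeRestrict :=
    ⟨fun a b h ↦ evalAt_injective ψ _ (hψ i) (congrArg Subtype.val h),
      (evalAt ψ _ (hψ i)).rangeRestrict_surjective⟩
  let s (i) : Γ(C', γ' ⁻¹ᵁ (U i).1) →+* Γ(C, γ ⁻¹ᵁ (U i).1) :=
    ((RingEquiv.ofBijective _ (hbij i)).symm.toRingHom.comp (Subring.inclusion (H i))).comp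
      (evalAt ψ' _ (hψ' i)).rangeRestrict
  have hs (i) (a) : evalAt ψ _ (hψ i) (s i a) = evalAt ψ' _ (hψ' i) a :=
    congrArg Subtype.val ((RingEquiv.ofBijective _ (hbij i)).apply_symm_apply
      (Subring.inclusion (H i) ((evalAt ψ' _ (hψ' i)).rangeRestrict a)))
  let m (i) : (γ ⁻¹ᵁ (U i).1).toScheme ⟶ C' :=
    (γ ⁻¹ᵁ (U i).1).toSpecΓ ≫ Spec.map (CommRingCat.ofHom (s i)) ≫ ((U i).2.preimage γ').fromSpec
  have hm (i) : m i ≫ γ' = (γ ⁻¹ᵁ (U i).1).ι ≫ γ := by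
    have h1 : γ'.appLE (U i).1 (γ' ⁻¹ᵁ (U i).1) le_rfl ≫ CommRingCat.ofHom (s i) =
        γ.appLE (U i).1 (γ ⁻¹ᵁ (U i).1) le_rfl := by
      rw [← Scheme.Hom.app_eq_appLE, ← Scheme.Hom.app_eq_appLE]
      ext a
      apply evalAt_injective ψ _ (hψ i)
      refine (hs i _).trans ?_
      exact (evalAt_comp ψ' γ' _ (hψ' i) _ _).symm.trans
        ((evalAt_congr e.symm _ (hψ i) _).trans (evalAt_comp ψ γ _ (hψ i) _ _))
    rw [Category.assoc, Category.assoc, ← IsAffineOpen.SpecMap_appLE_fromSpec γ' (U i).2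
      ((U i).2.preimage γ') le_rfl, ← Spec.map_comp_assoc, h1,
      IsAffineOpen.SpecMap_appLE_fromSpec γ (U i).2 ((U i).2.preimage γ) le_rfl,
      IsAffineOpen.toSpecΓ_fromSpec_assoc]
  let l (i) : Spec (.of L) ⟶ (γ ⁻¹ᵁ (U i).1).toScheme :=
    IsOpenImmersion.lift (γ ⁻¹ᵁ (U i).1).ι ψ (by
      rintro _ ⟨x, rfl⟩
      rw [Scheme.Opens.range_ι]
      exact hψ i trivial)
  have hl (i) : l i ≫ (γ ⁻¹ᵁ (U i).1).ι = ψ := IsOpenImmersion.lift_fac _ _ _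
  have hlm (i) : l i ≫ m i = ψ' := by
    have h1 : l i ≫ (γ ⁻¹ᵁ (U i).1).toSpecΓ = Spec.map (CommRingCat.ofHom (evalAt ψ _ (hψ i))) := by
      rw [← cancel_mono ((U i).2.preimage γ).fromSpec, Category.assoc,
        IsAffineOpen.toSpecΓ_fromSpec, hl, specMap_evalAt_fromSpec]
    rw [reassoc_of% h1, ← Spec.map_comp_assoc, ← CommRingCat.ofHom_comp]
    have h2 : (evalAt ψ _ (hψ i)).comp (s i) = evalAt ψ' _ (hψ' i) := RingHom.ext (hs i)
    rw [h2, specMap_evalAt_fromSpec]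
  let 𝒰 := C.openCoverOfIsOpenCover (fun i ↦ γ ⁻¹ᵁ (U i).1) (by
    refine top_le_iff.mp fun x _ ↦ ?_
    obtain ⟨i, hi⟩ := Opens.mem_iSup.mp (hU.ge (Set.mem_univ (γ x)))
    exact Opens.mem_iSup.mpr ⟨i, hi⟩)
  -- Gluing only uses that the local morphisms lie over X and take the point ψ to ψ'; their
  -- construction can be forgotten.
  obtain ⟨m, l, hm, hl, hlm⟩ : ∃ (m : ∀ i, 𝒰.X i ⟶ C') (l : ∀ i, Spec (.of L) ⟶ 𝒰.X i),
      (∀ i, m i ≫ γ' = 𝒰.f i ≫ γ) ∧ (∀ i, l i ≫ 𝒰.f i = ψ) ∧ ∀ i, l i ≫ m i = ψ' :=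
    ⟨m, l, hm, hl, hlm⟩
  have hI : Nonempty 𝒰.I₀ := by
    obtain ⟨i, -⟩ := 𝒰.exists_eq (ψ (⊥ : PrimeSpectrum L))
    exact ⟨i⟩
  clear_value 𝒰
  refine ⟨𝒰.glueMorphisms m fun i j ↦ ?_, ?_, ?_⟩
  · let t : Spec (.of L) ⟶ pullback (𝒰.f i) (𝒰.f j) :=
      pullback.lift (l i) (l j) ((hl i).trans (hl j).symm)
    have ht : t ≫ pullback.fst _ _ ≫ 𝒰.f i = ψ := by
      rw [pullback.lift_fst_assoc]; exact hl i
    have : IsDominant (t ≫ pullback.fst _ _ ≫ 𝒰.f i) := by rwa [ht]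
    have := isDominant_of_comp_isOpenImmersion t (pullback.fst (𝒰.f i) (𝒰.f j) ≫ 𝒰.f i)
    have : IsReduced (pullback (𝒰.f i) (𝒰.f j)) :=
      isReduced_of_isOpenImmersion (pullback.fst (𝒰.f i) (𝒰.f j) ≫ 𝒰.f i)
    refine ext_of_isDominant_of_isSeparated γ' ?_ t ?_
    · rw [Category.assoc, Category.assoc, hm, hm, pullback.condition_assoc]
    · rw [pullback.lift_fst_assoc, pullback.lift_snd_assoc, hlm, hlm]
  · refine 𝒰.hom_ext _ _ fun i ↦ ?_
    rw [Scheme.Cover.ι_glueMorphisms_assoc]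
    exact hm i
  · obtain ⟨i⟩ := hI
    refine (congrArg (· ≫ _) (hl i).symm).trans ?_
    rw [Category.assoc, 𝒰.ι_glueMorphisms, hlm]

/-- The two morphisms are mutually inverse because both composites are over X and fix a dominant
point. -/
theorem exists_iso_of_range_eq [IsIntegral C] [IsIntegral C'] (γ : C ⟶ X) (γ' : C' ⟶ X)
    [IsAffineHom γ] [IsAffineHom γ'] (ψ : Spec (.of L) ⟶ C) [IsDominant ψ]
    (ψ' : Spec (.of L) ⟶ C') [IsDominant ψ'] (e : ψ ≫ γ = ψ' ≫ γ') {ι : Type u}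
    (U : ι → X.affineOpens) (hU : ⨆ i, (U i).1 = ⊤)
    (hψ : ∀ i, ⊤ ≤ ψ ⁻¹ᵁ γ ⁻¹ᵁ (U i).1) (hψ' : ∀ i, ⊤ ≤ ψ' ⁻¹ᵁ γ' ⁻¹ᵁ (U i).1)
    (H : ∀ i, (evalAt ψ' _ (hψ' i)).range = (evalAt ψ _ (hψ i)).range) :
    ∃ f : C ≅ C', f.hom ≫ γ' = γ := by
  obtain ⟨f, hf, hf'⟩ := exists_hom_of_range_le γ γ' ψ ψ' e U hU hψ hψ' fun i ↦ (H i).le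
  obtain ⟨g, hg, hg'⟩ := exists_hom_of_range_le γ' γ ψ' ψ e.symm U hU hψ' hψ fun i ↦ (H i).ge
  refine ⟨⟨f, g, ?_, ?_⟩, hf⟩
  · refine ext_of_isDominant_of_isSeparated γ ?_ ψ ?_
    · rw [Category.assoc, hg, hf, Category.id_comp]
    · rw [reassoc_of% hf', hg', Category.comp_id]
  · refine ext_of_isDominant_of_isSeparated γ' ?_ ψ' ?_
    · rw [Category.assoc, hf, hg, Category.id_comp]
    · rw [reassoc_of% hg', hf', Category.comp_id]

theorem irreducibleSpace_of_isDominant (ψ : Spec (.of L) ⟶ X) [IsDominant ψ] :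
    IrreducibleSpace X := by
  rw [irreducibleSpace_def]
  have h := ((irreducibleSpace_def _).mp (inferInstance : IrreducibleSpace (Spec (.of L)))).image
    ψ ψ.continuous.continuousOn
  rw [Set.top_eq_univ, Set.image_univ] at h
  have h2 := h.closure
  rwa [ψ.denseRange.closure_range] at h2

theorem isIntegral_of_openCover_of_isDominant (ψ : Spec (.of L) ⟶ X) [IsDominant ψ]
    (𝒰 : X.OpenCover) [∀ i, IsIntegral (𝒰.X i)] : IsIntegral X := by
  have : IsReduced X := .of_openCover _ 𝒰
  have := irreducibleSpace_of_isDominant ψ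
  exact isIntegral_of_irreducibleSpace_of_isReduced X

theorem isDominant_of_openCover {Y : Scheme.{u}} (ψ : Y ⟶ X) (𝒰 : X.OpenCover)
    (H : ∀ i, ∃ g : Y ⟶ 𝒰.X i, IsDominant g ∧ g ≫ 𝒰.f i = ψ) : IsDominant ψ := by
  refine ⟨dense_iff_inter_open.mpr fun V hV ⟨v, hv⟩ ↦ ?_⟩
  obtain ⟨i, w, rfl⟩ := 𝒰.exists_eq v
  obtain ⟨g, hg, e⟩ := H i
  obtain ⟨y, hy⟩ := g.denseRange.exists_mem_open (hV.preimage (𝒰.f i).continuous) ⟨w, hv⟩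
  refine ⟨ψ y, ?_, y, rfl⟩
  rw [← e, Scheme.Hom.comp_apply]
  exact hy

end Gluing
-- Points, regular functions and local generators on a nonsingular curve
section Points

attribute [local instance] specializationOrder in
theorem krullDim_eq_topologicalKrullDim (X : Scheme.{u}) :
    Order.krullDim X = topologicalKrullDim X :=
  (Order.krullDim_eq_of_orderIso (irreducibleSetEquivPoints (α := X))).symm

variable {X : Scheme.{u}} [IsNonsingularCurve X]

theorem coheight_ne_zero_of_ne_genericPoint {X : Scheme.{u}} [IrreducibleSpace X] {x : X}
    (hx : x ≠ genericPoint X) : Order.coheight x ≠ 0 := by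
  rw [Order.coheight_ne_zero]
  intro h
  have h1 : x ≤ genericPoint X := genericPoint_specializes x
  have h2 : genericPoint X ≤ x := h h1
  exact hx (Specializes.antisymm (show x ⤳ genericPoint X from h2)
    (show genericPoint X ⤳ x from h1)).eq

theorem coheight_genericPoint {X : Scheme.{u}} [IrreducibleSpace X] :
    Order.coheight (genericPoint X) = 0 := by
  rw [Order.coheight_eq_zero]
  exact fun y _ ↦ show genericPoint X ⤳ y from genericPoint_specializes y

theorem coheight_eq_one_of_ne_genericPoint {x : X} (hx : x ≠ genericPoint X) :
    Order.coheight x = 1 := by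
  have h1 := Order.coheight_le_krullDim x
  rw [krullDim_eq_topologicalKrullDim, IsNonsingularCurve.dim_eq_one] at h1
  exact le_antisymm (by exact_mod_cast h1)
    (Order.one_le_iff_ne_zero.mpr (coheight_ne_zero_of_ne_genericPoint hx))

theorem PrimeDivisor.ne_genericPoint (x : PrimeDivisor X) : x.1 ≠ genericPoint X := by
  intro h
  have := x.2
  rw [h, coheight_genericPoint] at this
  exact zero_ne_one this

theorem PrimeDivisor.eq_of_specializes {x y : PrimeDivisor X} (h : x.1 ⤳ y.1) : x = y := by
  by_contra hne
  have hlt : y.1 < x.1 := lt_iff_le_not_ge.mpr ⟨h, fun h' ↦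
    hne (Subtype.ext (Specializes.antisymm h (show y.1 ⤳ x.1 from h')).eq)⟩
  have h1 := Order.coheight_add_one_le hlt
  rw [x.2, y.2] at h1
  exact absurd h1 (by decide)

theorem genericPoint_mem {X : Scheme.{u}} [IrreducibleSpace X] (U : X.Opens) [hU : Nonempty U] :
    genericPoint X ∈ U :=
  ((genericPoint_spec X).mem_open_set_iff U.isOpen).mpr (by simpa using hU)

theorem ord_inv' {f : X.functionField} (hf : f ≠ 0) (x : X) :
    Scheme.ord f⁻¹ x = -Scheme.ord f x := by
  have h := Scheme.ord_mul (x := x) hf (inv_ne_zero hf)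
  rw [mul_inv_cancel₀ hf, ord_one'] at h
  omega

theorem ord_zpow' {f : X.functionField} (hf : f ≠ 0) (n : ℤ) (x : X) :
    Scheme.ord (f ^ n) x = n * Scheme.ord f x := by
  have hpow (n : ℕ) : Scheme.ord (f ^ n) x = n * Scheme.ord f x := by
    induction n with
    | zero => simp [ord_one']
    | succ n ih =>
      rw [pow_succ, Scheme.ord_mul (pow_ne_zero _ hf) hf, ih]
      push_cast; ring
  obtain ⟨n, rfl | rfl⟩ := n.eq_nat_or_neg
  · rw [zpow_natCast, hpow]
  · rw [zpow_neg, zpow_natCast, ord_inv' (pow_ne_zero _ hf), hpow]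
    ring

/-- In a discrete valuation ring either f or f⁻¹ is integral. In the second case the order of f⁻¹ is
both nonnegative and, by hypothesis, nonpositive, so f⁻¹ is a unit and f is integral too. -/
theorem mem_range_algebraMap_stalk (x : X) {f : X.functionField}
    (hf : f ≠ 0 → 0 ≤ Scheme.ord f x) : f ∈ (algebraMap (X.presheaf.stalk x) X.functionField).range := by
  by_cases hf0 : f = 0
  · exact hf0 ▸ zero_mem _
  by_cases hx : x = genericPoint X
  · subst hx
    refine ⟨f, ?_⟩
    rw [RingHom.algebraMap_toAlgebra]
    simp
  · have h1 := coheight_eq_one_of_ne_genericPoint hx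
    have := isDVR_stalk x h1
    obtain ⟨g, hg⟩ | ⟨g, hg⟩ := ValuationRing.isInteger_or_isInteger (X.presheaf.stalk x) f
    · exact ⟨g, hg⟩
    have hg0 : g ≠ 0 := by
      rintro rfl
      rw [map_zero] at hg
      exact inv_ne_zero hf0 hg.symm
    have hord : Scheme.ord (algebraMap (X.presheaf.stalk x) X.functionField g) x = 0 := by
      refine le_antisymm ?_ ?_
      · rw [hg, ord_inv' hf0]
        have := hf hf0
        omega
      · rw [Scheme.le_ord_iff h1 (by rw [hg]; exact inv_ne_zero hf0)]
        exact Ring.ordFrac_ge_one_of_ne_zero hg0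
    rw [Scheme.ord_eq_iff h1 (by rw [hg]; exact inv_ne_zero hf0)] at hord
    have hu : IsUnit g :=
      (Ring.isUnit_iff_ordFrac_one_of_isDiscreteValuationRing (K := X.functionField)).mpr hord
    obtain ⟨v, hv⟩ := hu.exists_right_inv
    refine ⟨v, ?_⟩
    have h2 := congrArg (algebraMap (X.presheaf.stalk x) X.functionField) hv
    rw [map_mul, hg, map_one, inv_mul_eq_one₀ hf0] at h2
    exact h2.symm

/-- Local representatives of f share the germ f at the generic point, hence agree on overlaps by
integrality, and the sheaf condition glues them. -/
theorem exists_germ_eq_of_forall_stalk {X : Scheme.{u}} [IsIntegral X] (U : X.Opens) [Nonempty U]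
    {f : X.functionField}
    (hf : ∀ x ∈ U, f ∈ (algebraMap (X.presheaf.stalk x) X.functionField).range) :
    ∃ a : Γ(X, U), X.germToFunctionField U a = f := by
  have h1 : ∀ x : U, ∃ V : X.Opens, x.1 ∈ V ∧ V ≤ U ∧ ∃ a : Γ(X, V), ∀ h : genericPoint X ∈ V,
      X.presheaf.germ V _ h a = f := by
    rintro ⟨x, hx⟩
    obtain ⟨g, rfl⟩ := hf x hx
    obtain ⟨V, hxV, a, rfl⟩ := X.presheaf.exists_germ_eq g
    have hle : V ⊓ U ≤ V := inf_le_left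
    refine ⟨V ⊓ U, ⟨hxV, hx⟩, inf_le_right, X.presheaf.map (homOfLE hle).op a, fun h ↦ ?_⟩
    have : Nonempty V := ⟨x, hxV⟩
    rw [Scheme.algebraMap_germ_eq_germToFunctionField, X.presheaf.germ_res_apply]
  choose V hxV hVU a ha using h1
  have hne (x) : Nonempty (V x) := ⟨x.1, hxV x⟩
  obtain ⟨b, hb, -⟩ := X.sheaf.existsUnique_gluing' V U (fun x ↦ homOfLE (hVU x))
    (fun x hx ↦ Opens.mem_iSup.mpr ⟨⟨x, hx⟩, hxV ⟨x, hx⟩⟩) a (by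
      intro x y
      have := hne x
      have := hne y
      have : Nonempty (V x ⊓ V y : X.Opens) := ⟨genericPoint X, genericPoint_mem _, genericPoint_mem _⟩
      apply X.germToFunctionField_injective (V x ⊓ V y)
      have e1 := X.presheaf.germ_res_apply (Opens.infLELeft (V x) (V y)) (genericPoint X)
        (genericPoint_mem _) (a x)
      have e2 := X.presheaf.germ_res_apply (Opens.infLERight (V x) (V y)) (genericPoint X)
        (genericPoint_mem _) (a y)
      exact (e1.trans (ha x _)).trans (e2.trans (ha y _)).symm)
  refine ⟨b, ?_⟩
  obtain ⟨x⟩ := ‹Nonempty U›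
  have := hne x
  rw [← ha x (genericPoint_mem _), ← hb x]
  exact (X.presheaf.germ_res_apply (homOfLE (hVU x)) _ (genericPoint_mem _) b).symm

theorem exists_germ_eq_of_mem_sections (U : X.Opens) [Nonempty U] {f : X.functionField}
    (hf : f ∈ (0 : Divisor X).sections U) : ∃ a : Γ(X, U), X.germToFunctionField U a = f := by
  refine exists_germ_eq_of_forall_stalk U fun x hx ↦ mem_range_algebraMap_stalk x fun hf0 ↦ ?_
  by_cases h1 : Order.coheight x = 1
  · have := hf hf0 ⟨x, h1⟩ hx
    simpa using this
  · rw [Scheme.ord_eq_zero_of_coheight_neq_one h1]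

/-- The ring is Noetherian, and a nonzero prime corresponds to a point other than the generic one,
so localizing there gives a stalk that is a discrete valuation ring. -/
theorem isDedekindDomain_sections (U : X.Opens) (hU : IsAffineOpen U) [Nonempty U] :
    IsDedekindDomain Γ(X, U) := by
  have : IsNoetherianRing Γ(X, U) := IsLocallyNoetherian.component_noetherian ⟨U, hU⟩
  have : IsDedekindDomainDvr Γ(X, U) := ⟨fun P hP hPp ↦ by
    let y : PrimeSpectrum Γ(X, U) := ⟨P, hPp⟩
    have hy : hU.fromSpec y ∈ U := by
      rw [← SetLike.mem_coe, ← hU.range_fromSpec]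
      exact ⟨y, rfl⟩
    have hne : hU.fromSpec y ≠ genericPoint X := by
      intro h
      have h1 := hU.primeIdealOf_genericPoint
      rw [genericPoint_eq_bot_of_affine] at h1
      have h2 : hU.fromSpec (⊥ : PrimeSpectrum Γ(X, U)) = genericPoint X := by
        rw [← h1]; exact hU.fromSpec_primeIdealOf _
      have h3 := hU.fromSpec.isOpenEmbedding.injective (h.trans h2.symm)
      exact hP (congrArg PrimeSpectrum.asIdeal h3)
    have hd := isDVR_stalk _ (coheight_eq_one_of_ne_genericPoint hne)
    let := TopCat.Presheaf.algebra_section_stalk X.presheaf (⟨hU.fromSpec y, hy⟩ : U)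
    have : IsLocalization.AtPrime (X.presheaf.stalk (hU.fromSpec y)) P :=
      hU.isLocalization_stalk' y hy
    let e := IsLocalization.algEquiv P.primeCompl (X.presheaf.stalk (hU.fromSpec y))
      (Localization.AtPrime P)
    exact IsDiscreteValuationRing.RingEquivClass.isDiscreteValuationRing e.toRingEquiv⟩
  infer_instance

/-- A generator of the invertible sheaf `O(D)` over `U`. -/
structure IsGenerator (D : Divisor X) (U : X.Opens) (h : X.functionField) : Prop where
  ne_zero : h ≠ 0
  ord_eq : ∀ x : PrimeDivisor X, x.1 ∈ U → Scheme.ord h x.1 = -D x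

/-- At a closed point x a suitable power of a uniformizer has the right order at x; at the generic
point h = 1 serves. The order is wrong at only finitely many prime divisors, none of which
specializes to x, so their closures can be removed. -/
theorem exists_isGenerator (D : Divisor X) (x : X) : ∃ (U : ChartIndex X) (h : X.functionField),
    x ∈ U.1.toOpens ∧ IsGenerator D U.1.toOpens h := by
  obtain ⟨h, hh0, hh⟩ : ∃ h : X.functionField, h ≠ 0 ∧
      ∀ hx : Order.coheight x = 1, Scheme.ord h x = -D ⟨x, hx⟩ := by
    by_cases hx : Order.coheight x = 1
    · have := isDVR_stalk x hx
      obtain ⟨π, hπ⟩ := IsDiscreteValuationRing.exists_irreducible (X.presheaf.stalk x)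
      have hπ0 : algebraMap (X.presheaf.stalk x) X.functionField π ≠ 0 := by
        rw [Ne, map_eq_zero_iff _ (IsFractionRing.injective _ _)]
        exact hπ.ne_zero
      have h1 : Scheme.ord (algebraMap (X.presheaf.stalk x) X.functionField π) x = 1 := by
        rw [Scheme.ord_eq_iff hx hπ0]
        exact Ring.ordFrac_irreducible hπ
      exact ⟨_, zpow_ne_zero (-D ⟨x, hx⟩) hπ0, fun _ ↦ by rw [ord_zpow' hπ0, h1, mul_one]⟩
    · exact ⟨1, one_ne_zero, fun h ↦ (hx h).elim⟩
  have hfin : {y : PrimeDivisor X | Scheme.ord h y.1 ≠ -D y}.Finite := by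
    refine ((finite_ord_ne_zero h hh0).union (D.support.finite_toSet)).subset fun y hy ↦ ?_
    by_contra hne
    simp only [Set.mem_union, Set.mem_ofPred_eq, not_or, not_not, Finset.mem_coe,
      Finsupp.mem_support_iff] at hne
    exact hy (by rw [hne.1, hne.2, neg_zero])
  let Z : Set X := ⋃ y ∈ {y : PrimeDivisor X | Scheme.ord h y.1 ≠ -D y}, closure {y.1}
  have hZ : IsClosed Z := hfin.isClosed_biUnion fun _ _ ↦ isClosed_closure
  have hxZ : x ∉ Z := by
    intro hx
    simp only [Z, Set.mem_iUnion] at hx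
    obtain ⟨y, hy, hxy⟩ := hx
    have hs : y.1 ⤳ x := specializes_iff_mem_closure.mpr hxy
    by_cases hx1 : Order.coheight x = 1
    · obtain rfl := PrimeDivisor.eq_of_specializes (x := y) (y := ⟨x, hx1⟩) hs
      exact hy (hh hx1)
    · have : x = genericPoint X := by
        by_contra hne
        exact hx1 (coheight_eq_one_of_ne_genericPoint hne)
      subst this
      exact y.ne_genericPoint (Specializes.antisymm hs (genericPoint_specializes _)).eq
  obtain ⟨_, ⟨U, hU, rfl⟩, hxU, hUZ⟩ := X.isBasis_affineOpens.exists_subset_of_mem_open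
    (show x ∈ Zᶜ from hxZ) hZ.isOpen_compl
  refine ⟨⟨⟨U, hU⟩, ⟨x, hxU⟩⟩, h, hxU, hh0, fun y hy ↦ ?_⟩
  by_contra hne
  refine hUZ hy (Set.mem_biUnion (show y ∈ {y : PrimeDivisor X | _} from hne) (subset_closure rfl))

end Points
-- Sections of O(nD) through a local generator, and constant global functions
section Generators
variable {X : Scheme.{u}} [IsNonsingularCurve X] {D : Divisor X} {U : X.Opens}

theorem ord_germ_nonneg_of_mem {f : X.functionField} {V : X.Opens} (hf : f ∈ (0 : Divisor X).sections V)
    (hf0 : f ≠ 0) (x : PrimeDivisor X) (hx : x.1 ∈ V) : 0 ≤ Scheme.ord f x.1 := by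
  simpa using hf hf0 x hx

theorem IsGenerator.mem_sections_iff {h : X.functionField} (H : IsGenerator D U h) (n : ℤ)
    {f : X.functionField} : f ∈ (n • D).sections U ↔ f * h ^ (-n) ∈ (0 : Divisor X).sections U := by
  by_cases hf : f = 0
  · simp [hf, zero_mem]
  rw [mem_sections, mem_sections]
  have hz : f * h ^ (-n) ≠ 0 := mul_ne_zero hf (zpow_ne_zero _ H.ne_zero)
  simp only [hf, hz, ne_eq, not_false_eq_true, forall_const]
  refine forall₂_congr fun x hx ↦ ?_
  rw [Scheme.ord_mul hf (zpow_ne_zero _ H.ne_zero), ord_zpow' H.ne_zero, H.ord_eq x hx]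
  simp

theorem IsGenerator.exists_eq_germ_mul [Nonempty U] {h : X.functionField} (H : IsGenerator D U h)
    (n : ℤ) {f : X.functionField} :
    f ∈ (n • D).sections U ↔ ∃ a : Γ(X, U), f = X.germToFunctionField U a * h ^ n := by
  rw [H.mem_sections_iff]
  constructor
  · intro hf
    obtain ⟨a, ha⟩ := exists_germ_eq_of_mem_sections U hf
    refine ⟨a, ?_⟩
    rw [ha, mul_assoc, ← zpow_add₀ H.ne_zero, neg_add_cancel, zpow_zero, mul_one]
  · rintro ⟨a, rfl⟩
    rw [mul_assoc, ← zpow_add₀ H.ne_zero, add_neg_cancel, zpow_zero, mul_one]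
    exact germ_mem_sections a

theorem IsGenerator.mono {V : X.Opens} {h : X.functionField} (H : IsGenerator D U h) (hV : V ≤ U) :
    IsGenerator D V h := ⟨H.ne_zero, fun x hx ↦ H.ord_eq x (hV hx)⟩

theorem IsGenerator.mem_sections {h : X.functionField} (H : IsGenerator D U h) :
    h ∈ D.sections U := fun _ x hx ↦ by rw [H.ord_eq x hx]; simp

theorem ord_eq_of_sq {f : X.functionField} (hf : f ≠ 0) (x : X) :
    Scheme.ord (f ^ 2) x = 2 * Scheme.ord f x := by
  rw [sq, Scheme.ord_mul hf hf]; ring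

variable {k : Type u} [Field k]

theorem isUnit_two_sections (p : X ⟶ Spec (.of k)) (h2 : (2 : k) ≠ 0) (U : X.Opens) : IsUnit (2 : Γ(X, U)) := by
  have := (isUnit_iff_ne_zero.mpr h2).map
    (((X.presheaf.map (homOfLE (show U ≤ p ⁻¹ᵁ ⊤ from le_top)).op).hom.comp p.appTop.hom).comp
      (Scheme.ΓSpecIso (.of k)).inv.hom)
  rwa [map_ofNat] at this

/-- Properness makes Γ(X, ⊤) integral over k; it is a domain and k is algebraically closed, so it
equals k. Every constant is then a square, and a nonzero constant has order zero everywhere. -/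
theorem exists_sq_of_mem_sections_zero (p : X ⟶ Spec (.of k)) [IsAlgClosed k] [IsProper p] {f : X.functionField}
    (hf : f ∈ (0 : Divisor X).sections ⊤) (hf0 : f ≠ 0) :
    ∃ c : X.functionField, c ≠ 0 ∧ c ^ 2 = f ∧ ∀ x : X, Scheme.ord c x = 0 := by
  have : Nonempty (⊤ : X.Opens) := ⟨⟨genericPoint X, trivial⟩⟩
  obtain ⟨a, rfl⟩ := exists_germ_eq_of_mem_sections ⊤ hf
  let φ : k →+* Γ(X, ⊤) := p.appTop.hom.comp (Scheme.ΓSpecIso (.of k)).inv.hom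
  have hint : φ.IsIntegral := by
    refine RingHom.IsIntegral.trans _ _ (RingHom.isIntegral_of_surjective _ ?_)
      (isIntegral_appTop_of_universallyClosed p)
    exact (ConcreteCategory.bijective_of_isIso (Scheme.ΓSpecIso (.of k)).inv).2
  have hsurj : Function.Surjective φ := IsAlgClosed.ringHom_bijective_of_isIntegral φ hint |>.2
  obtain ⟨a, rfl⟩ := hsurj a
  obtain ⟨b, rfl⟩ := IsAlgClosed.exists_pow_nat_eq a two_pos
  have hb : b ≠ 0 := by
    rintro rfl
    simp at hf0
  have hu : IsUnit (φ b) := (isUnit_iff_ne_zero.mpr hb).map φ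
  refine ⟨X.germToFunctionField ⊤ (φ b), ?_, ?_, fun x ↦ Scheme.ord_of_isUnit hu (by trivial)⟩
  · exact (hu.map (X.germToFunctionField ⊤).hom).ne_zero
  · rw [map_pow, map_pow]

end Generators
-- Free quadratic algebras, their involution and their ramification
section QuadraticAlgebra

/-- A free quadratic algebra `R = A ⊕ A y` with `y ^ 2 = d`. -/
structure IsQuadratic (A R : Type*) [CommRing A] [CommRing R] [Algebra A R] (y : R) (d : A) :
    Prop where
  sq_eq : y ^ 2 = algebraMap A R d
  exists_eq : ∀ r : R, ∃ a b : A, r = algebraMap A R a + algebraMap A R b * y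
  eq_zero : ∀ a b : A, algebraMap A R a + algebraMap A R b * y = 0 → a = 0 ∧ b = 0

namespace IsQuadratic
variable {A R : Type u} [CommRing A] [CommRing R] [Algebra A R] {y : R} {d : A}

theorem unique (H : IsQuadratic A R y d) {a b a' b' : A}
    (e : algebraMap A R a + algebraMap A R b * y = algebraMap A R a' + algebraMap A R b' * y) :
    a = a' ∧ b = b' := by
  have := H.eq_zero (a - a') (b - b') (by rw [map_sub, map_sub]; linear_combination e)
  exact ⟨sub_eq_zero.mp this.1, sub_eq_zero.mp this.2⟩

theorem module_finite (H : IsQuadratic A R y d) : Module.Finite A R := by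
  classical
  refine ⟨⟨({1, y} : Finset R), ?_⟩⟩
  rw [eq_top_iff]
  rintro r -
  obtain ⟨a, b, rfl⟩ := H.exists_eq r
  simp only [Finset.coe_insert, Finset.coe_singleton]
  refine Submodule.mem_span_pair.mpr ⟨a, b, ?_⟩
  rw [Algebra.smul_def, Algebra.smul_def, mul_one]

/-- Coordinates in the basis 1, y are unique, so the map can be defined on coordinates.
Multiplicativity uses only that y² and z² both come from d. -/
theorem exists_lift (H : IsQuadratic A R y d) {T : Type*} [CommRing T] (j : A →+* T) {z : T}
    (hz : z ^ 2 = j d) :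
    ∃ σ : R →+* T, ∀ a b, σ (algebraMap A R a + algebraMap A R b * y) = j a + j b * z := by
  choose a b hab using H.exists_eq
  have key : ∀ u v, j (a (algebraMap A R u + algebraMap A R v * y)) +
      j (b (algebraMap A R u + algebraMap A R v * y)) * z = j u + j v * z := by
    intro u v
    obtain ⟨h1, h2⟩ := H.unique (hab (algebraMap A R u + algebraMap A R v * y))
    rw [← h1, ← h2]
  refine ⟨{ toFun r := j (a r) + j (b r) * z
            map_one' := ?_, map_zero' := ?_, map_mul' r s := ?_, map_add' r s := ?_ }, key⟩
  · have := key 1 0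
    simpa using this
  · obtain ⟨u, v, rfl⟩ := H.exists_eq r
    obtain ⟨u', v', rfl⟩ := H.exists_eq s
    rw [key, key]
    have := key (u * u' + v * v' * d) (u * v' + v * u')
    simp only [map_add, map_mul, ← H.sq_eq, ← hz] at this
    rw [show (algebraMap A R u + algebraMap A R v * y) * (algebraMap A R u' + algebraMap A R v' * y) =
      algebraMap A R u * algebraMap A R u' + algebraMap A R v * algebraMap A R v' * y ^ 2 +
      (algebraMap A R u * algebraMap A R v' + algebraMap A R v * algebraMap A R u') * y by ring, this]
    ring
  · have := key 0 0
    simpa using this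
  · obtain ⟨u, v, rfl⟩ := H.exists_eq r
    obtain ⟨u', v', rfl⟩ := H.exists_eq s
    rw [key, key]
    have := key (u + u') (v + v')
    simp only [map_add] at this
    rw [show algebraMap A R u + algebraMap A R v * y + (algebraMap A R u' + algebraMap A R v' * y) =
      algebraMap A R u + algebraMap A R u' + (algebraMap A R v + algebraMap A R v') * y by ring, this]
    ring

theorem exists_involution (H : IsQuadratic A R y d) :
    ∃ σ : R →+* R, ∀ a b, σ (algebraMap A R a + algebraMap A R b * y) =
      algebraMap A R a - algebraMap A R b * y := by
  obtain ⟨σ, hσ⟩ := H.exists_lift (algebraMap A R) (z := -y) (by rw [neg_sq, H.sq_eq])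
  exact ⟨σ, fun a b ↦ by rw [hσ]; ring⟩

section Local
variable {O T : Type u} [CommRing O] [CommRing T] [Algebra A O] [Algebra R T] [Algebra O T]
  [Algebra A T] [IsScalarTower A O T] [IsScalarTower A R T]

/-- Since y² comes from A, its differential 2y dy vanishes. Here 2y is a unit, so dy = 0; then all
differentials of R vanish, and those of its localization as well. -/
theorem formallyUnramified (M : Submonoid R) [IsLocalization M T] (H : IsQuadratic A R y d) (h2 : IsUnit (2 : T))
    (hd : IsUnit (algebraMap A O d)) : Algebra.FormallyUnramified O T := by
  rw [Algebra.formallyUnramified_iff]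
  have hA (a : A) : KaehlerDifferential.D O T (algebraMap A T a) = 0 := by
    rw [IsScalarTower.algebraMap_apply A O T]
    exact Derivation.map_algebraMap _ _
  have hyu : IsUnit (2 * algebraMap R T y) := by
    refine h2.mul ?_
    have : IsUnit (algebraMap R T y ^ 2) := by
      rw [← map_pow, H.sq_eq, ← IsScalarTower.algebraMap_apply,
        IsScalarTower.algebraMap_apply A O T]
      exact hd.map _
    exact (isUnit_pow_iff two_ne_zero).mp this
  have hy : KaehlerDifferential.D O T (algebraMap R T y) = 0 := by
    have h : KaehlerDifferential.D O T (algebraMap R T y ^ 2) = 0 := by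
      rw [← map_pow, H.sq_eq, ← IsScalarTower.algebraMap_apply, hA]
    rw [sq, Derivation.leibniz, ← two_smul T, smul_smul] at h
    exact hyu.smul_eq_zero.mp h
  have hR (r : R) : KaehlerDifferential.D O T (algebraMap R T r) = 0 := by
    obtain ⟨a, b, rfl⟩ := H.exists_eq r
    rw [map_add, map_mul, ← IsScalarTower.algebraMap_apply, ← IsScalarTower.algebraMap_apply,
      map_add, Derivation.leibniz, hA, hA, hy]
    simp
  have hT (z : T) : KaehlerDifferential.D O T z = 0 := by
    obtain ⟨⟨r, s⟩, e⟩ := IsLocalization.surj M z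
    have h := congrArg (KaehlerDifferential.D O T) e
    rw [Derivation.leibniz, hR, hR, smul_zero, zero_add] at h
    exact (IsLocalization.map_units T s).smul_eq_zero.mp h
  rw [← Submodule.subsingleton_iff T, ← subsingleton_iff_bot_eq_top,
    ← KaehlerDifferential.span_range_derivation, eq_comm, Submodule.span_eq_bot]
  rintro _ ⟨z, rfl⟩
  exact hT z

/-- The identity and the involution y ↦ -y agree modulo y. If T were formally unramified, these two
maps to T/(y²) would be equal, whence 2y ∈ (y²) and, T being a domain with y ≠ 0, 2 ∈ (y). This is
absurd because y lies in the maximal ideal and 2 is a unit. -/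
theorem not_formallyUnramified [IsDomain T] (H : IsQuadratic A R y d) (h2 : IsUnit (2 : T))
    (P : Ideal R) [P.IsPrime] [IsLocalization.AtPrime T P] (M' : Submonoid A) [IsLocalization M' O]
    (hyP : y ∈ P) (hy0 : algebraMap R T y ≠ 0) : ¬ Algebra.FormallyUnramified O T := by
  intro hun
  have : IsLocalRing T := IsLocalization.AtPrime.isLocalRing T P
  obtain ⟨σ, hσ⟩ := H.exists_involution
  -- σ is the identity modulo y, and y ∈ P, so σ respects the complement of P and extends to the
  -- localization.
  have hσP : P.primeCompl ≤ P.primeCompl.comap σ := by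
    intro r hr hr'
    refine hr ?_
    obtain ⟨a, b, rfl⟩ := H.exists_eq r
    rw [hσ] at hr'
    have h1 := P.add_mem hr' (P.mul_mem_left (algebraMap A R b) hyP)
    rw [sub_add_cancel] at h1
    exact P.add_mem h1 (P.mul_mem_left _ hyP)
  let τ : T →+* T := IsLocalization.map T σ hσP
  have hτ (r : R) : τ (algebraMap R T r) = algebraMap R T (σ r) := IsLocalization.map_eq _ _
  have hτA (a : A) : τ (algebraMap A T a) = algebraMap A T a := by
    rw [IsScalarTower.algebraMap_apply A R T, hτ]
    have := hσ a 0
    simp only [map_zero, zero_mul, add_zero, sub_zero] at this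
    rw [this]
  have hτO : τ.comp (algebraMap O T) = algebraMap O T := by
    refine IsLocalization.ringHom_ext M' (RingHom.ext fun a ↦ ?_)
    simp only [RingHom.comp_apply, ← IsScalarTower.algebraMap_apply, hτA]
  let τ' : T →ₐ[O] T := { τ with commutes' := fun o ↦ RingHom.congr_fun hτO o }
  let Y := algebraMap R T y
  let q := Ideal.Quotient.mkₐ O (Ideal.span {Y ^ 2})
  have hmem : ∀ z, z - τ z ∈ Ideal.span {Y} := by
    have hR (r : R) : algebraMap R T r - algebraMap R T (σ r) ∈ Ideal.span {Y} := by
      obtain ⟨a, b, rfl⟩ := H.exists_eq r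
      rw [hσ, ← map_sub]
      refine Ideal.mem_span_singleton.mpr ⟨algebraMap R T (2 * algebraMap A R b), ?_⟩
      rw [← map_mul]
      congr 1
      ring
    intro z
    obtain ⟨⟨r, s⟩, e⟩ := IsLocalization.surj P.primeCompl z
    have e' := congrArg τ e
    rw [map_mul, hτ, hτ] at e'
    refine (Ideal.unit_mul_mem_iff_mem _ (IsLocalization.map_units T s)).mp ?_
    have : algebraMap R T s * (z - τ z) = (algebraMap R T r - algebraMap R T (σ r)) -
        τ z * (algebraMap R T s - algebraMap R T (σ s)) := by
      simp only at e e'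
      linear_combination e - e'
    rw [this]
    exact sub_mem (hR r) (Ideal.mul_mem_left _ _ (hR s))
  have heq : q = q.comp τ' := by
    refine Algebra.FormallyUnramified.ext (Ideal.span {q Y}) ⟨2, ?_⟩ fun z ↦ ?_
    · have : q Y ^ 2 = 0 := (map_pow q Y 2).symm.trans
        (Ideal.Quotient.eq_zero_iff_mem.mpr (Ideal.mem_span_singleton_self _))
      rw [Ideal.span_singleton_pow, this]; simp
    · rw [Ideal.Quotient.mk_eq_mk_iff_sub_mem, AlgHom.comp_apply, ← map_sub]
      obtain ⟨w, hw⟩ := Ideal.mem_span_singleton.mp (hmem z)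
      change q (z - τ z) ∈ _
      rw [hw, map_mul]
      exact Ideal.mul_mem_right _ _ (Ideal.mem_span_singleton_self _)
  have h := DFunLike.congr_fun heq Y
  rw [AlgHom.comp_apply, ← sub_eq_zero, ← map_sub] at h
  have h' : Y - τ Y ∈ Ideal.span {Y ^ 2} := Ideal.Quotient.eq_zero_iff_mem.mp h
  have hτY : τ Y = -Y := by
    have := hσ 0 1
    simp only [map_zero, map_one, one_mul, zero_add, zero_sub] at this
    rw [hτ, this, map_neg]
  obtain ⟨w, hw⟩ := Ideal.mem_span_singleton.mp h'
  rw [hτY] at hw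
  have hw2 : 2 = Y * w := mul_left_cancel₀ hy0 (by linear_combination hw)
  have hYu : IsUnit Y := isUnit_of_mul_isUnit_left (hw2 ▸ h2)
  rw [IsLocalization.AtPrime.isUnit_to_map_iff T P] at hYu
  exact hYu hyP

end Local
end IsQuadratic
end QuadraticAlgebra
-- Generic points, function fields and the degree of a morphism
section GenericPoints

/-- The inclusion of the generic point. -/
noncomputable def genericMap (X : Scheme.{u}) [IsIntegral X] : Spec (.of X.functionField) ⟶ X :=
  X.fromSpecStalk (genericPoint X)

instance {X : Scheme.{u}} [IsIntegral X] : IsDominant (genericMap X) := by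
  refine ⟨?_⟩
  refine Dense.mono (s₁ := {genericPoint X}) ?_ ?_
  · rintro _ rfl
    exact ⟨IsLocalRing.closedPoint (X.presheaf.stalk (genericPoint X)),
      Scheme.fromSpecStalk_closedPoint⟩
  · rw [dense_iff_closure_eq, genericPoint_closure]

theorem evalAt_genericMap {X : Scheme.{u}} [IsIntegral X] (U : X.Opens) [Nonempty U]
    (h : ⊤ ≤ genericMap X ⁻¹ᵁ U) (a : Γ(X, U)) :
    evalAt (genericMap X) U h a = X.germToFunctionField U a := by
  have e : (genericMap X).appLE U ⊤ h ≫ (Scheme.ΓSpecIso (.of X.functionField)).hom =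
      X.germToFunctionField U := by
    have e (x : X) (hx : x ∈ U) (h : ⊤ ≤ X.fromSpecStalk x ⁻¹ᵁ U) :
        (X.fromSpecStalk x).appLE U ⊤ h ≫ (Scheme.ΓSpecIso (X.presheaf.stalk x)).hom =
          X.presheaf.germ U x hx := by
      rw [Scheme.Hom.appLE, Scheme.fromSpecStalk_app hx]
      simp only [Category.assoc]
      have e1 : (Spec (X.presheaf.stalk x)).presheaf.map
          ((homOfLE (show X.fromSpecStalk x ⁻¹ᵁ U ≤ ⊤ from le_top)).op ≫ (homOfLE h).op) = 𝟙 _ :=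
        (Spec (X.presheaf.stalk x)).presheaf.map_id _
      rw [← Functor.map_comp_assoc, e1, Category.id_comp, Iso.inv_hom_id,
        Category.comp_id]
    exact e _ (genericPoint_mem U) h
  exact ConcreteCategory.congr_hom e a

instance {L F : Type u} [Field L] [Field F] (j : F →+* L) :
    IsDominant (Spec.map (CommRingCat.ofHom j)) := by
  have : Surjective (Spec.map (CommRingCat.ofHom j)) := ⟨fun x ↦
    ⟨IsLocalRing.closedPoint L, Subsingleton.elim (α := Spec (.of F)) _ _⟩⟩
  infer_instance

theorem apply_eq_genericPoint {X : Scheme.{u}} [IsIntegral X] {L : Type u} [Field L]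
    (ψ : Spec (.of L) ⟶ X) [IsDominant ψ] (x : Spec (.of L)) : ψ x = genericPoint X := by
  have h : IsGenericPoint (ψ x) ⊤ := by
    rw [isGenericPoint_def, Set.top_eq_univ, ← ψ.denseRange.closure_range]
    congr 1
    ext y
    simp only [Set.mem_singleton_iff, Set.mem_range]
    constructor
    · rintro rfl; exact ⟨x, rfl⟩
    · rintro ⟨z, rfl⟩; rw [Subsingleton.elim z x]
  exact h.eq (genericPoint_spec X)

/-- A dominant field-valued point can only hit the generic point, so it factors through the local
ring there, which is the function field. -/
theorem exists_functionField_hom {X : Scheme.{u}} [IsIntegral X] {L : Type u} [Field L]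
    (ψ : Spec (.of L) ⟶ X) [IsDominant ψ] : ∃ j : X.functionField →+* L,
      Spec.map (CommRingCat.ofHom j) ≫ genericMap X = ψ ∧
      ∀ (U : X.Opens) [Nonempty U] (h : ⊤ ≤ ψ ⁻¹ᵁ U) (a : Γ(X, U)),
        j (X.germToFunctionField U a) = evalAt ψ U h a := by
  obtain ⟨j, hj⟩ : ∃ j : X.functionField →+* L,
      Spec.map (CommRingCat.ofHom j) ≫ genericMap X = ψ := by
    have key : ∀ x, x = ψ (IsLocalRing.closedPoint L) → ∃ j : X.presheaf.stalk x →+* L,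
        Spec.map (CommRingCat.ofHom j) ≫ X.fromSpecStalk x = ψ := by
      rintro _ rfl
      exact ⟨(Scheme.stalkClosedPointTo ψ).hom, Scheme.Spec_stalkClosedPointTo_fromSpecStalk ψ⟩
    exact key _ (apply_eq_genericPoint ψ _).symm
  refine ⟨j, hj, fun U _ h a ↦ ?_⟩
  subst hj
  rw [evalAt_specMap j _ U (top_le_preimage _ U), evalAt_genericMap]

theorem evalAt_app_of_comp_eq {X C : Scheme.{u}} [IsIntegral X] {γ : C ⟶ X} {L : Type u} [Field L]
    {j : X.functionField →+* L} {ψ : Spec (.of L) ⟶ C}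
    (hγ : ψ ≫ γ = Spec.map (CommRingCat.ofHom j) ≫ genericMap X) (U : X.Opens) [Nonempty U]
    (h : ⊤ ≤ ψ ⁻¹ᵁ γ ⁻¹ᵁ U) (a : Γ(X, U)) :
    evalAt ψ (γ ⁻¹ᵁ U) h (γ.app U a) = j (X.germToFunctionField U a) := by
  have h' : ⊤ ≤ (ψ ≫ γ) ⁻¹ᵁ U := h
  have h'' : ⊤ ≤ (Spec.map (CommRingCat.ofHom j) ≫ genericMap X) ⁻¹ᵁ U := hγ ▸ h'
  rw [← evalAt_comp ψ γ U h' h, evalAt_congr hγ h' h'',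
    evalAt_specMap _ _ _ (top_le_preimage _ U), evalAt_genericMap]

theorem exists_functionField_equiv_residueField {X : Scheme.{u}} [IsIntegral X] (x : X)
    (hx : x = genericPoint X) : ∃ e : X.functionField ≃+* X.residueField x,
      ∀ (U : X.Opens) [Nonempty U] (h : x ∈ U) (a : Γ(X, U)),
        e (X.germToFunctionField U a) = X.evaluation U x h a := by
  subst hx
  let φ : X.functionField →+* X.residueField (genericPoint X) := (X.residue (genericPoint X)).hom
  refine ⟨RingEquiv.ofBijective φ ⟨φ.injective, Ideal.Quotient.mk_surjective⟩, fun U _ h a ↦ rfl⟩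

theorem exists_germ_div_germ {X : Scheme.{u}} [IsIntegral X] (U : X.Opens) (hU : IsAffineOpen U)
    [Nonempty U] (f : X.functionField) : ∃ a b : Γ(X, U), X.germToFunctionField U b ≠ 0 ∧
      f = X.germToFunctionField U a / X.germToFunctionField U b := by
  have := functionField_isFractionRing_of_isAffineOpen X U hU
  obtain ⟨a, b, hb, rfl⟩ := IsFractionRing.div_surjective (A := Γ(X, U)) f
  refine ⟨a, b, ?_, rfl⟩
  rw [Ne, map_eq_zero_iff _ (X.germToFunctionField_injective U)]
  exact nonZeroDivisors.ne_zero hb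

/-- The hypothesis `hψ` says that every element of L is a quotient of values of functions on C, so
the function field of C is all of L. The residue fields at the generic points are the function
fields. -/
theorem residueDegree_genericPoint {X C : Scheme.{u}} [IsIntegral X] [IsIntegral C] (γ : C ⟶ X)
    {L : Type u} [Field L] [Algebra X.functionField L] (ψ : Spec (.of L) ⟶ C) [IsDominant ψ]
    (hγ : ψ ≫ γ = Spec.map (CommRingCat.ofHom (algebraMap X.functionField L)) ≫
      genericMap X)
    (hψ : ∀ x : L, ∃ (U : C.Opens) (_ : Nonempty U) (h : ⊤ ≤ ψ ⁻¹ᵁ U) (a b : Γ(C, U)),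
      x = evalAt ψ U h a / evalAt ψ U h b) :
    γ.residueDegree (genericPoint C) = Module.finrank X.functionField L := by
  obtain ⟨j, -, hj⟩ := exists_functionField_hom ψ
  have hjb : Function.Bijective j := by
    refine ⟨j.injective, fun x ↦ ?_⟩
    obtain ⟨U, _, h, a, b, rfl⟩ := hψ x
    exact ⟨C.germToFunctionField U a / C.germToFunctionField U b, by rw [map_div₀, hj U h, hj U h]⟩
  have hgen : γ (genericPoint C) = genericPoint X := by
    have : IsDominant (ψ ≫ γ) := hγ ▸ inferInstance
    rw [← apply_eq_genericPoint ψ (IsLocalRing.closedPoint (R := L))]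
    exact apply_eq_genericPoint (ψ ≫ γ) _
  obtain ⟨e, he⟩ := exists_functionField_equiv_residueField _ hgen
  obtain ⟨e', he'⟩ := exists_functionField_equiv_residueField (genericPoint C) rfl
  let := (γ.residueFieldMap (genericPoint C)).hom.toAlgebra
  refine (Algebra.finrank_eq_of_equiv_equiv e ((RingEquiv.ofBijective j hjb).symm.trans e')
    (RingHom.ext fun f ↦ ?_)).symm
  obtain ⟨U, hU⟩ : ∃ U : X.affineOpens, Nonempty U.1 := by
    obtain ⟨_, ⟨U, hU, rfl⟩, hxU, -⟩ := X.isBasis_affineOpens.exists_subset_of_mem_open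
      (Set.mem_univ (genericPoint X)) isOpen_univ
    exact ⟨⟨U, hU⟩, ⟨_, hxU⟩⟩
  have hmem : γ (genericPoint C) ∈ U.1 := hgen ▸ genericPoint_mem U.1
  have : Nonempty (γ ⁻¹ᵁ U.1) := ⟨genericPoint C, hmem⟩
  -- Compatibility of the two field extensions need only be checked on regular functions, since
  -- their quotients exhaust the function field.
  have key (a : Γ(X, U)) : γ.residueFieldMap (genericPoint C) (e (X.germToFunctionField U.1 a)) =
      e' ((RingEquiv.ofBijective j hjb).symm
        (algebraMap X.functionField L (X.germToFunctionField U.1 a))) := by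
    have h1 : algebraMap X.functionField L (X.germToFunctionField U.1 a) =
        RingEquiv.ofBijective j hjb (C.germToFunctionField (γ ⁻¹ᵁ U.1) (γ.app U.1 a)) := by
      rw [RingEquiv.ofBijective_apply, hj _ (top_le_preimage ψ _), evalAt_app_of_comp_eq hγ]
    rw [h1, RingEquiv.symm_apply_apply, he _ hmem, he' _ (genericPoint_mem _)]
    exact Scheme.evaluation_naturality_apply γ _ _ _
  obtain ⟨a, b, -, rfl⟩ := exists_germ_div_germ U.1 U.2 f
  rw [map_div₀, map_div₀]
  congr 1
  · exact key a
  · exact key b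

end GenericPoints
-- Double covers obtained by adjoining a square root
section SqrtCover
variable {X : Scheme.{u}} [IsNonsingularCurve X]

/-- `γ : C ⟶ X` is the double cover of `X` which is given by adjoining a square root `ρ` of a
rational function `δ`, such that over an open set on which `h` generates `O(D)` the regular
functions on `C` are the `a + b h ρ` for `a`, `b` regular on `X`. -/
structure IsSqrtCover (D : Divisor X) {C : Scheme.{u}} (γ : C ⟶ X) {L : Type u} [Field L]
    [Algebra X.functionField L] (ψ : Spec (.of L) ⟶ C) (ρ : L) (δ : X.functionField) : Prop where
  isIntegral : IsIntegral C
  isDominant : IsDominant ψ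
  comp_eq : ψ ≫ γ = Spec.map (CommRingCat.ofHom (algebraMap X.functionField L)) ≫ genericMap X
  sq_eq : ρ ^ 2 = algebraMap _ _ δ
  ne_algebraMap : ∀ a : X.functionField, ρ ≠ algebraMap _ _ a
  exists_eq : ∀ x : L, ∃ a b : X.functionField, x = algebraMap _ _ a + algebraMap _ _ b * ρ
  isAffineOpen : ∀ (U : ChartIndex X) (h), IsGenerator D U.1.toOpens h →
    IsAffineOpen (γ ⁻¹ᵁ U.1.toOpens)
  mem_range_iff : ∀ (U : ChartIndex X) (h), IsGenerator D U.1.toOpens h → ∀ (h') (z : L),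
    (∃ r, evalAt ψ (γ ⁻¹ᵁ U.1.toOpens) h' r = z) ↔ ∃ a b : Γ(X, U.1.toOpens),
      z = algebraMap _ _ (X.germToFunctionField _ a) +
        algebraMap _ _ (X.germToFunctionField _ b * h) * ρ

namespace IsSqrtCover
variable {D : Divisor X} {C : Scheme.{u}} {γ : C ⟶ X} {L : Type u} [Field L]
  [Algebra X.functionField L] {ψ : Spec (.of L) ⟶ C} {ρ : L} {δ : X.functionField}

theorem eq_zero (H : IsSqrtCover D γ ψ ρ δ) {a b : X.functionField}
    (e : algebraMap _ L a + algebraMap _ _ b * ρ = 0) : a = 0 ∧ b = 0 := by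
  have hb : b = 0 := by
    by_contra hb
    refine H.ne_algebraMap (-a / b) ?_
    have : algebraMap _ L b ≠ 0 := by simpa using hb
    rw [map_div₀, eq_div_iff this, map_neg]
    linear_combination e
  subst hb
  simpa using e

theorem unique (H : IsSqrtCover D γ ψ ρ δ) {a b a' b' : X.functionField}
    (e : algebraMap _ L a + algebraMap _ _ b * ρ = algebraMap _ L a' + algebraMap _ _ b' * ρ) :
    a = a' ∧ b = b' := by
  have := H.eq_zero (a := a - a') (b := b - b') (by rw [map_sub, map_sub]; linear_combination e)
  exact ⟨sub_eq_zero.mp this.1, sub_eq_zero.mp this.2⟩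

theorem ne_zero (H : IsSqrtCover D γ ψ ρ δ) : δ ≠ 0 := by
  rintro rfl
  have := H.sq_eq
  rw [map_zero, sq_eq_zero_iff] at this
  exact H.ne_algebraMap 0 (by rw [this, map_zero])

theorem finrank_eq (H : IsSqrtCover D γ ψ ρ δ) : Module.finrank X.functionField L = 2 := by
  have h : Module.finrank X.functionField L = Fintype.card (Fin 2) := by
    refine Module.finrank_eq_card_basis (Module.Basis.mk (v := ![1, ρ]) ?_ ?_)
    · rw [LinearIndependent.pair_iff]
      intro s t e
      rw [Algebra.smul_def, Algebra.smul_def, mul_one] at e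
      exact H.eq_zero e
    · rintro x -
      obtain ⟨a, b, rfl⟩ := H.exists_eq x
      rw [Matrix.range_cons, Matrix.range_cons, Matrix.range_empty, Set.union_empty,
        Set.singleton_union, Submodule.mem_span_pair]
      exact ⟨a, b, by rw [Algebra.smul_def, Algebra.smul_def, mul_one]⟩
  simpa using h

theorem top_le (H : IsSqrtCover D γ ψ ρ δ) (U : X.Opens) [Nonempty U] : ⊤ ≤ ψ ⁻¹ᵁ γ ⁻¹ᵁ U := by
  change ⊤ ≤ (ψ ≫ γ) ⁻¹ᵁ U
  rw [H.comp_eq]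
  exact top_le_preimage _ U

theorem nonempty_preimage (H : IsSqrtCover D γ ψ ρ δ) (U : X.Opens) [Nonempty U] :
    Nonempty (γ ⁻¹ᵁ U) :=
  ⟨⟨ψ (IsLocalRing.closedPoint (R := L)), H.top_le U trivial⟩⟩

/-- Take y = hρ. Its square δh² has no ρ-component, so by uniqueness of coordinates in L over k(X)
it is the image of a regular function d on U. -/
theorem exists_isQuadratic (H : IsSqrtCover D γ ψ ρ δ) (U : ChartIndex X) {h : X.functionField}
    (hh : IsGenerator D U.1.toOpens h) :
    letI := (γ.app U.1.toOpens).hom.toAlgebra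
    ∃ (y : Γ(C, γ ⁻¹ᵁ U.1.toOpens)) (d : Γ(X, U.1.toOpens)),
      IsQuadratic Γ(X, U.1.toOpens) Γ(C, γ ⁻¹ᵁ U.1.toOpens) y d ∧
      evalAt ψ _ (H.top_le _) y = algebraMap _ _ h * ρ ∧ X.germToFunctionField _ d = δ * h ^ 2 := by
  let := (γ.app U.1.toOpens).hom.toAlgebra
  have := H.isIntegral
  have := H.isDominant
  have hinj := evalAt_injective ψ (γ ⁻¹ᵁ U.1.toOpens) (H.top_le _)
  have hA (a : Γ(X, U.1.toOpens)) : evalAt ψ _ (H.top_le _) (algebraMap _ Γ(C, γ ⁻¹ᵁ U.1.toOpens) a) =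
      algebraMap _ L (X.germToFunctionField _ a) := evalAt_app_of_comp_eq H.comp_eq _ _ _
  obtain ⟨y, hy⟩ := (H.mem_range_iff U h hh (H.top_le _) (algebraMap _ _ h * ρ)).mpr
    ⟨0, 1, by simp⟩
  obtain ⟨d, b, hd⟩ := (H.mem_range_iff U h hh (H.top_le _) _).mp ⟨y ^ 2, rfl⟩
  rw [map_pow, hy, mul_pow, H.sq_eq, ← map_pow, ← map_mul] at hd
  obtain ⟨h1, -⟩ := H.unique (a := h ^ 2 * δ) (b := 0) (a' := X.germToFunctionField _ d)
    (b' := X.germToFunctionField _ b * h) (by rw [map_zero, zero_mul, add_zero]; exact hd)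
  refine ⟨y, d, ⟨hinj ?_, fun r ↦ ?_, fun a b e ↦ ?_⟩, hy, by rw [← h1]; ring⟩
  · rw [map_pow, hy, mul_pow, H.sq_eq, hA, ← h1, ← map_pow, ← map_mul]
  · obtain ⟨a, b, e⟩ := (H.mem_range_iff U h hh (H.top_le _) _).mp ⟨r, rfl⟩
    refine ⟨a, b, hinj ?_⟩
    rw [e]
    simp only [map_add, map_mul, hA, hy, mul_assoc]
  · have e := congrArg (evalAt ψ _ (H.top_le _)) e
    simp only [map_add, map_mul (evalAt ψ _ (H.top_le _)), hA, hy, map_zero, ← mul_assoc] at e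
    rw [← map_mul] at e
    obtain ⟨h1, h2⟩ := H.eq_zero e
    refine ⟨X.germToFunctionField_injective _ (by rw [h1, map_zero]),
      X.germToFunctionField_injective _ ?_⟩
    rw [map_zero]
    exact (mul_eq_zero.mp h2).resolve_right hh.ne_zero

theorem isFinite (H : IsSqrtCover D γ ψ ρ δ) : IsFinite γ := by
  choose U h hx hh using exists_isGenerator D
  have : HasAffineProperty @IsFinite (affineAnd RingHom.Finite) :=
    (HasAffineProperty.affineAnd_iff _ RingHom.finite_respectsIso
      RingHom.finite_localizationPreserves.away RingHom.finite_ofLocalizationSpan).mpr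
      fun f ↦ isFinite_iff f
  refine (HasAffineProperty.iff_of_iSup_eq_top (P := @IsFinite)
    (fun x ↦ (⟨(U x).1.toOpens, (U x).1.2⟩ : X.affineOpens))
    (top_le_iff.mp fun x _ ↦ Opens.mem_iSup.mpr ⟨x, hx x⟩)).mpr fun x ↦
    ⟨H.isAffineOpen (U x) (h x) (hh x), ?_⟩
  let := (γ.app (U x).1.toOpens).hom.toAlgebra
  obtain ⟨y, d, hq, -⟩ := H.exists_isQuadratic (U x) (hh x)
  have h1 : (γ.app (U x).1.toOpens).hom.Finite := hq.module_finite
  change (Scheme.Hom.app (γ ∣_ (U x).1.toOpens) ⊤).hom.Finite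
  have h2 : ∀ W, W = (U x).1.toOpens → (γ.app W).hom.Finite := by rintro _ rfl; exact h1
  rw [morphismRestrict_app]
  exact (RingHom.Finite.of_surjective (CommRingCat.Hom.hom (C.presheaf.map (eqToHom _).op))
    (ConcreteCategory.bijective_of_isIso _).2).comp (h2 _ (Scheme.Opens.ι_image_top _))

theorem isTwoToOne (H : IsSqrtCover D γ ψ ρ δ) :
    letI := H.isIntegral
    IsTwoToOne γ := by
  let := H.isIntegral
  have := H.isFinite
  have := H.isDominant
  refine ⟨inferInstance, ?_, ?_⟩
  · have : IsDominant γ := by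
      have : IsDominant (ψ ≫ γ) := H.comp_eq ▸ inferInstance
      exact IsDominant.of_comp ψ γ
    refine surjective_of_isDominant_of_isClosed_range γ ?_
    exact γ.isClosedMap.isClosed_range
  · rw [residueDegree_genericPoint γ ψ H.comp_eq, H.finrank_eq]
    intro x
    obtain ⟨U, h, -, hh⟩ := exists_isGenerator D (genericPoint X)
    obtain ⟨a, b, rfl⟩ := H.exists_eq x
    obtain ⟨a, c, hc, rfl⟩ := exists_germ_div_germ U.1.toOpens U.1.2 a
    -- Expanding b/h instead of b puts the element into the form a/c + (b/d)·hρ, which equals (ad +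
    -- bc·hρ)/(cd), a quotient of functions on C.
    obtain ⟨b, d, hd, hb⟩ := exists_germ_div_germ U.1.toOpens U.1.2 (b / h)
    replace hb := (div_eq_iff hh.ne_zero).mp hb
    subst hb
    obtain ⟨r, hr⟩ := (H.mem_range_iff U h hh (H.top_le _) _).mpr ⟨a * d, b * c, rfl⟩
    refine ⟨_, H.nonempty_preimage U.1.toOpens, H.top_le _, r, γ.app _ (c * d), ?_⟩
    rw [hr, evalAt_app_of_comp_eq H.comp_eq]
    have hc' : algebraMap _ L (X.germToFunctionField _ c) ≠ 0 := by simpa using hc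
    have hd' : algebraMap _ L (X.germToFunctionField _ d) ≠ 0 := by simpa using hd
    simp only [map_mul, map_div₀]
    field_simp

end IsSqrtCover
end SqrtCover
-- The branch locus of a square root cover
namespace IsSqrtCover
variable {X : Scheme.{u}} [IsNonsingularCurve X]
  {D : Divisor X} {C : Scheme.{u}} {γ : C ⟶ X} {L : Type u} [Field L]
  [Algebra X.functionField L] {ψ : Spec (.of L) ⟶ C} {ρ : L} {δ : X.functionField}

theorem isUnit_germ_iff {U : X.Opens} [Nonempty U] (d : Γ(X, U)) (hd : d ≠ 0) {x : X} (hx : x ∈ U) :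
    IsUnit (X.presheaf.germ U x hx d) ↔ Scheme.ord (X.germToFunctionField U d) x = 0 := by
  have hne : X.germToFunctionField U d ≠ 0 := by
    rwa [Ne, map_eq_zero_iff _ (X.germToFunctionField_injective U)]
  by_cases h1 : Order.coheight x = 1
  · have := isDVR_stalk x h1
    rw [Scheme.ord_eq_iff h1 hne, ← Scheme.algebraMap_germ_eq_germToFunctionField X hx]
    exact Ring.isUnit_iff_ordFrac_one_of_isDiscreteValuationRing (K := X.functionField)
  · rw [Scheme.ord_eq_zero_of_coheight_neq_one h1]
    obtain rfl : x = genericPoint X := by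
      by_contra hx
      exact h1 (coheight_eq_one_of_ne_genericPoint hx)
    exact iff_of_true (isUnit_iff_ne_zero (G₀ := X.functionField) |>.mpr hne) rfl

/-- Near x the function δh² is regular, and h has order -D there. -/
theorem nonneg_ord (H : IsSqrtCover D γ ψ ρ δ) (x : PrimeDivisor X) :
    0 ≤ Scheme.ord δ x.1 - 2 * D x := by
  obtain ⟨U, h, hx, hh⟩ := exists_isGenerator D x.1
  obtain ⟨y, d, -, -, hd⟩ := H.exists_isQuadratic U hh
  have h1 := zero_le_ord_germ (a := d) (by
    rintro rfl
    rw [map_zero, eq_comm] at hd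
    exact mul_ne_zero H.ne_zero (pow_ne_zero 2 hh.ne_zero) hd) hx
  rw [hd, Scheme.ord_mul H.ne_zero (pow_ne_zero 2 hh.ne_zero), ord_eq_of_sq hh.ne_zero,
    hh.ord_eq x hx] at h1
  omega

/-- This is the criterion for A ⊕ A y read off at the stalks. If d is not a unit at γ c, then y lies
in the prime of c: otherwise y² = d would be a unit upstairs, hence downstairs because the stalk map
is local. -/
theorem formallyUnramified_iff (H : IsSqrtCover D γ ψ ρ δ) (h2 : ∀ U : X.Opens, IsUnit (2 : Γ(X, U)))
    (U : ChartIndex X) {h : X.functionField} (hh : IsGenerator D U.1.toOpens h) (c : C)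
    (hc : γ c ∈ U.1.toOpens) (d : Γ(X, U.1.toOpens)) (hd : X.germToFunctionField _ d = δ * h ^ 2) :
    (γ.stalkMap c).hom.FormallyUnramified ↔ IsUnit (X.presheaf.germ _ _ hc d) := by
  have := H.isIntegral
  have := H.isDominant
  let alg1 := (γ.app U.1.toOpens).hom.toAlgebra
  obtain ⟨y, d', hq, hy, hd'⟩ := H.exists_isQuadratic U hh
  obtain rfl : d = d' := X.germToFunctionField_injective _ (hd.trans hd'.symm)
  let alg2 := (X.presheaf.germ _ _ hc).hom.toAlgebra
  let c' : γ ⁻¹ᵁ U.1.toOpens := ⟨c, hc⟩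
  let alg3 : Algebra Γ(C, γ ⁻¹ᵁ U.1.toOpens) (C.presheaf.stalk c) :=
    TopCat.Presheaf.algebra_section_stalk C.presheaf c'
  let alg4 := (γ.stalkMap c).hom.toAlgebra
  let alg5 : Algebra Γ(X, U.1.toOpens) (C.presheaf.stalk c) :=
    ((γ.stalkMap c).hom.comp (X.presheaf.germ _ _ hc).hom).toAlgebra
  have tow1 : IsScalarTower Γ(X, U.1.toOpens) (X.presheaf.stalk (γ c)) (C.presheaf.stalk c) :=
    IsScalarTower.of_algebraMap_eq fun _ ↦ rfl
  have tow2 : IsScalarTower Γ(X, U.1.toOpens) Γ(C, γ ⁻¹ᵁ U.1.toOpens) (C.presheaf.stalk c) :=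
    IsScalarTower.of_algebraMap_eq fun a ↦
      ConcreteCategory.congr_hom (Scheme.Hom.germ_stalkMap γ U.1.toOpens c hc) a
  let P := ((H.isAffineOpen U h hh).primeIdealOf c').asIdeal
  have loc1 : IsLocalization.AtPrime (C.presheaf.stalk c) P :=
    (H.isAffineOpen U h hh).isLocalization_stalk c'
  let alg6 : Algebra Γ(X, U.1.toOpens) (X.presheaf.stalk (γ c)) :=
    TopCat.Presheaf.algebra_section_stalk X.presheaf (⟨γ c, hc⟩ : U.1.toOpens)
  have loc2 : IsLocalization.AtPrime (X.presheaf.stalk (γ c))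
      (U.1.2.primeIdealOf ⟨γ c, hc⟩).asIdeal :=
    U.1.2.isLocalization_stalk ⟨γ c, hc⟩
  have h2T : IsUnit (2 : C.presheaf.stalk c) := by
    have := (h2 U.1.toOpens).map (algebraMap Γ(X, U.1.toOpens) (C.presheaf.stalk c))
    rwa [map_ofNat] at this
  constructor
  · contrapose
    intro hu
    refine hq.not_formallyUnramified h2T P
      (U.1.2.primeIdealOf ⟨γ c, hc⟩).asIdeal.primeCompl ?_ ?_
    · by_contra hyP
      refine hu ?_
      have h3 : IsUnit (algebraMap _ (C.presheaf.stalk c) y) :=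
        (IsLocalization.AtPrime.isUnit_to_map_iff _ P y).mpr hyP
      have h4 := h3.pow 2
      rw [← map_pow, hq.sq_eq, ← IsScalarTower.algebraMap_apply] at h4
      exact isUnit_of_map_unit (γ.stalkMap c).hom _ h4
    · rw [Ne, map_eq_zero_iff]
      · rintro rfl
        rw [map_zero, eq_comm] at hy
        refine mul_ne_zero ?_ ?_ hy
        · simpa using hh.ne_zero
        · rintro rfl
          exact H.ne_algebraMap 0 (map_zero _).symm
      · exact germ_injective_of_isIntegral C c hc
  · intro hu
    exact hq.formallyUnramified P.primeCompl h2T hu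

/-- The criterion sees only d at γ c, so either all points over x are ramified or none is;
surjectivity provides such a point. The order of d = δh² at x is ord δ - 2D. -/
theorem mem_branchLocus_iff (H : IsSqrtCover D γ ψ ρ δ) (h2 : ∀ U : X.Opens, IsUnit (2 : Γ(X, U)))
    (x : X) : x ∈ branchLocus γ ↔
      ∃ hx : Order.coheight x = 1, 1 ≤ Scheme.ord δ x - 2 * D ⟨x, hx⟩ := by
  have := H.isIntegral
  obtain ⟨U, h, hx, hh⟩ := exists_isGenerator D x
  let alg1 := (γ.app U.1.toOpens).hom.toAlgebra
  obtain ⟨-, d, -, -, hd⟩ := H.exists_isQuadratic U hh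
  have hd0 : d ≠ 0 := by
    rintro rfl
    rw [map_zero, eq_comm] at hd
    exact mul_ne_zero H.ne_zero (pow_ne_zero 2 hh.ne_zero) hd
  have key : x ∈ branchLocus γ ↔ ¬ IsUnit (X.presheaf.germ _ _ hx d) := by
    constructor
    · rintro ⟨c, rfl, hc⟩
      rwa [H.formallyUnramified_iff h2 U hh c hx d hd] at hc
    · intro hu
      have := H.isTwoToOne.surjective
      obtain ⟨c, rfl⟩ := γ.surjective x
      refine ⟨c, rfl, ?_⟩
      rwa [H.formallyUnramified_iff h2 U hh c hx d hd]
  rw [key, isUnit_germ_iff d hd0]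
  by_cases h1 : Order.coheight x = 1
  · have h3 := H.nonneg_ord ⟨x, h1⟩
    rw [hd, Scheme.ord_mul H.ne_zero (pow_ne_zero 2 hh.ne_zero), ord_eq_of_sq hh.ne_zero,
      hh.ord_eq ⟨x, h1⟩ hx]
    simp only [h1, exists_true_left]
    simp only at h3
    omega
  · simp [h1]

end IsSqrtCover

/-! ### Nonsingularity of square root covers, and when two of them are isomorphic -/

theorem isDedekindDomain_of_isIntegralClosure (A F L R : Type*) [CommRing A] [Field F] [Field L]
    [CommRing R] [Algebra A F] [IsFractionRing A F] [Algebra F L] [Algebra A L]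
    [IsScalarTower A F L] [FiniteDimensional F L] [Algebra A R] [Algebra R L] [IsScalarTower A R L]
    [IsIntegralClosure R A L] [IsDedekindDomain A] [Module.Finite A R] : IsDedekindDomain R := by
  have hinj := IsIntegralClosure.algebraMap_injective R A L
  have : IsDomain R := hinj.isDomain _
  have : IsNoetherianRing R := IsNoetherianRing.of_finite A R
  have : Ring.DimensionLEOne R := Ring.DimensionLEOne.of_isIntegral A R
  have := integralClosure.isIntegrallyClosedOfFiniteExtension (R := A) F (L := L)
  have : IsIntegrallyClosed R :=
    IsIntegrallyClosed.of_equiv (IsIntegralClosure.equiv A (integralClosure A L) L R).toRingEquiv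
  have : IsIntegralClosure R R (FractionRing R) :=
    (isIntegrallyClosed_iff_isIntegralClosure _).mp inferInstance
  exact { toIsDomain := inferInstance, toIsDedekindRing := {} }

namespace IsSqrtCover
variable {X : Scheme.{u}} [IsNonsingularCurve X]
  {D : Divisor X} {C : Scheme.{u}} {γ : C ⟶ X} {L : Type u} [Field L]
  [Algebra X.functionField L] {ψ : Spec (.of L) ⟶ C} {ρ : L} {δ : X.functionField}

theorem isQuadratic (H : IsSqrtCover D γ ψ ρ δ) : IsQuadratic X.functionField L ρ δ :=
  ⟨H.sq_eq, H.exists_eq, fun _ _ ↦ H.eq_zero⟩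

theorem exists_involution (H : IsSqrtCover D γ ψ ρ δ) : ∃ σ : L →ₐ[X.functionField] L,
    ∀ a b : X.functionField, σ (algebraMap _ _ a + algebraMap _ _ b * ρ) =
      algebraMap _ _ a - algebraMap _ _ b * ρ := by
  obtain ⟨σ, hσ⟩ := H.isQuadratic.exists_involution
  exact ⟨{ σ with commutes' := fun a ↦ by simpa using hσ a 0 }, hσ⟩

/-- The coordinate ring is the integral closure of A in L. If u + vρ is integral, adding its
conjugate shows that 2u, hence u, is in A; then vρ is integral, so v²δ is in A. From 2 ord v + ord δ
≥ 0 and ord δ ≤ 2D + 1 follows 2(ord v + D) ≥ -1, and by parity v is a section of O(D). -/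
theorem isDedekindDomain (H : IsSqrtCover D γ ψ ρ δ) (h2 : ∀ U : X.Opens, IsUnit (2 : Γ(X, U)))
    (hδ : ∀ x : PrimeDivisor X, Scheme.ord δ x.1 - 2 * D x ≤ 1)
    (U : ChartIndex X) {h : X.functionField} (hh : IsGenerator D U.1.toOpens h) :
    IsDedekindDomain Γ(C, γ ⁻¹ᵁ U.1.toOpens) := by
  have := H.isIntegral
  have := H.isDominant
  let alg1 := (γ.app U.1.toOpens).hom.toAlgebra
  obtain ⟨y, d, hq, hy, hd⟩ := H.exists_isQuadratic U hh
  have := isDedekindDomain_sections U.1.toOpens U.1.2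
  have := functionField_isFractionRing_of_isAffineOpen X U.1.toOpens U.1.2
  let alg2 : Algebra Γ(X, U.1.toOpens) L :=
    ((algebraMap X.functionField L).comp (algebraMap Γ(X, U.1.toOpens) X.functionField)).toAlgebra
  have tow1 : IsScalarTower Γ(X, U.1.toOpens) X.functionField L :=
    IsScalarTower.of_algebraMap_eq fun _ ↦ rfl
  have : FiniteDimensional X.functionField L :=
    FiniteDimensional.of_finrank_pos (by rw [H.finrank_eq]; exact two_pos)
  let alg3 : Algebra Γ(C, γ ⁻¹ᵁ U.1.toOpens) L := (evalAt ψ _ (H.top_le _)).toAlgebra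
  have tow2 : IsScalarTower Γ(X, U.1.toOpens) Γ(C, γ ⁻¹ᵁ U.1.toOpens) L :=
    IsScalarTower.of_algebraMap_eq fun a ↦ (evalAt_app_of_comp_eq H.comp_eq _ _ a).symm
  have := hq.module_finite
  have hF {f : X.functionField} (hf : IsIntegral Γ(X, U.1.toOpens) (algebraMap _ L f)) :
      ∃ a : Γ(X, U.1.toOpens), X.germToFunctionField _ a = f :=
    IsIntegrallyClosed.isIntegral_iff.mp ((isIntegral_algebraMap_iff
      (algebraMap X.functionField L).injective).mp hf)
  have : IsIntegralClosure Γ(C, γ ⁻¹ᵁ U.1.toOpens) Γ(X, U.1.toOpens) L := by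
    refine ⟨evalAt_injective ψ _ (H.top_le _), fun {x} ↦ ⟨fun hx ↦ ?_, ?_⟩⟩
    · refine (H.mem_range_iff U h hh (H.top_le _) x).mpr ?_
      obtain ⟨σ, hσ⟩ := H.exists_involution
      obtain ⟨u, v, rfl⟩ := H.exists_eq x
      have hx' := hx.map (σ.restrictScalars Γ(X, U.1.toOpens))
      rw [AlgHom.restrictScalars_apply, hσ] at hx'
      obtain ⟨a, ha⟩ : ∃ a : Γ(X, U.1.toOpens), X.germToFunctionField _ a = u := by
        obtain ⟨a, ha⟩ := hF (f := 2 * u) (by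
          have := hx.add hx'
          rwa [add_add_sub_cancel, ← two_mul, ← map_ofNat (algebraMap X.functionField L) 2,
            ← map_mul] at this)
        obtain ⟨w, hw⟩ := (h2 U.1.toOpens).exists_left_inv
        refine ⟨w * a, ?_⟩
        have := congrArg (X.germToFunctionField U.1.toOpens) hw
        rw [map_mul, map_ofNat, map_one] at this
        rw [map_mul, ha, ← mul_assoc, this, one_mul]
      subst ha
      have hv : IsIntegral Γ(X, U.1.toOpens) (algebraMap X.functionField L v * ρ) := by
        have := hx.sub (isIntegral_algebraMap (x := a))
        rw [IsScalarTower.algebraMap_apply Γ(X, U.1.toOpens) X.functionField L] at this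
        rwa [show algebraMap Γ(X, U.1.toOpens) X.functionField a =
          X.germToFunctionField U.1.toOpens a from rfl, add_sub_cancel_left] at this
      obtain ⟨e, he⟩ := hF (f := v ^ 2 * δ) (by
        have := hv.pow 2
        rwa [mul_pow, H.sq_eq, ← map_pow, ← map_mul] at this)
      have hvD : v ∈ ((1 : ℤ) • D).sections U.1.toOpens := by
        rw [one_smul]
        intro hv0 x hx
        have hm := ord_germ_nonneg_of_mem (germ_mem_sections e)
          (he ▸ mul_ne_zero (pow_ne_zero 2 hv0) H.ne_zero) x hx
        rw [he, Scheme.ord_mul (pow_ne_zero 2 hv0) H.ne_zero, ord_eq_of_sq hv0] at hm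
        have := hδ x
        omega
      obtain ⟨b, rfl⟩ := (hh.exists_eq_germ_mul 1).mp hvD
      exact ⟨a, b, by rw [zpow_one]⟩
    · rintro ⟨r, rfl⟩
      exact (Algebra.IsIntegral.isIntegral (R := Γ(X, U.1.toOpens)) r).map
        (IsScalarTower.toAlgHom Γ(X, U.1.toOpens) _ L)
  exact isDedekindDomain_of_isIntegralClosure Γ(X, U.1.toOpens) X.functionField L _

theorem isPrincipalIdealRing_stalk (H : IsSqrtCover D γ ψ ρ δ)
    (h2 : ∀ U : X.Opens, IsUnit (2 : Γ(X, U)))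
    (hδ : ∀ x : PrimeDivisor X, Scheme.ord δ x.1 - 2 * D x ≤ 1) (c : C) :
    IsPrincipalIdealRing (C.presheaf.stalk c) := by
  have := H.isIntegral
  by_cases hc : c = genericPoint C
  · subst hc
    exact inferInstanceAs (IsPrincipalIdealRing C.functionField)
  obtain ⟨U, h, hx, hh⟩ := exists_isGenerator D (γ c)
  have := H.isDedekindDomain h2 hδ U hh
  have hV := H.isAffineOpen U h hh
  have : Nonempty (γ ⁻¹ᵁ U.1.toOpens) := ⟨c, hx⟩
  let c' : γ ⁻¹ᵁ U.1.toOpens := ⟨c, hx⟩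
  let := TopCat.Presheaf.algebra_section_stalk C.presheaf c'
  have loc1 : IsLocalization.AtPrime (C.presheaf.stalk c) (hV.primeIdealOf c').asIdeal :=
    hV.isLocalization_stalk c'
  have hP : (hV.primeIdealOf c').asIdeal ≠ ⊥ := by
    intro h0
    have h1 := hV.primeIdealOf_genericPoint
    rw [genericPoint_eq_bot_of_affine] at h1
    have h2 : hV.primeIdealOf c' = ⊥ := PrimeSpectrum.ext h0
    have h3 := congrArg hV.fromSpec (h2.trans h1.symm)
    exact hc ((hV.fromSpec_primeIdealOf c').symm.trans (h3.trans (hV.fromSpec_primeIdealOf _)))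
  have := IsLocalization.AtPrime.isDiscreteValuationRing_of_dedekind_domain _ hP
    (C.presheaf.stalk c)
  infer_instance

theorem exists_ne_genericPoint (X : Scheme.{u}) [IsNonsingularCurve X] : ∃ x : X, x ≠ genericPoint X := by
  by_contra! h
  have h1 : topologicalKrullDim X = 0 := by
    rw [← krullDim_eq_topologicalKrullDim, Order.krullDim_eq_iSup_coheight]
    have h0 (x : X) : Order.coheight x = 0 := by rw [h x, coheight_genericPoint]
    simp [h0]
  rw [IsNonsingularCurve.dim_eq_one] at h1
  exact one_ne_zero h1

/-- The stalks are principal ideal rings, hence regular of dimension at most one. Dimension one is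
attained because C maps onto X, so some point of C is not generic. -/
theorem isNonsingularCurve (H : IsSqrtCover D γ ψ ρ δ)
    (h2 : ∀ U : X.Opens, IsUnit (2 : Γ(X, U)))
    (hδ : ∀ x : PrimeDivisor X, Scheme.ord δ x.1 - 2 * D x ≤ 1) : IsNonsingularCurve C := by
  have := H.isIntegral
  have := H.isDominant
  have := H.isFinite
  have hpir := H.isPrincipalIdealRing_stalk h2 hδ
  have : IsLocallyNoetherian C := LocallyOfFiniteType.isLocallyNoetherian γ
  have : CompactSpace C := QuasiCompact.compactSpace_of_compactSpace γ
  refine { regular := fun c ↦ inferInstance, dim_eq_one := ?_ }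
  rw [← krullDim_eq_topologicalKrullDim]
  refine le_antisymm ?_ ?_
  · rw [Order.krullDim_eq_iSup_coheight]
    refine iSup_le fun c ↦ ?_
    rw [← ringKrullDim_stalk_eq_coheight]
    exact Order.KrullDimLE.krullDim_le (α := PrimeSpectrum (C.presheaf.stalk c)) (n := 1)
  · obtain ⟨x, hx⟩ := exists_ne_genericPoint X
    have := H.isTwoToOne.surjective
    obtain ⟨c, rfl⟩ := γ.surjective x
    have hc : c ≠ genericPoint C := by
      rintro rfl
      refine hx ?_
      have : IsDominant (ψ ≫ γ) := H.comp_eq ▸ inferInstance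
      rw [← apply_eq_genericPoint ψ (IsLocalRing.closedPoint (R := L))]
      exact apply_eq_genericPoint (ψ ≫ γ) _
    refine le_trans ?_ (Order.coheight_le_krullDim c)
    exact_mod_cast Order.one_le_iff_ne_zero.mpr (coheight_ne_zero_of_ne_genericPoint hc)

/-- Sending ρ' to cρ maps L' into L over k(X). As c is invertible on every open set, the subrings A
+ A hρ and A + A h(cρ) of L coincide. -/
theorem exists_iso (H : IsSqrtCover D γ ψ ρ δ) {C' : Scheme.{u}} {γ' : C' ⟶ X} {L' : Type u}
    [Field L'] [Algebra X.functionField L'] {ψ' : Spec (.of L') ⟶ C'} {ρ' : L'}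
    {δ' : X.functionField} (H' : IsSqrtCover D γ' ψ' ρ' δ') (c : X.functionField)
    (hc : c ^ 2 * δ = δ') (hc0 : ∀ x, Scheme.ord c x = 0) :
    ∃ e : C ≅ C', e.hom ≫ γ' = γ := by
  have := H.isIntegral
  have := H.isDominant
  have := H.isFinite
  have := H'.isIntegral
  have := H'.isDominant
  have := H'.isFinite
  have hcne : c ≠ 0 := by
    rintro rfl
    exact H'.ne_zero (by rw [← hc]; ring)
  obtain ⟨τ, hτ⟩ := H'.isQuadratic.exists_lift (algebraMap X.functionField L)
    (z := algebraMap _ _ c * ρ) (by rw [mul_pow, H.sq_eq, ← map_pow, ← map_mul, hc])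
  have hτ0 : τ.comp (algebraMap X.functionField L') = algebraMap X.functionField L :=
    RingHom.ext fun a ↦ by simpa using hτ a 0
  have e : ψ ≫ γ = (Spec.map (CommRingCat.ofHom τ) ≫ ψ') ≫ γ' := by
    rw [Category.assoc, H.comp_eq, H'.comp_eq, ← Spec.map_comp_assoc, ← CommRingCat.ofHom_comp, hτ0]
  have htop (U : X.Opens) [Nonempty U] : ⊤ ≤ (Spec.map (CommRingCat.ofHom τ) ≫ ψ') ⁻¹ᵁ γ' ⁻¹ᵁ U := by
    have := H'.nonempty_preimage U
    exact top_le_preimage _ _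
  choose U h hx hh using exists_isGenerator D
  refine exists_iso_of_range_eq γ γ' ψ (Spec.map (CommRingCat.ofHom τ) ≫ ψ') e
    (fun x ↦ (⟨(U x).1.toOpens, (U x).1.2⟩ : X.affineOpens))
    (top_le_iff.mp fun x _ ↦ Opens.mem_iSup.mpr ⟨x, hx x⟩) (fun x ↦ H.top_le (U x).1.toOpens)
    (fun x ↦ htop (U x).1.toOpens) fun x ↦ ?_
  have hsec (c : X.functionField) (hc0 : ∀ x, Scheme.ord c x = 0) :
      ∃ u : Γ(X, (U x).1.toOpens), X.germToFunctionField _ u = c :=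
    exists_germ_eq_of_mem_sections _ fun _ x _ ↦ by simp [hc0]
  obtain ⟨u, hu⟩ := hsec c hc0
  obtain ⟨v, hv⟩ := hsec c⁻¹ fun x ↦ by rw [ord_inv' hcne, hc0, neg_zero]
  have huv : X.germToFunctionField _ v * c = 1 := by rw [hv, inv_mul_cancel₀ hcne]
  ext z
  rw [RingHom.mem_range, RingHom.mem_range]
  refine Iff.trans ?_ (H.mem_range_iff (U x) (h x) (hh x) _ z).symm
  constructor
  · rintro ⟨r, rfl⟩
    rw [evalAt_specMap τ ψ' _ (H'.top_le _)]
    obtain ⟨a, b, hab⟩ := (H'.mem_range_iff (U x) (h x) (hh x) (H'.top_le _) _).mp ⟨r, rfl⟩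
    refine ⟨a, b * u, ?_⟩
    have hbu : X.germToFunctionField _ (b * u) = X.germToFunctionField _ b * c := by
      rw [map_mul, hu]
    rw [hab, hτ, hbu]
    simp only [map_mul]
    ring
  · rintro ⟨a, b, rfl⟩
    obtain ⟨r, hr⟩ := (H'.mem_range_iff (U x) (h x) (hh x) (H'.top_le _) _).mpr
      ⟨a, b * v, rfl⟩
    refine ⟨r, ?_⟩
    rw [evalAt_specMap τ ψ' _ (H'.top_le _), hr, hτ]
    congr 1
    have hbv : X.germToFunctionField _ (b * v) =
      X.germToFunctionField _ b * X.germToFunctionField _ v := map_mul _ _ _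
    rw [← mul_assoc, ← map_mul, hbv]
    congr 2
    linear_combination (X.germToFunctionField _ b * h x) * huv

end IsSqrtCover
-- Homogeneous coordinates: evaluation of the symmetric algebra in a field
section Points
variable {X : Scheme.{u}} [IsNonsingularCurve X] (D : Divisor X)
variable {L : Type u} [Field L] [Algebra X.functionField L]

/-- The element `s` of degree one of the symmetric algebra. -/
noncomputable def symS (U : X.Opens) [Nonempty U] : symAlg D U :=
  ⟨MvPolynomial.X 0, fun m ↦ by
    rw [MvPolynomial.coeff_X]
    split_ifs with e
    · subst e; simpa using one_mem_sections U
    · exact zero_mem _⟩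

theorem symS_mem (U : X.Opens) [Nonempty U] : symS D U ∈ symGrading D U 1 :=
  MvPolynomial.isHomogeneous_X _ _

theorem symT_mem (U : X.Opens) [Nonempty U] (h : D.sections U) :
    symT D U h ∈ symGrading D U 1 :=
  MvPolynomial.isHomogeneous_monomial _ (by simp)

/-- Evaluation of elements of the symmetric algebra at `(x, y)`. -/
noncomputable def symEval (U : X.Opens) [Nonempty U] (x y : L) : symAlg D U →+* L :=
  (MvPolynomial.aeval (R := X.functionField) ![x, y]).toRingHom.comp (symAlg D U).subtype

variable (U : X.Opens) [Nonempty U] (x y : L)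

theorem symEval_symS : symEval D U x y (symS D U) = x := by
  simp [symEval, symS]

theorem symEval_symT (h : D.sections U) :
    symEval D U x y (symT D U h) = algebraMap _ L h.1 * y := by
  simp [symEval, symT, MvPolynomial.aeval_monomial]

theorem symEval_symC (a : Γ(X, U)) :
    symEval D U x y (symC D U a) = algebraMap _ L (X.germToFunctionField U a) := by
  change MvPolynomial.aeval (R := X.functionField) ![x, y] (MvPolynomial.C _) = _
  rw [MvPolynomial.aeval_C]

theorem symEval_symRestrict {V : X.Opens} [Nonempty V] (h : V ≤ U) (P : symAlg D U) :
    symEval D V x y (symRestrict D h P) = symEval D U x y P := rfl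

theorem symEval_eq_sum {n : ℕ} {P : symAlg D U} (hP : P ∈ symGrading D U n) :
    symEval D U x y P = ∑ i ∈ Finset.range (n + 1),
      algebraMap _ L (P.1.coeff (Finsupp.single 0 (n - i) + Finsupp.single 1 i)) *
        x ^ (n - i) * y ^ i := by
  have key : P.1 = ∑ i ∈ Finset.range (n + 1),
      MvPolynomial.monomial (Finsupp.single 0 (n - i) + Finsupp.single 1 i)
        (P.1.coeff (Finsupp.single 0 (n - i) + Finsupp.single 1 i)) := by
    ext m
    rw [MvPolynomial.coeff_sum]
    simp only [MvPolynomial.coeff_monomial]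
    have hP' : P.1.IsHomogeneous n := hP
    by_cases hm : m 0 + m 1 = n
    · rw [Finset.sum_eq_single (m 1)]
      · have e : Finsupp.single 0 (n - m 1) + Finsupp.single 1 (m 1) = m := by
          ext i
          fin_cases i
          · simp; omega
          · simp
        rw [if_pos e, e]
      · intro i _ hi
        rw [if_neg]
        rintro rfl
        simp at hi
      · intro h
        simp at h
        omega
    · have h0 : P.1.coeff m = 0 := by
        refine hP'.coeff_eq_zero ?_
        rwa [Finsupp.degree_eq_sum, Fin.sum_univ_two]
      rw [h0, Finset.sum_eq_zero]
      intro i hi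
      rw [Finset.mem_range] at hi
      rw [if_neg]
      rintro rfl
      simp at hm
      omega
  change MvPolynomial.aeval (R := X.functionField) ![x, y] P.1 = _
  conv_lhs => rw [key]
  rw [map_sum]
  refine Finset.sum_congr rfl fun i _ ↦ ?_
  rw [MvPolynomial.aeval_monomial, Finsupp.prod_fintype _ _ (by simp)]
  simp [mul_assoc]

variable {x y U D}

/-- Evaluation of homogeneous fractions at `(x, y)`. -/
noncomputable def awayEval {a : symAlg D U} (ha : symEval D U x y a ≠ 0) :
    Away (symGrading D U) a →+* L :=
  (IsLocalization.Away.lift (S := Localization.Away a) a (isUnit_iff_ne_zero.mpr ha)).comp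
    (algebraMap (Away (symGrading D U) a) (Localization.Away a))

theorem awayEval_mk {a : symAlg D U} (ha : symEval D U x y a ≠ 0) {m : ℕ}
    (hm : a ∈ symGrading D U m) (n : ℕ) (P : symAlg D U) (hP : P ∈ symGrading D U (n • m)) :
    awayEval ha (Away.mk _ hm n P hP) = symEval D U x y P / symEval D U x y a ^ n := by
  rw [eq_div_iff (pow_ne_zero _ ha), awayEval, RingHom.comp_apply,
    HomogeneousLocalization.algebraMap_apply, Away.val_mk, Localization.mk_eq_mk', ← map_pow]
  conv_lhs => rw [← IsLocalization.Away.lift_eq (S := Localization.Away a) a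
    (isUnit_iff_ne_zero.mpr ha) (a ^ n)]
  have hs := IsLocalization.mk'_spec (Localization.Away a) P
    (⟨a ^ n, n, rfl⟩ : Submonoid.powers a)
  rw [← map_mul]
  exact (congrArg _ hs).trans (IsLocalization.Away.lift_eq a _ P)

theorem awayEval_fromZeroRingHom {a : symAlg D U} (ha : symEval D U x y a ≠ 0)
    (c : symGrading D U 0) :
    awayEval ha (fromZeroRingHom (symGrading D U) (Submonoid.powers a) c) =
      symEval D U x y (c : symAlg D U) := by
  rw [awayEval, RingHom.comp_apply, HomogeneousLocalization.algebraMap_apply, val_fromZeroRingHom,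
    Localization.mk_one_eq_algebraMap, IsLocalization.Away.lift_eq]

/-- The hypothesis says that τ is transcendental over the function field. A form of known degree is
recovered from its dehomogenization s = 1, t = τ, because the exponent of t determines that of s. -/
theorem awayEval_injective {τ : L}
    (hτ : Function.Injective (Polynomial.aeval (R := X.functionField) τ)) {a : symAlg D U} {m : ℕ}
    (hm : a ∈ symGrading D U m) (ha : symEval D U 1 τ a ≠ 0) :
    Function.Injective (awayEval ha) := by
  rw [injective_iff_map_eq_zero]
  intro z hz
  obtain ⟨n, P, hP, rfl⟩ := Away.mk_surjective _ hm z
  rw [awayEval_mk, div_eq_zero_iff, or_iff_left (pow_ne_zero n ha), symEval_eq_sum D U _ _ hP] at hz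
  have h0 : (∑ i ∈ Finset.range (n • m + 1), Polynomial.C (P.1.coeff
      (Finsupp.single 0 (n • m - i) + Finsupp.single 1 i)) * Polynomial.X ^ i) = 0 := by
    apply hτ
    rw [map_zero, ← hz, map_sum]
    refine Finset.sum_congr rfl fun i _ ↦ ?_
    rw [map_mul, Polynomial.aeval_C, map_pow, Polynomial.aeval_X, one_pow, mul_one]
  have hP0 : P = 0 := by
    refine Subtype.ext (MvPolynomial.ext _ _ fun d ↦ ?_)
    by_contra hd
    have hdeg := MvPolynomial.IsHomogeneous.coeff_eq_zero (φ := P.1) (n := n • m) hP (d := d)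
    have hd' : d 0 + d 1 = n • m := by
      by_contra h
      exact hd (hdeg (by rwa [Finsupp.degree_eq_sum, Fin.sum_univ_two]))
    have h1 := congrArg (fun q ↦ q.coeff (d 1)) h0
    simp only [Polynomial.finsetSum_coeff, Polynomial.coeff_C_mul, Polynomial.coeff_X_pow,
      mul_ite, mul_one, mul_zero, Polynomial.coeff_zero, Finset.sum_ite_eq, Finset.mem_range] at h1
    rw [if_pos (by omega)] at h1
    have e : Finsupp.single 0 (n • m - d 1) + Finsupp.single 1 (d 1) = d := by
      ext i
      fin_cases i
      · simp only [Finsupp.coe_add, Pi.add_apply]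
        simp; simp at hd'; omega
      · simp
    rw [e] at h1
    exact hd h1
  subst hP0
  apply val_injective
  rw [Away.val_mk, val_zero, Localization.mk_zero]

theorem awayEval_awayMap {a b c : symAlg D U} (ha : symEval D U x y a ≠ 0)
    (hc : symEval D U x y c ≠ 0) {m m' : ℕ} (hm : a ∈ symGrading D U m)
    (hm' : b ∈ symGrading D U m') (e : c = a * b) (z : Away (symGrading D U) a) :
    awayEval hc (awayMap _ hm' e z) = awayEval ha z := by
  obtain ⟨n, P, hP, rfl⟩ := Away.mk_surjective _ hm z
  rw [awayMap_mk, awayEval_mk, awayEval_mk]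
  subst e
  rw [map_mul] at hc
  have hb := right_ne_zero_of_mul hc
  rw [map_mul, map_mul, map_pow]
  field_simp
  ring

theorem awayEval_awayMap_symRestrict {U V : X.Opens} [Nonempty U] [Nonempty V] (h : V ≤ U)
    {a : symAlg D U} (ha : symEval D U x y a ≠ 0)
    (ha' : symEval D V x y (symRestrict D h a) ≠ 0) {m : ℕ} (hm : a ∈ symGrading D U m)
    (z : Away (symGrading D U) a) :
    awayEval ha' (Away.map (symRestrict D h) a z) = awayEval ha z := by
  obtain ⟨n, P, hP, rfl⟩ := Away.mk_surjective _ hm z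
  rw [Away.map_mk, awayEval_mk, awayEval_mk, symEval_symRestrict, symEval_symRestrict]

end Points

/-! ### Affine charts of the ruled surface and points in them -/

section Charts
variable {X : Scheme.{u}} [IsNonsingularCurve X] (D : Divisor X)
variable {L : Type u} [Field L] [Algebra X.functionField L]

/-- The open immersion of the affine chart `a ≠ 0` of the ruled surface. -/
noncomputable def awayChart (U : ChartIndex X) {a : symAlg D U.1.toOpens} {m : ℕ}
    (hm : a ∈ symGrading D U.1.toOpens m) (hm0 : 0 < m) :
    Spec (.of (Away (symGrading D U.1.toOpens) a)) ⟶ ruledSurface D :=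
  Proj.awayι _ a hm hm0 ≫ ruledChart D U

instance (U : ChartIndex X) {a : symAlg D U.1.toOpens} {m : ℕ}
    (hm : a ∈ symGrading D U.1.toOpens m) (hm0 : 0 < m) : IsOpenImmersion (awayChart D U hm hm0) :=
  IsOpenImmersion.comp _ _

theorem chartMap_ruledChart {U V : ChartIndex X} (h : V ≤ U) :
    chartMap D h ≫ ruledChart D U = ruledChart D V :=
  let f : V ⟶ U := homOfLE h
  (ruledGluing D).cover.trans_map (i := V) (j := U) f

theorem ruledChart_ruling (U : ChartIndex X) :
    ruledChart D U ≫ ruling D = chartProj D U ≫ U.1.toOpens.ι :=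
  (ruledGluing D).ι_toBase U

theorem opensRange_ruledChart (U : ChartIndex X) :
    (ruledChart D U).opensRange = ruling D ⁻¹ᵁ U.1.toOpens := by
  have h := (ruledGluing D).toBase_preimage_eq_opensRange_ι U
  rw [show ((chartCover X).f U).opensRange = U.1.toOpens from U.1.toOpens.opensRange_ι] at h
  exact h.symm

theorem awayChart_ruling (U : ChartIndex X) {a : symAlg D U.1.toOpens} {m : ℕ}
    (hm : a ∈ symGrading D U.1.toOpens m) (hm0 : 0 < m) :
    awayChart D U hm hm0 ≫ ruling D = Spec.map (CommRingCat.ofHom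
      ((fromZeroRingHom (symGrading D U.1.toOpens) (Submonoid.powers a)).comp
        (symC D U.1.toOpens))) ≫ U.1.2.fromSpec := by
  rw [awayChart, Category.assoc, ruledChart_ruling, chartProj_ι, Proj.awayι_toSpecZero_assoc,
    ← Spec.map_comp_assoc, CommRingCat.ofHom_comp]

/-- The point of the ruled surface with homogeneous coordinates `x`, `y` in a chart `a ≠ 0`. -/
noncomputable def chartPoint (U : ChartIndex X) {x y : L} {a : symAlg D U.1.toOpens} {m : ℕ}
    (hm : a ∈ symGrading D U.1.toOpens m) (hm0 : 0 < m) (ha : symEval D _ x y a ≠ 0) :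
    Spec (.of L) ⟶ ruledSurface D :=
  Spec.map (CommRingCat.ofHom (awayEval ha)) ≫ awayChart D U hm hm0

variable {D}

theorem chartPoint_mul (U : ChartIndex X) {x y : L} {a b c : symAlg D U.1.toOpens} {m m' n : ℕ}
    (hm : a ∈ symGrading D U.1.toOpens m) (hm0 : 0 < m) (ha : symEval D _ x y a ≠ 0)
    (hm' : b ∈ symGrading D U.1.toOpens m') (hn : c ∈ symGrading D U.1.toOpens n) (hn0 : 0 < n)
    (hc : symEval D _ x y c ≠ 0) (e : c = a * b) (e' : n = m + m') :
    chartPoint D U hn hn0 hc = chartPoint D U hm hm0 ha := by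
  subst e e'
  rw [chartPoint, chartPoint, awayChart, awayChart,
    ← Proj.SpecMap_awayMap_awayι _ hm hm0 hm' rfl, Category.assoc, ← Spec.map_comp_assoc,
    ← CommRingCat.ofHom_comp]
  congr 3
  ext z
  exact awayEval_awayMap ha hc hm hm' rfl z

/-- Both points agree with the one computed in the smaller chart where the product of a and b does
not vanish. -/
theorem chartPoint_eq (U : ChartIndex X) {x y : L} {a b : symAlg D U.1.toOpens} {m m' : ℕ}
    (hm : a ∈ symGrading D U.1.toOpens m) (hm0 : 0 < m) (ha : symEval D _ x y a ≠ 0)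
    (hm' : b ∈ symGrading D U.1.toOpens m') (hm0' : 0 < m') (hb : symEval D _ x y b ≠ 0) :
    chartPoint D U hm hm0 ha = chartPoint D U hm' hm0' hb := by
  have hc : symEval D _ x y (a * b) ≠ 0 := by rw [map_mul]; exact mul_ne_zero ha hb
  rw [← chartPoint_mul U hm hm0 ha hm' (SetLike.mul_mem_graded hm hm') (by omega) hc rfl rfl,
    ← chartPoint_mul U hm' hm0' hb hm (SetLike.mul_mem_graded hm hm') (by omega) hc (mul_comm _ _)
      (add_comm _ _)]

theorem chartPoint_symRestrict {U V : ChartIndex X} (h : V ≤ U) {x y : L}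
    {a : symAlg D U.1.toOpens} {m : ℕ}
    (hm : a ∈ symGrading D U.1.toOpens m) (hm0 : 0 < m) (ha : symEval D _ x y a ≠ 0)
    (ha' : symEval D _ x y (symRestrict D (ChartIndex.le h) a) ≠ 0) :
    chartPoint D V (Graded.map_mem (symRestrict D (ChartIndex.le h)) hm) hm0 ha' =
      chartPoint D U hm hm0 ha := by
  rw [chartPoint, chartPoint, awayChart, awayChart, ← chartMap_ruledChart D h, chartMap,
    Proj.awayι_comp_map_assoc _ _ hm0 _ hm, ← Spec.map_comp_assoc, ← CommRingCat.ofHom_comp]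
  congr 3
  ext z
  exact awayEval_awayMap_symRestrict _ ha ha' hm z

theorem ChartIndex.exists_le_le (U V : ChartIndex X) {x : X} (hU : x ∈ U.1.toOpens)
    (hV : x ∈ V.1.toOpens) : ∃ W : ChartIndex X, W ≤ U ∧ W ≤ V ∧ x ∈ W.1.toOpens := by
  obtain ⟨f, g, e, hxf⟩ := exists_basicOpen_le_affine_inter U.1.2 V.1.2 _ ⟨hU, hV⟩
  exact ⟨⟨U.1.basicOpen f, ⟨x, hxf⟩⟩, U.1.basicOpen_le f, ⟨g, e.symm⟩, hxf⟩

/-- Any two charts of the base share a smaller one around the generic point, and restriction to it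
does not change the values at (x, y). -/
theorem chartPoint_eq' (U V : ChartIndex X) {x y : L} {a : symAlg D U.1.toOpens}
    {b : symAlg D V.1.toOpens} {m m' : ℕ}
    (hm : a ∈ symGrading D U.1.toOpens m) (hm0 : 0 < m) (ha : symEval D _ x y a ≠ 0)
    (hm' : b ∈ symGrading D V.1.toOpens m') (hm0' : 0 < m') (hb : symEval D _ x y b ≠ 0) :
    chartPoint D U hm hm0 ha = chartPoint D V hm' hm0' hb := by
  obtain ⟨W, hU, hV, -⟩ := ChartIndex.exists_le_le U V (genericPoint_mem U.1.toOpens)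
    (genericPoint_mem V.1.toOpens)
  rw [← chartPoint_symRestrict hU hm hm0 ha ha, ← chartPoint_symRestrict hV hm' hm0' hb hb]
  exact chartPoint_eq _ _ _ _ _ _ _

theorem chartPoint_ruling (U : ChartIndex X) {x y : L} {a : symAlg D U.1.toOpens} {m : ℕ}
    (hm : a ∈ symGrading D U.1.toOpens m) (hm0 : 0 < m) (ha : symEval D _ x y a ≠ 0) :
    chartPoint D U hm hm0 ha ≫ ruling D =
      Spec.map (CommRingCat.ofHom (algebraMap X.functionField L)) ≫ genericMap X := by
  rw [chartPoint, Category.assoc, awayChart_ruling, ← specMap_evalAt_fromSpec (genericMap X) U.1.2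
    (top_le_preimage _ U.1.toOpens), ← Spec.map_comp_assoc, ← Spec.map_comp_assoc,
    ← CommRingCat.ofHom_comp, ← CommRingCat.ofHom_comp]
  congr 3
  ext a
  rw [RingHom.comp_apply, RingHom.comp_apply, RingHom.comp_apply, awayEval_fromZeroRingHom,
    symEval_symC, evalAt_genericMap]

end Charts

/-! ### Functions on the charts as polynomials in ht/s or s/(ht) -/

theorem preimage_basicOpen_evalAt {S : Scheme.{u}} {R : Type u} [CommRing R] (ψ : Spec (.of R) ⟶ S)
    {W : S.Opens} (h : ⊤ ≤ ψ ⁻¹ᵁ W) (r : Γ(S, W)) :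
    ψ ⁻¹ᵁ S.basicOpen r = PrimeSpectrum.basicOpen (evalAt ψ W h r) := by
  have h1 : (Spec (.of R)).basicOpen (ψ.appLE W ⊤ h r) =
    PrimeSpectrum.basicOpen (evalAt ψ W h r) := basicOpen_eq_of_affine' _
  rw [← h1, Scheme.basicOpen_appLE, top_inf_eq]

theorem evalAt_fromSpec {S : Scheme.{u}} {W : S.Opens} (hW : IsAffineOpen W)
    (h : ⊤ ≤ hW.fromSpec ⁻¹ᵁ W) (a : Γ(S, W)) :
    evalAt (R := Γ(S, W)) hW.fromSpec W h a = a := by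
  have h1 := specMap_evalAt_fromSpec (R := Γ(S, W)) hW.fromSpec hW h
  have h2 : Spec.map (CommRingCat.ofHom (evalAt (R := Γ(S, W)) hW.fromSpec W h)) = 𝟙 _ := by
    rw [← cancel_mono hW.fromSpec, h1, Category.id_comp]
  rw [← Spec.map_id, Spec.map_inj] at h2
  exact ConcreteCategory.congr_hom h2 a

section Sections
variable {X : Scheme.{u}} [IsNonsingularCurve X] (D : Divisor X) (U : ChartIndex X)
variable {L : Type u} [Field L] [Algebra X.functionField L]

/-- The structure map of the ring of functions on a chart of the ruled surface. -/
noncomputable def awayC (a : symAlg D U.1.toOpens) :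
    Γ(X, U.1.toOpens) →+* Away (symGrading D U.1.toOpens) a :=
  (fromZeroRingHom (symGrading D U.1.toOpens) (Submonoid.powers a)).comp (symC D U.1.toOpens)

/-- The regular functions on an affine open set as elements of an extension of the function field. -/
noncomputable def germMap (U : X.Opens) [Nonempty U] (L : Type u) [Field L]
    [Algebra X.functionField L] : Γ(X, U) →+* L :=
  (algebraMap X.functionField L).comp (X.germToFunctionField U).hom

theorem germMap_apply (U : X.Opens) [Nonempty U] (L : Type u) [Field L]
    [Algebra X.functionField L] (a : Γ(X, U)) :
    germMap U L a = algebraMap X.functionField L (X.germToFunctionField U a) := rfl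

variable {D U} in
theorem awayEval_awayC {x y : L} {a : symAlg D U.1.toOpens} (ha : symEval D _ x y a ≠ 0)
    (c : Γ(X, U.1.toOpens)) : awayEval ha (awayC D U a c) = germMap _ L c := by
  rw [awayC, RingHom.comp_apply, awayEval_fromZeroRingHom, symEval_symC, germMap_apply]

/-- The open subset `s ≠ 0` of the ruled surface, over an affine open subset of the curve. -/
noncomputable def sOpen : (ruledSurface D).Opens :=
  (awayChart D U (symS_mem D U.1.toOpens) one_pos).opensRange

/-- The open subset `h t ≠ 0` of the ruled surface, over an affine open subset of the curve. -/
noncomputable def tOpen (h : D.sections U.1.toOpens) : (ruledSurface D).Opens :=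
  (awayChart D U (symT_mem D U.1.toOpens h) one_pos).opensRange

theorem isAffineOpen_sOpen : IsAffineOpen (sOpen D U) := isAffineOpen_opensRange _

theorem isAffineOpen_tOpen (h : D.sections U.1.toOpens) : IsAffineOpen (tOpen D U h) :=
  isAffineOpen_opensRange _

/-- The polynomial functions in `h t / s`. -/
noncomputable def sPoly (h : D.sections U.1.toOpens) :
    Polynomial Γ(X, U.1.toOpens) →+* Away (symGrading D U.1.toOpens) (symS D U.1.toOpens) :=
  Polynomial.eval₂RingHom (awayC D U _) (Away.mk _ (symS_mem D _) 1 (symT D _ h) (symT_mem D _ h))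

/-- The polynomial functions in `s / (h t)`. -/
noncomputable def tPoly (h : D.sections U.1.toOpens) :
    Polynomial Γ(X, U.1.toOpens) →+* Away (symGrading D U.1.toOpens) (symT D U.1.toOpens h) :=
  Polynomial.eval₂RingHom (awayC D U _) (Away.mk _ (symT_mem D _ h) 1 (symS D _) (symS_mem D _))

variable {D U}

theorem awayEval_sPoly {x y : L} (hx : symEval D _ x y (symS D U.1.toOpens) ≠ 0)
    (h : D.sections U.1.toOpens) (q : Polynomial Γ(X, U.1.toOpens)) :
    awayEval hx (sPoly D U h q) = q.eval₂ (germMap _ L) (algebraMap _ L h.1 * y / x) := by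
  rw [sPoly, Polynomial.coe_eval₂RingHom, Polynomial.hom_eval₂, awayEval_mk, symEval_symS,
    symEval_symT, pow_one]
  congr 1
  exact RingHom.ext (awayEval_awayC hx)

theorem awayEval_tPoly {x y : L} {h : D.sections U.1.toOpens}
    (hy : symEval D _ x y (symT D U.1.toOpens h) ≠ 0) (q : Polynomial Γ(X, U.1.toOpens)) :
    awayEval hy (tPoly D U h q) = q.eval₂ (germMap _ L) (x / (algebraMap _ L h.1 * y)) := by
  rw [tPoly, Polynomial.coe_eval₂RingHom, Polynomial.hom_eval₂, awayEval_mk, symEval_symS,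
    symEval_symT, pow_one]
  congr 1
  exact RingHom.ext (awayEval_awayC hy)

/-- The field of rational functions in one variable over the function field of the curve. -/
abbrev RatField (X : Scheme.{u}) [IsNonsingularCurve X] : Type u :=
  FractionRing (Polynomial X.functionField)

/-- The variable of the rational function field. -/
noncomputable def ratVar (X : Scheme.{u}) [IsNonsingularCurve X] : RatField X :=
  algebraMap (Polynomial X.functionField) _ Polynomial.X

theorem aeval_ratVar (q : Polynomial X.functionField) :
    Polynomial.aeval (ratVar X) q = algebraMap _ (RatField X) q := by
  have : Polynomial.aeval (ratVar X) =
      IsScalarTower.toAlgHom X.functionField (Polynomial X.functionField) (RatField X) :=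
    Polynomial.algHom_ext (by simp [ratVar])
  rw [this]; rfl

theorem aeval_ratVar_injective :
    Function.Injective (Polynomial.aeval (R := X.functionField) (ratVar X)) := by
  intro a b h
  rw [aeval_ratVar, aeval_ratVar] at h
  exact IsFractionRing.injective _ _ h

theorem ratVar_ne_zero : ratVar X ≠ 0 := by
  intro h
  exact Polynomial.X_ne_zero (aeval_ratVar_injective (X := X) (by
    rw [Polynomial.aeval_X, h, map_zero]))

theorem symEval_symS_ne_zero (U : X.Opens) [Nonempty U] {x : L} (hx : x ≠ 0) (y : L) :
    symEval D U x y (symS D U) ≠ 0 := by rwa [symEval_symS]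

theorem symEval_symT_ne_zero {U : X.Opens} [Nonempty U] (x : L) {y : L} (hy : y ≠ 0)
    {h : D.sections U} (hh : h.1 ≠ 0) :
    symEval D U x y (symT D U h) ≠ 0 := by
  rw [symEval_symT]
  exact mul_ne_zero (by simpa using hh) hy

/-- For a generator h of O(D), the coefficient of s^(n-i) t^i is aᵢ hⁱ with aᵢ regular, so a form
divided by sⁿ is the sum of the aᵢ (ht/s)ⁱ. The identity is verified after embedding everything in
the rational function field. -/
theorem sPoly_surjective {h : D.sections U.1.toOpens} (hh : IsGenerator D U.1.toOpens h.1) :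
    Function.Surjective (sPoly D U h) := by
  intro z
  obtain ⟨n, P, hP, rfl⟩ := Away.mk_surjective _ (symS_mem D _) z
  have hc (i : ℕ) : ∃ a : Γ(X, U.1.toOpens), P.1.coeff
      (Finsupp.single 0 (n • 1 - i) + Finsupp.single 1 i) = X.germToFunctionField _ a * h.1 ^ i := by
    have h1 := (mem_symAlg D _).mp P.2 (Finsupp.single 0 (n • 1 - i) + Finsupp.single 1 i)
    have := (hh.exists_eq_germ_mul i).mp (by simpa using h1)
    simpa using this
  choose a ha using hc
  refine ⟨∑ i ∈ Finset.range (n • 1 + 1), Polynomial.C (a i) * Polynomial.X ^ i,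
    awayEval_injective aeval_ratVar_injective (symS_mem D _)
      (symEval_symS_ne_zero _ one_ne_zero _) ?_⟩
  rw [awayEval_sPoly, awayEval_mk, symEval_symS, one_pow, div_one, symEval_eq_sum D _ _ _ hP,
    Polynomial.eval₂_finsetSum, div_one]
  refine Finset.sum_congr rfl fun i _ ↦ ?_
  rw [ha, Polynomial.eval₂_mul, Polynomial.eval₂_C, Polynomial.eval₂_X_pow, germMap_apply]
  simp only [map_mul, map_pow]
  ring

theorem tPoly_surjective {h : D.sections U.1.toOpens} (hh : IsGenerator D U.1.toOpens h.1) :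
    Function.Surjective (tPoly D U h) := by
  intro z
  obtain ⟨n, P, hP, rfl⟩ := Away.mk_surjective _ (symT_mem D _ h) z
  have hc (i : ℕ) : ∃ a : Γ(X, U.1.toOpens), P.1.coeff
      (Finsupp.single 0 (n • 1 - i) + Finsupp.single 1 i) = X.germToFunctionField _ a * h.1 ^ i := by
    have h1 := (mem_symAlg D _).mp P.2 (Finsupp.single 0 (n • 1 - i) + Finsupp.single 1 i)
    have := (hh.exists_eq_germ_mul i).mp (by simpa using h1)
    simpa using this
  choose a ha using hc
  have hy := symEval_symT_ne_zero (1 : RatField X) ratVar_ne_zero hh.ne_zero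
  -- Dividing s^(n-i) (ht)^i by (ht)^n leaves the power n - i of s/(ht).
  refine ⟨∑ i ∈ Finset.range (n • 1 + 1), Polynomial.C (a i) * Polynomial.X ^ (n - i),
    awayEval_injective aeval_ratVar_injective (symT_mem D _ h) hy ?_⟩
  rw [symEval_symT] at hy
  rw [awayEval_tPoly, awayEval_mk, symEval_symT, symEval_eq_sum D _ _ _ hP,
    Polynomial.eval₂_finsetSum, eq_div_iff (pow_ne_zero _ hy), Finset.sum_mul]
  refine Finset.sum_congr rfl fun i hi ↦ ?_
  have hi : n = (n - i) + i := by rw [Finset.mem_range] at hi; simp at hi; omega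
  rw [ha, Polynomial.eval₂_mul, Polynomial.eval₂_C, Polynomial.eval₂_X_pow, germMap_apply]
  conv_lhs => rw [show ∀ z : RatField X, z ^ n = z ^ ((n - i) + i) from fun z ↦ by rw [← hi]]
  simp only [map_mul, map_pow, one_pow, mul_one]
  rw [mul_assoc, one_div, inv_pow, pow_add, inv_mul_cancel_left₀ (pow_ne_zero _ hy), mul_pow,
    mul_assoc]

variable (D)

/-- The identification of the functions on a chart of the ruled surface. -/
noncomputable def awaySec (U : ChartIndex X) {a : symAlg D U.1.toOpens} {m : ℕ}
    (hm : a ∈ symGrading D U.1.toOpens m) (hm0 : 0 < m) :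
    Away (symGrading D U.1.toOpens) a ≃+* Γ(ruledSurface D, (awayChart D U hm hm0).opensRange) :=
  (RingEquiv.ofBijective (evalAt (awayChart D U hm hm0) _ (by simp))
    (evalAt_bijective (awayChart D U hm hm0) (by simp))).symm

variable {D}

theorem evalAt_awaySec (U : ChartIndex X) {a : symAlg D U.1.toOpens} {m : ℕ}
    (hm : a ∈ symGrading D U.1.toOpens m) (hm0 : 0 < m)
    (h : ⊤ ≤ awayChart D U hm hm0 ⁻¹ᵁ (awayChart D U hm hm0).opensRange)
    (z : Away (symGrading D U.1.toOpens) a) :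
    evalAt (awayChart D U hm hm0) _ h (awaySec D U hm hm0 z) = z :=
  (RingEquiv.ofBijective (evalAt (awayChart D U hm hm0) _ h)
    (evalAt_bijective (awayChart D U hm hm0) h)).apply_symm_apply z

theorem awayChart_opensRange_le (U : ChartIndex X) {a : symAlg D U.1.toOpens} {m : ℕ}
    (hm : a ∈ symGrading D U.1.toOpens m) (hm0 : 0 < m) :
    (awayChart D U hm hm0).opensRange ≤ ruling D ⁻¹ᵁ U.1.toOpens := by
  rw [← opensRange_ruledChart]
  rintro _ ⟨y, rfl⟩
  exact ⟨Proj.awayι _ a hm hm0 y, (Scheme.Hom.comp_apply _ _ _).symm⟩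

theorem awaySec_awayC (U : ChartIndex X) {a : symAlg D U.1.toOpens} {m : ℕ}
    (hm : a ∈ symGrading D U.1.toOpens m) (hm0 : 0 < m) (c : Γ(X, U.1.toOpens)) :
    awaySec D U hm hm0 (awayC D U a c) =
      (ruledSurface D).presheaf.map (homOfLE (awayChart_opensRange_le U hm hm0)).op
        ((ruling D).app _ c) := by
  have htop : ⊤ ≤ awayChart D U hm hm0 ⁻¹ᵁ (awayChart D U hm hm0).opensRange := by simp
  have htop' : ⊤ ≤ awayChart D U hm hm0 ⁻¹ᵁ ruling D ⁻¹ᵁ U.1.toOpens :=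
    htop.trans ((awayChart D U hm hm0).preimage_mono (awayChart_opensRange_le U hm hm0))
  apply (evalAt_bijective (awayChart D U hm hm0) htop).1
  have htop'' : ⊤ ≤ (awayChart D U hm hm0 ≫ ruling D) ⁻¹ᵁ U.1.toOpens := htop'
  have h1 := U.1.2.range_fromSpec
  have h2 : ⊤ ≤ U.1.2.fromSpec ⁻¹ᵁ U.1.toOpens := fun x _ ↦ by
    change U.1.2.fromSpec x ∈ (U.1.toOpens : Set X)
    rw [← h1]; exact ⟨x, rfl⟩
  rw [evalAt_awaySec, evalAt_res _ _ htop', ← evalAt_comp _ _ _ htop'',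
    evalAt_congr (awayChart_ruling D U hm hm0) htop'' (awayChart_ruling D U hm hm0 ▸ htop''),
    evalAt_specMap (R := Γ(X, U.1.toOpens)) _ _ _ h2, evalAt_fromSpec]
  rfl

end Sections
-- Points of the surface with a given coordinate t/s
section ChartSections
variable {X : Scheme.{u}} [IsNonsingularCurve X] (D : Divisor X) (U : ChartIndex X)
variable {L : Type u} [Field L] [Algebra X.functionField L]

/-- Polynomials over the functions on `U` as functions on the chart `s ≠ 0`. -/
noncomputable def sSec (h : D.sections U.1.toOpens) :
    Polynomial Γ(X, U.1.toOpens) →+* Γ(ruledSurface D, sOpen D U) :=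
  (awaySec D U (symS_mem D _) one_pos).toRingHom.comp (sPoly D U h)

/-- Polynomials over the functions on `U` as functions on the chart `h t ≠ 0`. -/
noncomputable def tSec (h : D.sections U.1.toOpens) :
    Polynomial Γ(X, U.1.toOpens) →+* Γ(ruledSurface D, tOpen D U h) :=
  (awaySec D U (symT_mem D _ h) one_pos).toRingHom.comp (tPoly D U h)

variable {D U}

theorem sSec_surjective {h : D.sections U.1.toOpens} (hh : IsGenerator D U.1.toOpens h.1) :
    Function.Surjective (sSec D U h) :=
  (awaySec D U (symS_mem D _) one_pos).surjective.comp (sPoly_surjective hh)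

theorem tSec_surjective {h : D.sections U.1.toOpens} (hh : IsGenerator D U.1.toOpens h.1) :
    Function.Surjective (tSec D U h) :=
  (awaySec D U (symT_mem D _ h) one_pos).surjective.comp (tPoly_surjective hh)

theorem evalAt_eq_germMap {S : Scheme.{u}} {π : S ⟶ X} {ψ : Spec (.of L) ⟶ S}
    (hψ : ψ ≫ π = Spec.map (CommRingCat.ofHom (algebraMap X.functionField L)) ≫ genericMap X)
    {W : S.Opens} (hW : W ≤ π ⁻¹ᵁ U.1.toOpens) (h : ⊤ ≤ ψ ⁻¹ᵁ W) (c : Γ(X, U.1.toOpens)) :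
    evalAt ψ W h (S.presheaf.map (homOfLE hW).op (π.app _ c)) = germMap _ L c := by
  rw [evalAt_res ψ h (h.trans (ψ.preimage_mono hW)), evalAt_app_of_comp_eq hψ, germMap_apply]

theorem evalAt_sSec {ψ : Spec (.of L) ⟶ ruledSurface D}
    (hψ : ψ ≫ ruling D = Spec.map (CommRingCat.ofHom (algebraMap X.functionField L)) ≫
      genericMap X) (h0 : ⊤ ≤ ψ ⁻¹ᵁ sOpen D U) (h : D.sections U.1.toOpens)
    (q : Polynomial Γ(X, U.1.toOpens)) :
    evalAt ψ _ h0 (sSec D U h q) =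
      q.eval₂ (germMap _ L) (evalAt ψ _ h0 (sSec D U h Polynomial.X)) := by
  have : (evalAt ψ _ h0).comp (sSec D U h) = Polynomial.eval₂RingHom (germMap _ L)
      (evalAt ψ _ h0 (sSec D U h Polynomial.X)) := by
    refine Polynomial.ringHom_ext (fun c ↦ ?_) ?_
    · rw [Polynomial.coe_eval₂RingHom, Polynomial.eval₂_C, ← evalAt_eq_germMap hψ
        (awayChart_opensRange_le U (symS_mem D _) one_pos) h0]
      rw [← awaySec_awayC]
      change evalAt ψ _ h0 (awaySec D U _ _ (sPoly D U h (Polynomial.C c))) = _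
      rw [sPoly, Polynomial.coe_eval₂RingHom, Polynomial.eval₂_C]
      rfl
    · rw [Polynomial.coe_eval₂RingHom, Polynomial.eval₂_X]
      rfl
  exact congr($this q)

theorem evalAt_tSec {ψ : Spec (.of L) ⟶ ruledSurface D}
    (hψ : ψ ≫ ruling D = Spec.map (CommRingCat.ofHom (algebraMap X.functionField L)) ≫
      genericMap X) {h : D.sections U.1.toOpens} (h0 : ⊤ ≤ ψ ⁻¹ᵁ tOpen D U h)
    (q : Polynomial Γ(X, U.1.toOpens)) :
    evalAt ψ _ h0 (tSec D U h q) =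
      q.eval₂ (germMap _ L) (evalAt ψ _ h0 (tSec D U h Polynomial.X)) := by
  have : (evalAt ψ _ h0).comp (tSec D U h) = Polynomial.eval₂RingHom (germMap _ L)
      (evalAt ψ _ h0 (tSec D U h Polynomial.X)) := by
    refine Polynomial.ringHom_ext (fun c ↦ ?_) ?_
    · rw [Polynomial.coe_eval₂RingHom, Polynomial.eval₂_C, ← evalAt_eq_germMap hψ
        (awayChart_opensRange_le U (symT_mem D _ h) one_pos) h0]
      rw [← awaySec_awayC]
      change evalAt ψ _ h0 (awaySec D U _ _ (tPoly D U h (Polynomial.C c))) = _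
      rw [tPoly, Polynomial.coe_eval₂RingHom, Polynomial.eval₂_C]
      rfl
    · rw [Polynomial.coe_eval₂RingHom, Polynomial.eval₂_X]
      rfl
  exact congr($this q)

theorem top_le_preimage_chartPoint (U : ChartIndex X) {x y : L} {a : symAlg D U.1.toOpens} {m : ℕ}
    (hm : a ∈ symGrading D U.1.toOpens m) (hm0 : 0 < m) (ha : symEval D _ x y a ≠ 0) :
    ⊤ ≤ chartPoint D U hm hm0 ha ⁻¹ᵁ (awayChart D U hm hm0).opensRange := by
  intro z _
  exact ⟨Spec.map (CommRingCat.ofHom (awayEval ha)) z, (Scheme.Hom.comp_apply _ _ _).symm⟩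

theorem evalAt_chartPoint (U : ChartIndex X) {x y : L} {a : symAlg D U.1.toOpens} {m : ℕ}
    (hm : a ∈ symGrading D U.1.toOpens m) (hm0 : 0 < m) (ha : symEval D _ x y a ≠ 0)
    (h : ⊤ ≤ chartPoint D U hm hm0 ha ⁻¹ᵁ (awayChart D U hm hm0).opensRange)
    (z : Away (symGrading D U.1.toOpens) a) :
    evalAt (chartPoint D U hm hm0 ha) _ h (awaySec D U hm hm0 z) = awayEval ha z := by
  have := evalAt_specMap (awayEval ha) (awayChart D U hm hm0) (awayChart D U hm hm0).opensRange
    (by simp) h (awaySec D U hm hm0 z)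
  rw [evalAt_awaySec] at this
  exact this

instance : Nonempty (ChartIndex X) :=
  ⟨(exists_isGenerator (0 : Divisor X) (genericPoint X)).choose⟩

variable (D)

/-- The point of the ruled surface with the affine coordinate `θ = t / s`. -/
noncomputable def affinePoint (θ : L) : Spec (.of L) ⟶ ruledSurface D :=
  chartPoint D (Classical.arbitrary (ChartIndex X)) (symS_mem D _) one_pos
    (symEval_symS_ne_zero _ one_ne_zero θ)

theorem affinePoint_ruling (θ : L) : affinePoint D θ ≫ ruling D =
    Spec.map (CommRingCat.ofHom (algebraMap X.functionField L)) ≫ genericMap X :=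
  chartPoint_ruling _ _ _ _

variable {D}

theorem affinePoint_eq (U : ChartIndex X) (θ : L) {a : symAlg D U.1.toOpens} {m : ℕ}
    (hm : a ∈ symGrading D U.1.toOpens m) (hm0 : 0 < m) (ha : symEval D _ 1 θ a ≠ 0) :
    affinePoint D θ = chartPoint D U hm hm0 ha :=
  chartPoint_eq' _ _ _ _ _ _ _ _

theorem top_le_preimage_affinePoint (U : ChartIndex X) (θ : L) {a : symAlg D U.1.toOpens} {m : ℕ}
    (hm : a ∈ symGrading D U.1.toOpens m) (hm0 : 0 < m) (ha : symEval D _ 1 θ a ≠ 0) :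
    ⊤ ≤ affinePoint D θ ⁻¹ᵁ (awayChart D U hm hm0).opensRange := by
  rw [affinePoint_eq U θ hm hm0 ha]
  exact top_le_preimage_chartPoint U hm hm0 ha

theorem evalAt_affinePoint (U : ChartIndex X) (θ : L) {a : symAlg D U.1.toOpens} {m : ℕ}
    (hm : a ∈ symGrading D U.1.toOpens m) (hm0 : 0 < m) (ha : symEval D _ 1 θ a ≠ 0)
    (h : ⊤ ≤ affinePoint D θ ⁻¹ᵁ (awayChart D U hm hm0).opensRange)
    (z : Away (symGrading D U.1.toOpens) a) :
    evalAt (affinePoint D θ) _ h (awaySec D U hm hm0 z) = awayEval ha z := by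
  rw [evalAt_congr (affinePoint_eq U θ hm hm0 ha) h (top_le_preimage_chartPoint U hm hm0 ha),
    evalAt_chartPoint]

theorem affinePoint_mem_sOpen (θ : L) (U : ChartIndex X) : ⊤ ≤ affinePoint D θ ⁻¹ᵁ sOpen D U :=
  top_le_preimage_affinePoint U θ _ _ (symEval_symS_ne_zero _ one_ne_zero θ)

theorem affinePoint_mem_tOpen {θ : L} (hθ : θ ≠ 0) {h : D.sections U.1.toOpens} (hh : h.1 ≠ 0) :
    ⊤ ≤ affinePoint D θ ⁻¹ᵁ tOpen D U h :=
  top_le_preimage_affinePoint U θ _ _ (symEval_symT_ne_zero _ hθ hh)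

theorem evalAt_affinePoint_sSec (θ : L) (h0 : ⊤ ≤ affinePoint D θ ⁻¹ᵁ sOpen D U)
    (h : D.sections U.1.toOpens) (q : Polynomial Γ(X, U.1.toOpens)) :
    evalAt (affinePoint D θ) _ h0 (sSec D U h q) = q.eval₂ (germMap _ L) (algebraMap _ L h.1 * θ) :=
  (evalAt_affinePoint U θ _ _ (symEval_symS_ne_zero _ one_ne_zero θ) h0 (sPoly D U h q)).trans
    (by rw [awayEval_sPoly, div_one])

theorem evalAt_affinePoint_tSec {θ : L} (hθ : θ ≠ 0) {h : D.sections U.1.toOpens} (hh : h.1 ≠ 0)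
    (h0 : ⊤ ≤ affinePoint D θ ⁻¹ᵁ tOpen D U h) (q : Polynomial Γ(X, U.1.toOpens)) :
    evalAt (affinePoint D θ) _ h0 (tSec D U h q) =
      q.eval₂ (germMap _ L) (1 / (algebraMap _ L h.1 * θ)) :=
  (evalAt_affinePoint U θ _ _ (symEval_symT_ne_zero _ hθ hh) h0 (tPoly D U h q)).trans
    (by rw [awayEval_tPoly])

/-- In the affine chart s ≠ 0 every function is a polynomial in ht/s over the base, so a point over
the generic point of X is determined by its value of ht/s. -/
theorem eq_affinePoint {ψ : Spec (.of L) ⟶ ruledSurface D}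
    (hψ : ψ ≫ ruling D = Spec.map (CommRingCat.ofHom (algebraMap X.functionField L)) ≫
      genericMap X) (h0 : ⊤ ≤ ψ ⁻¹ᵁ sOpen D U) {h : D.sections U.1.toOpens}
    (hh : IsGenerator D U.1.toOpens h.1) {θ : L}
    (hθ : evalAt ψ _ h0 (sSec D U h Polynomial.X) = algebraMap _ L h.1 * θ) :
    ψ = affinePoint D θ := by
  rw [← specMap_evalAt_fromSpec ψ (isAffineOpen_sOpen D U) h0,
    ← specMap_evalAt_fromSpec (affinePoint D θ) (isAffineOpen_sOpen D U)
      (affinePoint_mem_sOpen θ U)]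
  congr 3
  ext z
  obtain ⟨q, rfl⟩ := sSec_surjective hh z
  rw [evalAt_sSec hψ, evalAt_affinePoint_sSec, hθ]

end ChartSections
-- How the charts cover the surface, and the complement of X₁
section ChartTopology
variable {X : Scheme.{u}} [IsNonsingularCurve X] {D : Divisor X} {U : ChartIndex X}

theorem opensRange_awayChart (U : ChartIndex X) {a : symAlg D U.1.toOpens} {m : ℕ}
    (hm : a ∈ symGrading D U.1.toOpens m) (hm0 : 0 < m) :
    (awayChart D U hm hm0).opensRange =
      ruledChart D U ''ᵁ Proj.basicOpen (symGrading D U.1.toOpens) a := by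
  rw [← Proj.opensRange_awayι _ a hm hm0]
  exact Scheme.Hom.opensRange_comp _ _

theorem preimage_awayChart_opensRange (U : ChartIndex X) {a b : symAlg D U.1.toOpens} {m n : ℕ}
    (hm : a ∈ symGrading D U.1.toOpens m) (hm0 : 0 < m)
    (hn : b ∈ symGrading D U.1.toOpens n) (hn0 : 0 < n) :
    awayChart D U hm hm0 ⁻¹ᵁ (awayChart D U hn hn0).opensRange =
      PrimeSpectrum.basicOpen (Away.isLocalizationElem hm hn) := by
  rw [opensRange_awayChart, awayChart, Scheme.Hom.comp_preimage, Scheme.Hom.preimage_image_eq,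
    Proj.awayι_preimage_basicOpen _ hm hm0 hn hn0]

theorem basicOpen_awaySec (U : ChartIndex X) {a b : symAlg D U.1.toOpens} {m n : ℕ}
    (hm : a ∈ symGrading D U.1.toOpens m) (hm0 : 0 < m)
    (hn : b ∈ symGrading D U.1.toOpens n) (hn0 : 0 < n) :
    (ruledSurface D).basicOpen (awaySec D U hm hm0 (Away.isLocalizationElem hm hn)) =
      (awayChart D U hm hm0).opensRange ⊓ (awayChart D U hn hn0).opensRange := by
  have h : ⊤ ≤ awayChart D U hm hm0 ⁻¹ᵁ (awayChart D U hm hm0).opensRange := by simp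
  rw [← Scheme.Hom.image_preimage_eq_opensRange_inf, preimage_awayChart_opensRange,
    ← evalAt_awaySec U hm hm0 h (Away.isLocalizationElem hm hn), ← preimage_basicOpen_evalAt,
    Scheme.Hom.image_preimage_eq_opensRange_inf, inf_eq_right.mpr, evalAt_awaySec]
  exact Scheme.basicOpen_le _ _

theorem basicOpen_sSec_X (h : D.sections U.1.toOpens) :
    (ruledSurface D).basicOpen (sSec D U h Polynomial.X) = sOpen D U ⊓ tOpen D U h := by
  refine (congrArg (ruledSurface D).basicOpen ?_).trans
    (basicOpen_awaySec U (symS_mem D _) one_pos (symT_mem D _ h) one_pos)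
  change awaySec D U _ _ (sPoly D U h Polynomial.X) = _
  congr 1
  rw [sPoly, Polynomial.coe_eval₂RingHom, Polynomial.eval₂_X]
  apply val_injective
  rw [Away.val_mk, Away.val_mk]
  congr 1
  rw [pow_one]

theorem basicOpen_tSec_X (h : D.sections U.1.toOpens) :
    (ruledSurface D).basicOpen (tSec D U h Polynomial.X) = sOpen D U ⊓ tOpen D U h := by
  rw [inf_comm]
  refine (congrArg (ruledSurface D).basicOpen ?_).trans
    (basicOpen_awaySec U (symT_mem D _ h) one_pos (symS_mem D _) one_pos)
  change awaySec D U _ _ (tPoly D U h Polynomial.X) = _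
  congr 1
  rw [tPoly, Polynomial.coe_eval₂RingHom, Polynomial.eval₂_X]
  apply val_injective
  rw [Away.val_mk, Away.val_mk]
  congr 1
  rw [pow_one]

theorem eq_sum_of_isGenerator {h : D.sections U.1.toOpens} (hh : IsGenerator D U.1.toOpens h.1)
    (P : symAlg D U.1.toOpens) : ∃ a : (Fin 2 →₀ ℕ) → Γ(X, U.1.toOpens),
      P = ∑ d ∈ P.1.support, (symC D U.1.toOpens (a d) : symAlg D U.1.toOpens) *
        (symS D U.1.toOpens ^ d 0 * symT D U.1.toOpens h ^ d 1) := by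
  have hc (d : Fin 2 →₀ ℕ) : ∃ a : Γ(X, U.1.toOpens),
      P.1.coeff d = X.germToFunctionField _ a * h.1 ^ d 1 := by
    have := (hh.exists_eq_germ_mul (d 1)).mp (by simpa using (mem_symAlg D _).mp P.2 d)
    simpa using this
  choose a ha using hc
  refine ⟨a, Subtype.ext ?_⟩
  rw [AddSubmonoidClass.coe_finsetSum]
  conv_lhs => rw [P.1.as_sum]
  refine Finset.sum_congr rfl fun d _ ↦ ?_
  rw [Subring.coe_mul, Subring.coe_mul, Subring.coe_pow, Subring.coe_pow, symC_val, symS, symT, ha,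
    MvPolynomial.monomial_pow, MvPolynomial.X_pow_eq_monomial, MvPolynomial.monomial_mul,
    MvPolynomial.C_mul_monomial, one_mul]
  have e : Finsupp.single 0 (d 0) + Finsupp.single 1 (d 1) = d :=
    Finsupp.ext fun i ↦ by fin_cases i <;> simp
  simp [e]

/-- Every monomial of positive degree is divisible by s or by ht, so these two elements generate the
irrelevant ideal. -/
theorem basicOpen_symS_sup_symT {h : D.sections U.1.toOpens}
    (hh : IsGenerator D U.1.toOpens h.1) :
    Proj.basicOpen (symGrading D U.1.toOpens) (symS D _) ⊔
      Proj.basicOpen (symGrading D U.1.toOpens) (symT D _ h) = ⊤ := by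
  have := Proj.iSup_basicOpen_eq_top (symGrading D U.1.toOpens)
    (fun b : Bool ↦ bif b then symS D _ else symT D _ h) ?_
  · rw [iSup_bool_eq] at this
    exact this
  rw [HomogeneousIdeal.toIdeal_irrelevant_le]
  intro i hi P hP
  obtain ⟨a, ha⟩ := eq_sum_of_isGenerator hh P
  have hs : symS D U.1.toOpens ∈ Ideal.span
      (Set.range fun b : Bool ↦ bif b then symS D _ else symT D _ h) :=
    Ideal.subset_span ⟨true, rfl⟩
  have ht : symT D U.1.toOpens h ∈ Ideal.span
      (Set.range fun b : Bool ↦ bif b then symS D _ else symT D _ h) :=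
    Ideal.subset_span ⟨false, rfl⟩
  rw [ha]
  refine sum_mem fun d hd ↦ Ideal.mul_mem_left _ _ ?_
  have hdi : d 0 + d 1 = i := by
    have hP' : P.1.IsHomogeneous i := hP
    have := hP' (MvPolynomial.mem_support_iff.mp hd)
    rw [← this, ← Fin.sum_univ_two, ← Finsupp.degree_eq_sum, Finsupp.degree_eq_weight_one]
    rfl
  by_cases h0 : d 0 = 0
  · refine Ideal.mul_mem_left _ _ (Ideal.pow_mem_of_mem _ ht _ ?_)
    omega
  · refine Ideal.mul_mem_right _ _ (Ideal.pow_mem_of_mem _ hs _ ?_)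
    omega

theorem sOpen_sup_tOpen {h : D.sections U.1.toOpens} (hh : IsGenerator D U.1.toOpens h.1) :
    sOpen D U ⊔ tOpen D U h = ruling D ⁻¹ᵁ U.1.toOpens := by
  rw [← opensRange_ruledChart, ← Scheme.Hom.image_top_eq_opensRange, ← basicOpen_symS_sup_symT hh,
    sOpen, tOpen, opensRange_awayChart, opensRange_awayChart]
  exact Opens.ext (Set.image_union _ _ _).symm

theorem sOpen_le (D : Divisor X) (U : ChartIndex X) : sOpen D U ≤ ruling D ⁻¹ᵁ U.1.toOpens :=
  awayChart_opensRange_le U (symS_mem D _) one_pos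

theorem tOpen_le (h : D.sections U.1.toOpens) : tOpen D U h ≤ ruling D ⁻¹ᵁ U.1.toOpens :=
  awayChart_opensRange_le U (symT_mem D _ h) one_pos

theorem preimage_tOpen {V : ChartIndex X} (hV : V ≤ U) (h : D.sections U.1.toOpens) :
    ruledChart D V ⁻¹ᵁ tOpen D U h = Proj.basicOpen (symGrading D V.1.toOpens)
      (symT D _ ⟨h.1, sections_anti D (ChartIndex.le hV) h.2⟩) := by
  rw [tOpen, opensRange_awayChart, ← chartMap_ruledChart D hV, Scheme.Hom.comp_preimage,
    Scheme.Hom.preimage_image_eq, chartMap, Proj.map_preimage_basicOpen]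
  rfl

theorem basicOpen_symT_le {h : D.sections U.1.toOpens} (hh : IsGenerator D U.1.toOpens h.1)
    (h' : D.sections U.1.toOpens) :
    Proj.basicOpen (symGrading D U.1.toOpens) (symT D _ h') ≤ Proj.basicOpen _ (symT D _ h) := by
  obtain ⟨a, ha⟩ := (hh.exists_eq_germ_mul 1).mp (by rw [one_zsmul]; exact h'.2)
  have : symT D _ h' = (symC D U.1.toOpens a : symAlg D U.1.toOpens) * symT D _ h := by
    refine Subtype.ext ?_
    rw [Subring.coe_mul, symC_val, symT, symT, MvPolynomial.C_mul_monomial, ← zpow_one h.1, ← ha]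
  rw [this, Proj.basicOpen_mul]
  exact inf_le_right

theorem tOpen_le_infinityCompl (h : D.sections U.1.toOpens) : tOpen D U h ≤ infinityCompl D := by
  rw [tOpen, opensRange_awayChart]
  exact le_iSup₂_of_le U h le_rfl

/-- The complement of X₁ is defined with all sections over all charts. Near a given point every
section is a regular multiple of the generator h, so the locus ht ≠ 0 already contains all the
others over U. -/
theorem infinityCompl_inf_le {h : D.sections U.1.toOpens} (hh : IsGenerator D U.1.toOpens h.1) :
    infinityCompl D ⊓ ruling D ⁻¹ᵁ U.1.toOpens ≤ tOpen D U h := by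
  rintro z ⟨hz, hzU⟩
  obtain ⟨U', hz⟩ := Opens.mem_iSup.mp hz
  obtain ⟨h', hz⟩ := Opens.mem_iSup.mp hz
  replace hz : z ∈ tOpen D U' h' := by rwa [tOpen, opensRange_awayChart]
  obtain ⟨V, hVU, hVU', hzV⟩ := ChartIndex.exists_le_le U U' (x := ruling D z) hzU
    (tOpen_le h' hz)
  obtain ⟨w, rfl⟩ : z ∈ (ruledChart D V).opensRange := by rwa [opensRange_ruledChart]
  have h1 : w ∈ ruledChart D V ⁻¹ᵁ tOpen D U' h' := hz
  have h2 : w ∈ ruledChart D V ⁻¹ᵁ tOpen D U h := by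
    rw [preimage_tOpen hVU]
    rw [preimage_tOpen hVU'] at h1
    exact basicOpen_symT_le (U := V) (hh.mono (ChartIndex.le hVU)) _ h1
  exact h2

theorem infinityCompl_inf_sOpen {h : D.sections U.1.toOpens}
    (hh : IsGenerator D U.1.toOpens h.1) :
    infinityCompl D ⊓ sOpen D U = (ruledSurface D).basicOpen (sSec D U h Polynomial.X) := by
  rw [basicOpen_sSec_X]
  refine le_antisymm ?_ ?_
  · exact le_inf inf_le_right
      ((inf_le_inf_left _ (sOpen_le D U)).trans (infinityCompl_inf_le hh))
  · exact le_inf (inf_le_right.trans (tOpen_le_infinityCompl h)) inf_le_left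

end ChartTopology
-- Integrality of the surface and the ideal of 2X₁
section Surface
variable {X : Scheme.{u}} [IsNonsingularCurve X] (D : Divisor X)

theorem exists_mem_sOpen_or_mem_tOpen (z : ruledSurface D) :
    ∃ (U : ChartIndex X) (h : D.sections U.1.toOpens), IsGenerator D U.1.toOpens h.1 ∧
      (z ∈ sOpen D U ∨ z ∈ tOpen D U h) := by
  obtain ⟨U, h, hU, hh⟩ := exists_isGenerator D (ruling D z)
  refine ⟨U, ⟨h, hh.mem_sections⟩, hh, ?_⟩
  have h1 : z ∈ sOpen D U ⊔ tOpen D U ⟨h, hh.mem_sections⟩ := by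
    rw [sOpen_sup_tOpen (h := ⟨h, hh.mem_sections⟩) hh]
    exact hU
  exact h1

theorem exists_mem_opensRange_awayChart (z : ruledSurface D) :
    ∃ i : Σ U : ChartIndex X, {a : symAlg D U.1.toOpens // a ∈ symGrading D U.1.toOpens 1 ∧
      symEval D _ 1 (ratVar X) a ≠ 0}, z ∈ (awayChart D i.1 i.2.2.1 one_pos).opensRange := by
  obtain ⟨U, h, hh, hz | hz⟩ := exists_mem_sOpen_or_mem_tOpen D z
  · exact ⟨⟨U, symS D _, symS_mem D _, symEval_symS_ne_zero _ one_ne_zero _⟩, hz⟩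
  · exact ⟨⟨U, symT D _ h, symT_mem D _ _, symEval_symT_ne_zero _ ratVar_ne_zero hh.ne_zero⟩, hz⟩

/-- The cover of the ruled surface by the charts `a ≠ 0`, for `a` homogeneous of degree one. -/
noncomputable def awayCover : (ruledSurface D).AffineOpenCover where
  I₀ := Σ U : ChartIndex X, {a : symAlg D U.1.toOpens // a ∈ symGrading D U.1.toOpens 1 ∧
      symEval D _ 1 (ratVar X) a ≠ 0}
  X i := .of (Away (symGrading D i.1.1.toOpens) i.2.1)
  f i := awayChart D i.1 i.2.2.1 one_pos
  idx z := (exists_mem_opensRange_awayChart D z).choose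
  covers z := (exists_mem_opensRange_awayChart D z).choose_spec

theorem isDominant_specMap_of_injective {R R' : Type u} [CommRing R] [CommRing R'] (φ : R →+* R')
    (hφ : Function.Injective φ) : IsDominant (Spec.map (CommRingCat.ofHom φ)) :=
  ⟨(PrimeSpectrum.denseRange_comap_iff_ker_le_nilRadical φ).mpr
    (by rw [(RingHom.injective_iff_ker_eq_bot φ).mp hφ]; exact bot_le)⟩

/-- In each chart this point is given by evaluation at a transcendental element, which is injective
and hence dominant; density in all charts is density. The same embedding makes every chart integral.
-/
instance : IsDominant (affinePoint D (ratVar X)) := by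
  refine isDominant_of_openCover _ (awayCover D).openCover fun i ↦ ?_
  refine ⟨Spec.map (CommRingCat.ofHom (awayEval i.2.2.2)), ?_, ?_⟩
  · exact isDominant_specMap_of_injective _ (awayEval_injective aeval_ratVar_injective i.2.2.1 _)
  · exact (affinePoint_eq i.1 (ratVar X) i.2.2.1 one_pos i.2.2.2).symm

instance : IsIntegral (ruledSurface D) := by
  have (i : (awayCover D).openCover.I₀) : IsIntegral ((awayCover D).openCover.X i) := by
    have : IsDomain (Away (symGrading D i.1.1.toOpens) i.2.1) :=
      (awayEval_injective aeval_ratVar_injective i.2.2.1 i.2.2.2).isDomain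
    exact inferInstanceAs (IsIntegral (Spec (.of (Away (symGrading D i.1.1.toOpens) i.2.1))))
  exact isIntegral_of_openCover_of_isDominant (affinePoint D (ratVar X)) (awayCover D).openCover

variable {D}

theorem mem_sectionOne {W : (ruledSurface D).affineOpens} {f : Γ(ruledSurface D, W.1)} :
    f ∈ (sectionOne D).ideal W ↔ (ruledSurface D).basicOpen f ≤ infinityCompl D := by
  rw [sectionOne, Scheme.IdealSheafData.vanishingIdeal_ideal, PrimeSpectrum.mem_vanishingIdeal]
  constructor
  · intro H z hz
    have hzW := (ruledSurface D).basicOpen_le f hz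
    obtain ⟨w, rfl⟩ : z ∈ Set.range W.2.fromSpec := by rw [W.2.range_fromSpec]; exact hzW
    by_contra hzc
    have h1 : w ∈ W.2.fromSpec ⁻¹ᵁ (ruledSurface D).basicOpen f := hz
    rw [W.2.fromSpec_preimage_basicOpen] at h1
    exact h1 (H w hzc)
  · intro H w hw
    by_contra hwf
    refine hw (H ?_)
    have h1 : w ∈ W.2.fromSpec ⁻¹ᵁ (ruledSurface D).basicOpen f := by
      rw [W.2.fromSpec_preimage_basicOpen]
      exact hwf
    exact h1

theorem sectionOne_sq_ideal_eq_top {W : (ruledSurface D).affineOpens} (hW : W.1 ≤ infinityCompl D) :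
    (sectionOne D ^ 2).ideal W = ⊤ := by
  have : (sectionOne D).ideal W = ⊤ := by
    rw [Ideal.eq_top_iff_one, mem_sectionOne]
    exact ((ruledSurface D).basicOpen_le _).trans hW
  rw [Scheme.IdealSheafData.ideal_pow, Pi.pow_apply, this, Ideal.top_pow]

theorem infinityCompl_ne_bot : infinityCompl D ≠ ⊥ := by
  obtain ⟨U, h, -, hh⟩ := exists_isGenerator D (genericPoint X)
  intro hbot
  have h1 := affinePoint_mem_tOpen (D := D) (U := U) (h := ⟨h, hh.mem_sections⟩)
    (ratVar_ne_zero (X := X)) hh.ne_zero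
  have h2 := tOpen_le_infinityCompl (D := D) (U := U) ⟨h, hh.mem_sections⟩
  rw [hbot] at h2
  exact h2 (h1 (Set.mem_univ (IsLocalRing.closedPoint (R := RatField X))))

theorem sectionOne_sq_ideal_ne_bot (W : (ruledSurface D).affineOpens) (hW : Nonempty W.1) :
    (sectionOne D ^ 2).ideal W ≠ ⊥ := by
  obtain ⟨z, hzW, hz⟩ := nonempty_preirreducible_inter W.1.isOpen (infinityCompl D).isOpen
    (by simpa using hW) ((Opens.ne_bot_iff_nonempty _).mp infinityCompl_ne_bot)
  obtain ⟨f, hf, hzf⟩ := W.2.exists_basicOpen_le ⟨z, hz⟩ hzW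
  have hf0 : f ≠ 0 := by
    rintro rfl
    rw [Scheme.basicOpen_zero] at hzf
    exact hzf
  have h1 : f ^ 2 ∈ (sectionOne D ^ 2).ideal W := by
    rw [Scheme.IdealSheafData.ideal_pow, Pi.pow_apply]
    exact Ideal.pow_mem_pow (mem_sectionOne.mpr hf) 2
  intro hbot
  rw [hbot, Ideal.mem_bot] at h1
  exact hf0 (pow_eq_zero_iff two_ne_zero |>.mp h1)

variable {U : ChartIndex X}

/-- The point θ = 0 over the function field of X is where ht/s vanishes. If q had a nonzero constant
coefficient, q would be nonzero at that point; but the nonvanishing locus of a member of the ideal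
lies in that of ht/s. -/
theorem sSec_mem_sectionOne {h : D.sections U.1.toOpens} (hh : IsGenerator D U.1.toOpens h.1)
    (q : Polynomial Γ(X, U.1.toOpens)) :
    sSec D U h q ∈ (sectionOne D).ideal ⟨_, isAffineOpen_sOpen D U⟩ ↔ Polynomial.X ∣ q := by
  rw [mem_sectionOne]
  constructor
  · intro H
    rw [Polynomial.X_dvd_iff]
    have h0 := affinePoint_mem_sOpen (D := D) (0 : X.functionField) U
    by_contra hq
    have h1 : evalAt (affinePoint D (0 : X.functionField)) _ h0 (sSec D U h q) ≠ 0 := by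
      rw [evalAt_affinePoint_sSec, mul_zero, Polynomial.eval₂_at_zero, germMap_apply, map_ne_zero]
      rwa [Ne, map_eq_zero_iff _ (X.germToFunctionField_injective _)]
    have h2 : (ruledSurface D).basicOpen (sSec D U h q) ≤
        (ruledSurface D).basicOpen (sSec D U h Polynomial.X) := by
      rw [← infinityCompl_inf_sOpen hh]
      exact le_inf H ((ruledSurface D).basicOpen_le _)
    rw [evalAt_ne_zero_iff] at h1
    have h3 := (evalAt_ne_zero_iff _ _ h0 _).mpr (h1.trans (Scheme.Hom.preimage_mono _ h2))
    rw [evalAt_affinePoint_sSec, Polynomial.eval₂_X, mul_zero] at h3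
    exact h3 rfl
  · rintro ⟨r, rfl⟩
    rw [map_mul, Scheme.basicOpen_mul, ← infinityCompl_inf_sOpen hh]
    exact inf_le_left.trans inf_le_left

theorem mem_sectionOne_sq {h : D.sections U.1.toOpens} (hh : IsGenerator D U.1.toOpens h.1)
    {a : Γ(ruledSurface D, sOpen D U)} :
    a ∈ (sectionOne D ^ 2).ideal ⟨_, isAffineOpen_sOpen D U⟩ ↔
      ∃ q, a = sSec D U h (Polynomial.X ^ 2 * q) := by
  have h1 : (sectionOne D).ideal ⟨_, isAffineOpen_sOpen D U⟩ =
      Ideal.span {sSec D U h Polynomial.X} := by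
    ext b
    obtain ⟨q, rfl⟩ := sSec_surjective hh b
    rw [sSec_mem_sectionOne hh, Ideal.mem_span_singleton]
    constructor
    · exact map_dvd _
    · rintro ⟨c, hc⟩
      obtain ⟨r, rfl⟩ := sSec_surjective hh c
      rw [← sSec_mem_sectionOne hh, hc, ← map_mul, sSec_mem_sectionOne hh]
      exact dvd_mul_right _ _
  rw [Scheme.IdealSheafData.ideal_pow, Pi.pow_apply, h1, Ideal.span_singleton_pow,
    Ideal.mem_span_singleton]
  constructor
  · rintro ⟨c, rfl⟩
    obtain ⟨r, rfl⟩ := sSec_surjective hh c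
    exact ⟨r, by simp⟩
  · rintro ⟨q, rfl⟩
    rw [map_mul, map_pow]
    exact dvd_mul_right _ _

end Surface
-- Curves with a monic quadratic equation are square root covers
section Conic
variable {X : Scheme.{u}} [IsNonsingularCurve X] {D : Divisor X} {U : ChartIndex X}
variable {L : Type u} [Field L] [Algebra X.functionField L]

/-- On C the relation 1 + X r = 0 makes X = s/(ht) invertible, so C does not meet s = 0 in this
chart. -/
theorem subscheme_preimage_tOpen_le {C : (ruledSurface D).IdealSheafData}
    {h : D.sections U.1.toOpens} {r : Polynomial Γ(X, U.1.toOpens)}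
    (hr : tSec D U h (1 + Polynomial.X * r) ∈ C.ideal ⟨_, isAffineOpen_tOpen D U h⟩) :
    C.subschemeι ⁻¹ᵁ tOpen D U h ≤ C.subschemeι ⁻¹ᵁ sOpen D U := by
  let W : (ruledSurface D).affineOpens := ⟨_, isAffineOpen_tOpen D U h⟩
  rw [← C.ker_subschemeι_app W, RingHom.mem_ker, map_add, map_one, map_mul, map_add, map_one,
    map_mul] at hr
  have h1 : IsUnit (C.subschemeι.app W.1 (tSec D U h Polynomial.X)) :=
    IsUnit.of_mul_eq_one (-(C.subschemeι.app W.1 (tSec D U h r)))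
      (by rw [mul_neg]; exact neg_eq_of_add_eq_zero_right ((add_comm _ _).trans hr) ▸ rfl)
  have h3 := Scheme.basicOpen_of_isUnit _ h1
  rw [← Scheme.preimage_basicOpen, basicOpen_tSec_X] at h3
  exact h3.ge.trans (Scheme.Hom.preimage_mono _ inf_le_left)

theorem exists_evalAt_eq_congr {S : Scheme.{u}} {R : Type u} [CommRing R] {ψ : Spec (.of R) ⟶ S}
    {W W' : S.Opens} (e : W = W') (h : ⊤ ≤ ψ ⁻¹ᵁ W) (h' : ⊤ ≤ ψ ⁻¹ᵁ W') (z : R) :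
    (∃ r, evalAt ψ W h r = z) ↔ ∃ r, evalAt ψ W' h' r = z := by
  subst e; rfl

theorem exists_evalAt_subscheme {C : (ruledSurface D).IdealSheafData}
    {ψ : Spec (.of L) ⟶ C.subscheme} {θ : L} (hψ : ψ ≫ C.subschemeι = affinePoint D θ)
    {h : D.sections U.1.toOpens} (hh : IsGenerator D U.1.toOpens h.1)
    (h0 : ⊤ ≤ ψ ⁻¹ᵁ C.subschemeι ⁻¹ᵁ sOpen D U) (z : L) :
    (∃ r, evalAt ψ _ h0 r = z) ↔
      ∃ q : Polynomial Γ(X, U.1.toOpens), z = q.eval₂ (germMap _ L) (algebraMap _ L h.1 * θ) := by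
  have key (q : Polynomial Γ(X, U.1.toOpens)) :
      evalAt ψ _ h0 (C.subschemeι.app _ (sSec D U h q)) =
        q.eval₂ (germMap _ L) (algebraMap _ L h.1 * θ) := by
    have h1 : ⊤ ≤ (ψ ≫ C.subschemeι) ⁻¹ᵁ sOpen D U := h0
    rw [← evalAt_comp ψ C.subschemeι _ h1, evalAt_congr hψ h1 (affinePoint_mem_sOpen θ U),
      evalAt_affinePoint_sSec]
  constructor
  · rintro ⟨r, rfl⟩
    obtain ⟨a, rfl⟩ := C.subschemeι_app_surjective ⟨_, isAffineOpen_sOpen D U⟩ r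
    obtain ⟨q, rfl⟩ := sSec_surjective hh a
    exact ⟨q, key q⟩
  · rintro ⟨q, rfl⟩
    exact ⟨_, key q⟩

/-- Divide q by the monic quadratic polynomial satisfied by y; the remainder is linear. -/
theorem exists_eval₂_eq_of_sq {A : Type*} [CommRing A] [Nontrivial A] (φ : A →+* L) {y : L}
    {a₀ b₀ : A} (hy : y ^ 2 + φ b₀ * y + φ a₀ = 0) (q : Polynomial A) :
    ∃ c d : A, q.eval₂ φ y = φ c + φ d * y := by
  let m : Polynomial A := .X ^ 2 + .C b₀ * .X + .C a₀
  have hm : m.Monic := by simp only [m]; monicity!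
  have hdeg : m.natDegree = 2 := by simp only [m]; compute_degree!
  obtain ⟨d, c, h⟩ := Polynomial.exists_eq_X_add_C_of_natDegree_le_one (p := q %ₘ m) (by
    have := Polynomial.natDegree_modByMonic_lt q hm (by rintro h; simp [h] at hdeg)
    omega)
  refine ⟨c, d, ?_⟩
  conv_lhs => rw [← Polynomial.modByMonic_add_div q m, h]
  have : m.eval₂ φ y = 0 := by simpa [m] using hy
  simp [this, Polynomial.eval₂_mul]
  ring

/-- By `hT` the curve avoids s = 0, so over U it is affine and its functions are the polynomials in
hθ. Since hθ satisfies a monic quadratic equation over A, these form A + A hθ. As hβ and 1/2 are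
regular, hθ may be replaced by hρ with ρ = θ + β/2, and completing the square gives ρ² = β²/4 - α.
-/
theorem isSqrtCover_of_affinePoint (h2 : ∀ U : X.Opens, IsUnit (2 : Γ(X, U)))
    {C : (ruledSurface D).IdealSheafData} [IsIntegral C.subscheme]
    {ψ : Spec (.of L) ⟶ C.subscheme} [IsDominant ψ] {θ : L}
    (hψ : ψ ≫ C.subschemeι = affinePoint D θ) (hne : ∀ a : X.functionField, θ ≠ algebraMap _ _ a)
    (hex : ∀ x : L, ∃ a b : X.functionField, x = algebraMap _ _ a + algebraMap _ _ b * θ)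
    {α β : X.functionField} (hθ : θ ^ 2 + algebraMap _ _ β * θ + algebraMap _ _ α = 0)
    (hβ : β ∈ ((-1 : ℤ) • D).sections ⊤) (hα : α ∈ ((-2 : ℤ) • D).sections ⊤)
    (hT : ∀ (U : ChartIndex X) (h : D.sections U.1.toOpens), IsGenerator D U.1.toOpens h.1 →
      ∃ r : Polynomial Γ(X, U.1.toOpens), tSec D U h (1 + Polynomial.X * r) ∈ C.ideal ⟨_, isAffineOpen_tOpen D U h⟩) :
    IsSqrtCover D (restrictedRuling C) ψ (θ + algebraMap _ _ (β / 2)) (β ^ 2 / 4 - α) := by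
  have h20 : (2 : X.functionField) ≠ 0 := by
    obtain ⟨U⟩ : Nonempty (ChartIndex X) := inferInstance
    have := (h2 U.1.toOpens).map (X.germToFunctionField U.1.toOpens).hom
    rw [map_ofNat] at this
    exact this.ne_zero
  have h2L : (2 : L) ≠ 0 := by
    rw [← map_ofNat (algebraMap X.functionField L)]
    simpa using h20
  have hpre (U : ChartIndex X) (h : X.functionField) (hh : IsGenerator D U.1.toOpens h) :
      restrictedRuling C ⁻¹ᵁ U.1.toOpens = C.subschemeι ⁻¹ᵁ sOpen D U := by
    obtain ⟨r, hr⟩ := hT U ⟨h, hh.mem_sections⟩ hh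
    rw [restrictedRuling, Scheme.Hom.comp_preimage,
      ← sOpen_sup_tOpen (h := ⟨h, hh.mem_sections⟩) hh, Scheme.Hom.preimage_sup]
    exact sup_eq_left.mpr (subscheme_preimage_tOpen_le hr)
  refine ⟨inferInstance, inferInstance, ?comp_eq, ?sq_eq, ?ne_algebraMap, ?exists_eq,
    ?isAffineOpen, ?mem_range_iff⟩
  case comp_eq => rw [restrictedRuling, reassoc_of% hψ, affinePoint_ruling]
  case sq_eq =>
    simp only [map_sub, map_div₀, map_pow, map_ofNat]
    have h4L : (4 : L) = 2 * 2 := by norm_num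
    rw [h4L]
    field_simp
    linear_combination 4 * hθ
  case ne_algebraMap =>
    intro a ha
    refine hne (a - β / 2) ?_
    rw [map_sub, ← ha, add_sub_cancel_right]
  case exists_eq =>
    intro x
    obtain ⟨a, b, rfl⟩ := hex x
    refine ⟨a - b * (β / 2), b, ?_⟩
    simp only [map_sub, map_mul]
    ring
  case isAffineOpen =>
    intro U h hh
    rw [hpre U h hh]
    exact (isAffineOpen_sOpen D U).preimage C.subschemeι
  case mem_range_iff =>
    intro U h hh h' z
    have h0 : ⊤ ≤ ψ ⁻¹ᵁ C.subschemeι ⁻¹ᵁ sOpen D U := hpre U h hh ▸ h'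
    rw [exists_evalAt_eq_congr (hpre U h hh) h' h0,
      exists_evalAt_subscheme (h := ⟨h, hh.mem_sections⟩) hψ hh]
    obtain ⟨b₀, hb₀⟩ := (hh.exists_eq_germ_mul (-1)).mp (sections_anti _ le_top hβ)
    obtain ⟨a₀, ha₀⟩ := (hh.exists_eq_germ_mul (-2)).mp (sections_anti _ le_top hα)
    obtain ⟨e, he⟩ := (h2 U.1.toOpens).exists_right_inv
    have hb₁ : germMap U.1.toOpens L b₀ = algebraMap _ L h * algebraMap _ L β := by
      rw [germMap_apply, ← map_mul, hb₀]
      congr 1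
      field_simp [hh.ne_zero]
    have ha₁ : germMap U.1.toOpens L a₀ = algebraMap _ L h ^ 2 * algebraMap _ L α := by
      rw [germMap_apply, ← map_pow, ← map_mul, ha₀]
      congr 1
      have := hh.ne_zero
      field_simp
    have he₁ : germMap U.1.toOpens L e = 1 / 2 := by
      rw [eq_div_iff h2L, ← map_ofNat (germMap U.1.toOpens L), ← map_mul, mul_comm, he, map_one]
    simp only [← germMap_apply, map_mul, map_div₀, map_ofNat]
    constructor
    · rintro ⟨q, rfl⟩
      obtain ⟨c, d, hcd⟩ := exists_eval₂_eq_of_sq (germMap U.1.toOpens L)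
        (y := algebraMap _ L h * θ) (a₀ := a₀) (b₀ := b₀) (by
          rw [ha₁, hb₁]
          linear_combination (algebraMap _ L h) ^ 2 * hθ) q
      -- Here b₀ = hβ and e = 1/2, so hρ = hθ + b₀e.
      refine ⟨c - d * b₀ * e, d, ?_⟩
      rw [hcd]
      simp only [map_sub, map_mul, hb₁, he₁]
      ring
    · rintro ⟨c, d, rfl⟩
      refine ⟨.C (c + d * b₀ * e) + .C d * .X, ?_⟩
      simp only [Polynomial.eval₂_add, Polynomial.eval₂_C, Polynomial.eval₂_mul,
        Polynomial.eval₂_X, map_add, map_mul, hb₁, he₁]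
      ring

end Conic
-- The quadratic equation of a curve linearly equivalent to 2X₁
section Equation
variable {X : Scheme.{u}} [IsNonsingularCurve X] {D : Divisor X} {U : ChartIndex X}

theorem mem_sections_top_of_isGenerator {E : Divisor X} {f : X.functionField}
    (H : ∀ (U : ChartIndex X) (h : X.functionField), IsGenerator D U.1.toOpens h →
      f ∈ E.sections U.1.toOpens) : f ∈ E.sections ⊤ := by
  intro hf x _
  obtain ⟨U, h, hx, hh⟩ := exists_isGenerator D x.1
  exact H U h hh hf x hx

theorem eval₂_germMap_injective {h : X.functionField} (hh : h ≠ 0) :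
    Function.Injective (Polynomial.eval₂ (germMap U.1.toOpens (RatField X))
      (algebraMap _ (RatField X) h * ratVar X)) := by
  rw [← Polynomial.coe_eval₂RingHom, injective_iff_map_eq_zero]
  intro p hp
  have h1 : Polynomial.aeval (ratVar X) ((p.map (X.germToFunctionField U.1.toOpens).hom).comp
      (.C h * .X)) = 0 := by
    rw [← hp, Polynomial.aeval_comp, Polynomial.aeval_def, Polynomial.eval₂_map,
      Polynomial.coe_eval₂RingHom]
    simp [germMap]
  have h2 := (map_eq_zero_iff _ aeval_ratVar_injective).mp h1
  ext n
  have h3 := congrArg (Polynomial.coeff · n) h2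
  simp only [Polynomial.comp_C_mul_X_coeff, Polynomial.coeff_map, Polynomial.coeff_zero,
    mul_eq_zero, pow_eq_zero_iff', hh, false_and, or_false] at h3
  exact (map_eq_zero_iff _ (X.germToFunctionField_injective _)).mp h3

/-- The injectivity hypothesis turns the relation into an identity of polynomials once powers of 1/y
are cleared by reflecting p. A term of p of degree n > 2 would correspond to the negative power 2 -
n of y, which q cannot supply. -/
theorem exists_eq_quadratic {A L : Type*} [CommRing A] [Field L] (φ : A →+* L) {y : L} (hy : y ≠ 0)
    (hinj : Function.Injective (Polynomial.eval₂ φ y)) {p q : Polynomial A}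
    (h : p.eval₂ φ (1 / y) * y ^ 2 = q.eval₂ φ y) :
    ∃ a b c : A, p = .C a + .C b * .X + .C c * .X ^ 2 := by
  have := invertibleOfNonzero hy
  have h1 : (p.reflect (p.natDegree + 2)) * .X ^ 2 = q * .X ^ (p.natDegree + 2) := by
    apply hinj
    rw [Polynomial.eval₂_mul, Polynomial.eval₂_mul, ← h, Polynomial.eval₂_X_pow,
      Polynomial.eval₂_X_pow]
    have h2 := Polynomial.eval₂_reflect_mul_pow φ y (p.natDegree + 2)
      (p.reflect (p.natDegree + 2)) (by
        refine Polynomial.natDegree_le_iff_coeff_eq_zero.mpr fun n hn ↦ ?_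
        rw [Polynomial.coeff_reflect, Polynomial.revAt_eq_self_of_lt hn]
        exact Polynomial.coeff_eq_zero_of_natDegree_lt (by omega))
    have h3 : (p.reflect (p.natDegree + 2)).reflect (p.natDegree + 2) = p := by
      ext n
      rw [Polynomial.coeff_reflect, Polynomial.coeff_reflect, Polynomial.revAt_invol]
    rw [h3, invOf_eq_inv] at h2
    rw [← h2, one_div]
    ring
  refine ⟨p.coeff 0, p.coeff 1, p.coeff 2, ?_⟩
  ext n
  have h3 : 2 < n → p.coeff n = 0 := by
    intro hn
    by_cases hn' : n ≤ p.natDegree + 2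
    · have h2 := congrArg (Polynomial.coeff · (p.natDegree + 2 - n + 2)) h1
      simp only [Polynomial.coeff_mul_X_pow] at h2
      rw [Polynomial.coeff_mul_X_pow', if_neg (by omega), Polynomial.coeff_reflect,
        Polynomial.revAt_le (by omega)] at h2
      rwa [show p.natDegree + 2 - (p.natDegree + 2 - n) = n by omega] at h2
    · exact Polynomial.coeff_eq_zero_of_natDegree_lt (by omega)
  match n with
  | 0 => simp
  | 1 => simp [Polynomial.coeff_X_pow, Polynomial.coeff_C]
  | 2 => simp
  | n + 3 => rw [h3 (by omega)]; simp

/-- Let φ be the rational function by which the ideals of C and 2X₁ differ. Where ht ≠ 0 the ideal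
of 2X₁ is trivial, so φ is a polynomial in s/(ht) lying in the ideal of C; where s ≠ 0 that ideal is
generated by (ht/s)², so φ(ht/s)² is a polynomial in ht/s. Hence φ is quadratic in s/(ht). -/
theorem exists_equation {C : (ruledSurface D).IdealSheafData}
    (hC : C ∈ linearSystemTwoXOne D) : ∃ g₀ g₁ g₂ : X.functionField,
      ¬ (g₀ = 0 ∧ g₁ = 0 ∧ g₂ = 0) ∧ g₀ ∈ (0 : Divisor X).sections ⊤ ∧
      g₁ ∈ ((-1 : ℤ) • D).sections ⊤ ∧ g₂ ∈ ((-2 : ℤ) • D).sections ⊤ ∧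
      ∀ (U : ChartIndex X) (h : D.sections U.1.toOpens), IsGenerator D U.1.toOpens h.1 →
        ∃ a b c : Γ(X, U.1.toOpens), X.germToFunctionField _ a = g₀ ∧
          X.germToFunctionField _ b = g₁ * h.1 ∧ X.germToFunctionField _ c = g₂ * h.1 ^ 2 ∧
          tSec D U h (.C a + .C b * .X + .C c * .X ^ 2) ∈ C.ideal ⟨_, isAffineOpen_tOpen D U h⟩ := by
  obtain ⟨φ, hφ, H⟩ := exists_evalAt_eq_mul_of_idealSheafIso (affinePoint D (ratVar X)) hC
    sectionOne_sq_ideal_ne_bot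
  have key (U : ChartIndex X) (h : D.sections U.1.toOpens) (hh : IsGenerator D U.1.toOpens h.1) :
      ∃ a b c : Γ(X, U.1.toOpens),
        tSec D U h (.C a + .C b * .X + .C c * .X ^ 2) ∈ C.ideal ⟨_, isAffineOpen_tOpen D U h⟩ ∧
        Polynomial.aeval (ratVar X) (Polynomial.C (X.germToFunctionField _ c * h.1 ^ (-2 : ℤ)) +
          .C (X.germToFunctionField _ b * h.1 ^ (-1 : ℤ)) * .X +
            .C (X.germToFunctionField _ a) * .X ^ 2) = φ * ratVar X ^ 2 := by
    have hy : algebraMap _ (RatField X) h.1 * ratVar X ≠ 0 :=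
      mul_ne_zero (by simpa using hh.ne_zero) ratVar_ne_zero
    have ht := affinePoint_mem_tOpen (D := D) (U := U) (ratVar_ne_zero (X := X)) hh.ne_zero
    have hs := affinePoint_mem_sOpen (D := D) (ratVar X) U
    obtain ⟨f, hf, hfe⟩ := (H ⟨_, isAffineOpen_tOpen D U h⟩ ht).1 1 (by
      rw [sectionOne_sq_ideal_eq_top (tOpen_le_infinityCompl h)]; trivial)
    obtain ⟨p, rfl⟩ := tSec_surjective hh f
    obtain ⟨f', hf', hfe'⟩ := (H ⟨_, isAffineOpen_sOpen D U⟩ hs).1 (sSec D U h (.X ^ 2 * 1))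
      ((mem_sectionOne_sq hh).mpr ⟨1, rfl⟩)
    obtain ⟨q, rfl⟩ := sSec_surjective hh f'
    rw [map_one, one_mul, evalAt_affinePoint_tSec ratVar_ne_zero hh.ne_zero] at hfe
    rw [evalAt_affinePoint_sSec, evalAt_affinePoint_sSec, mul_one, Polynomial.eval₂_X_pow] at hfe'
    obtain ⟨a, b, c, rfl⟩ := exists_eq_quadratic (germMap U.1.toOpens (RatField X)) hy
      (eval₂_germMap_injective hh.ne_zero) (p := p) (q := q) (by rw [hfe, hfe', mul_comm])
    refine ⟨a, b, c, hf, ?_⟩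
    rw [← hfe]
    have h1 := (mul_ne_zero_iff.mp hy).1
    have h2 := (mul_ne_zero_iff.mp hy).2
    simp only [map_add, map_mul, Polynomial.aeval_C, Polynomial.aeval_X, map_pow, map_zpow₀,
      Polynomial.eval₂_add, Polynomial.eval₂_mul, Polynomial.eval₂_C, Polynomial.eval₂_X,
      Polynomial.eval₂_pow, germMap_apply]
    field_simp
    ring
  obtain ⟨U₀, h₀, -, hh₀⟩ := exists_isGenerator D (genericPoint X)
  obtain ⟨a₀, b₀, c₀, -, e₀⟩ := key U₀ ⟨h₀, hh₀.mem_sections⟩ hh₀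
  set g₀ := X.germToFunctionField _ a₀
  set g₁ := X.germToFunctionField _ b₀ * h₀ ^ (-1 : ℤ)
  set g₂ := X.germToFunctionField _ c₀ * h₀ ^ (-2 : ℤ)
  -- The coefficients of φ(t/s)² as a polynomial in the transcendental t/s do not depend on the
  -- chart, so those found over one chart are the same for all. This makes them global sections.
  have key' (U : ChartIndex X) (h : D.sections U.1.toOpens) (hh : IsGenerator D U.1.toOpens h.1) :
      ∃ a b c : Γ(X, U.1.toOpens),
        tSec D U h (.C a + .C b * .X + .C c * .X ^ 2) ∈ C.ideal ⟨_, isAffineOpen_tOpen D U h⟩ ∧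
        g₀ = X.germToFunctionField _ a ∧ g₁ = X.germToFunctionField _ b * h.1 ^ (-1 : ℤ) ∧
        g₂ = X.germToFunctionField _ c * h.1 ^ (-2 : ℤ) := by
    obtain ⟨a, b, c, h1, e⟩ := key U h hh
    have h2 := aeval_ratVar_injective (e₀.trans e.symm)
    refine ⟨a, b, c, h1, ?_, ?_, ?_⟩
    · simpa [Polynomial.coeff_X, Polynomial.coeff_C] using congrArg (Polynomial.coeff · 2) h2
    · simpa [Polynomial.coeff_X_pow, Polynomial.coeff_C] using congrArg (Polynomial.coeff · 1) h2
    · simpa using congrArg (Polynomial.coeff · 0) h2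
  refine ⟨g₀, g₁, g₂, ?_, ?_, ?_, ?_, ?_⟩
  · rintro ⟨e0, e1, e2⟩
    change Polynomial.aeval (ratVar X) (Polynomial.C g₂ + .C g₁ * .X + .C g₀ * .X ^ 2) = _ at e₀
    rw [e0, e1, e2] at e₀
    simp only [map_zero, zero_mul, add_zero] at e₀
    exact mul_ne_zero hφ (pow_ne_zero 2 ratVar_ne_zero) e₀.symm
  · refine mem_sections_top_of_isGenerator (D := D) fun U h hh ↦ ?_
    obtain ⟨a, b, c, -, e, -⟩ := key' U ⟨h, hh.mem_sections⟩ hh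
    rw [e]
    exact germ_mem_sections a
  · refine mem_sections_top_of_isGenerator (D := D) fun U h hh ↦ ?_
    obtain ⟨a, b, c, -, -, e, -⟩ := key' U ⟨h, hh.mem_sections⟩ hh
    exact (hh.exists_eq_germ_mul (-1)).mpr ⟨b, e⟩
  · refine mem_sections_top_of_isGenerator (D := D) fun U h hh ↦ ?_
    obtain ⟨a, b, c, -, -, -, e⟩ := key' U ⟨h, hh.mem_sections⟩ hh
    exact (hh.exists_eq_germ_mul (-2)).mpr ⟨c, e⟩
  · intro U h hh
    obtain ⟨a, b, c, h1, e0, e1, e2⟩ := key' U h hh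
    have := hh.ne_zero
    refine ⟨a, b, c, e0.symm, ?_, ?_, h1⟩
    · rw [e1]; field_simp
    · rw [e2]; field_simp

end Equation
-- Integral 2:1 curves in |2X₁| are square root covers
section CurvesToCovers
variable {X : Scheme.{u}} [IsNonsingularCurve X] {D : Divisor X}

/-- Elements of the function field of C are quotients of functions on an affine open subset, and
these lift to the ambient scheme because C is closed in it. -/
theorem exists_eq_algebraMap_of_evalAt {S : Scheme.{u}} {C : S.IdealSheafData}
    [IsIntegral C.subscheme] [Algebra X.functionField C.subscheme.functionField] {W : S.Opens}
    (hW : IsAffineOpen W) (h0 : ⊤ ≤ (genericMap C.subscheme ≫ C.subschemeι) ⁻¹ᵁ W)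
    (H : ∀ r : Γ(S, W), ∃ a : X.functionField, evalAt _ W h0 r = algebraMap _ _ a)
    (x : C.subscheme.functionField) : ∃ a : X.functionField, x = algebraMap _ _ a := by
  have : Nonempty (C.subschemeι ⁻¹ᵁ W) := ⟨⟨genericMap C.subscheme
    (IsLocalRing.closedPoint (R := C.subscheme.functionField)), h0 trivial⟩⟩
  obtain ⟨a, b, -, rfl⟩ := exists_germ_div_germ _ (hW.preimage C.subschemeι) x
  have key (a : Γ(C.subscheme, C.subschemeι ⁻¹ᵁ W)) : ∃ c : X.functionField,
      C.subscheme.germToFunctionField _ a = algebraMap _ _ c := by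
    obtain ⟨r, rfl⟩ := C.subschemeι_app_surjective ⟨W, hW⟩ a
    obtain ⟨c, hc⟩ := H r
    refine ⟨c, hc ▸ ?_⟩
    rw [evalAt_comp _ _ _ h0 h0]
    exact (evalAt_genericMap _ _ _).symm
  obtain ⟨c, hc⟩ := key a
  obtain ⟨d, hd⟩ := key b
  exact ⟨c / d, by rw [hc, hd, map_div₀]⟩

/-- The function field L of C has degree two over k(X). The coordinate θ of the generic point of C
is finite and not in k(X), since otherwise all functions on C would come from X; so 1, θ is a basis
of L. The leading coefficient g₀ of the equation is a nonzero constant, and dividing by it gives a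
monic equation to which `isSqrtCover_of_affinePoint` applies. -/
theorem exists_isSqrtCover {k : Type u} [Field k] [IsAlgClosed k] (h2 : (2 : k) ≠ 0)
    (p : X ⟶ Spec (.of k)) [IsProper p] {C : (ruledSurface D).IdealSheafData}
    (hC : C ∈ linearSystemTwoXOne D) [IsIntegral C.subscheme]
    (hγ : IsTwoToOne (restrictedRuling C)) :
    ∃ (L : Type u) (_ : Field L) (_ : Algebra X.functionField L)
      (ψ : Spec (.of L) ⟶ C.subscheme) (ρ : L) (δ : X.functionField),
      IsSqrtCover D (restrictedRuling C) ψ ρ δ := by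
  have := hγ.surjective
  obtain ⟨j, hj, -⟩ := exists_functionField_hom (genericMap C.subscheme ≫ restrictedRuling C)
  let : Algebra X.functionField C.subscheme.functionField := j.toAlgebra
  replace hj : genericMap C.subscheme ≫ restrictedRuling C =
    Spec.map (CommRingCat.ofHom (algebraMap X.functionField C.subscheme.functionField)) ≫
      genericMap X := hj.symm
  have hrank : Module.finrank X.functionField C.subscheme.functionField = 2 := by
    rw [← residueDegree_genericPoint _ (genericMap C.subscheme) hj fun x ↦ ?_, hγ.degree]
    obtain ⟨_, ⟨V, hV, rfl⟩, hξ, -⟩ :=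
      C.subscheme.isBasis_affineOpens.exists_subset_of_mem_open
        (Set.mem_univ (genericPoint C.subscheme)) isOpen_univ
    have : Nonempty V := ⟨_, hξ⟩
    obtain ⟨a, b, -, e⟩ := exists_germ_div_germ V hV x
    exact ⟨V, this, top_le_preimage _ V, a, b, by rw [e, evalAt_genericMap, evalAt_genericMap]⟩
  have hnot : ¬ ∀ x : C.subscheme.functionField, ∃ a : X.functionField, x = algebraMap _ _ a := by
    intro H
    have h1 : Function.Bijective (algebraMap X.functionField C.subscheme.functionField) :=
      ⟨RingHom.injective _, fun x ↦ (H x).imp fun _ h ↦ h.symm⟩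
    have h3 := (LinearEquiv.ofBijective (Algebra.linearMap X.functionField _) h1).finrank_eq
    rw [hrank, Module.finrank_self] at h3
    exact absurd h3 (by norm_num)
  set ψ := genericMap C.subscheme ≫ C.subschemeι with hψdef
  have hψ : ψ ≫ ruling D = Spec.map (CommRingCat.ofHom
      (algebraMap X.functionField C.subscheme.functionField)) ≫ genericMap X := by
    rw [← hj, hψdef, Category.assoc, restrictedRuling]
  obtain ⟨g₀, g₁, g₂, hg, hg₀, hg₁, hg₂, H⟩ := exists_equation hC
  obtain ⟨U, h, -, hh⟩ := exists_isGenerator D (genericPoint X)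
  let h' : D.sections U.1.toOpens := ⟨h, hh.mem_sections⟩
  have hpoly (y : X.functionField) (q : Polynomial Γ(X, U.1.toOpens)) :
      ∃ a : X.functionField, q.eval₂ (germMap _ C.subscheme.functionField) (algebraMap _ _ y) =
        algebraMap _ _ a :=
    ⟨_, (Polynomial.hom_eval₂ q (X.germToFunctionField U.1.toOpens).hom (algebraMap _ _) y).symm⟩
  -- If the generic point of C were outside s ≠ 0, then s/(ht) would vanish at it and every function
  -- would take a value in k(X), contradicting degree two.
  have hs : ⊤ ≤ ψ ⁻¹ᵁ sOpen D U := by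
    by_contra hs
    have hU : ⊤ ≤ ψ ⁻¹ᵁ ruling D ⁻¹ᵁ U.1.toOpens := by
      change ⊤ ≤ (ψ ≫ ruling D) ⁻¹ᵁ U.1.toOpens
      rw [hψ]
      exact top_le_preimage _ _
    rw [← sOpen_sup_tOpen (h := h') hh] at hU
    have ht : ⊤ ≤ ψ ⁻¹ᵁ tOpen D U h' := by
      rcases hU (Set.mem_univ (IsLocalRing.closedPoint (R := C.subscheme.functionField)))
        with h1 | h1
      · exact absurd (top_le_preimage_of_mem ψ h1) hs
      · exact top_le_preimage_of_mem ψ h1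
    have h0 : evalAt ψ _ ht (tSec D U h' Polynomial.X) = 0 := by
      by_contra h0
      have h1 := (evalAt_ne_zero_iff ψ _ ht _).mp h0
      rw [basicOpen_tSec_X] at h1
      exact hs (h1.trans (Scheme.Hom.preimage_mono _ inf_le_left))
    refine hnot (exists_eq_algebraMap_of_evalAt (isAffineOpen_tOpen D U h') ht fun r ↦ ?_)
    obtain ⟨q, rfl⟩ := tSec_surjective (h := h') hh r
    rw [evalAt_tSec hψ, h0, ← map_zero (algebraMap X.functionField C.subscheme.functionField)]
    exact hpoly 0 q
  have hhL : algebraMap X.functionField C.subscheme.functionField h ≠ 0 := by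
    simpa using hh.ne_zero
  obtain ⟨θ, hθ⟩ : ∃ θ, evalAt ψ _ hs (sSec D U h' Polynomial.X) =
      algebraMap X.functionField C.subscheme.functionField h * θ :=
    ⟨_ / algebraMap X.functionField C.subscheme.functionField h, (mul_div_cancel₀ _ hhL).symm⟩
  have hne (a : X.functionField) : θ ≠ algebraMap _ _ a := by
    rintro rfl
    refine hnot (exists_eq_algebraMap_of_evalAt (isAffineOpen_sOpen D U) hs fun r ↦ ?_)
    obtain ⟨q, rfl⟩ := sSec_surjective (h := h') hh r
    rw [evalAt_sSec hψ, hθ, ← map_mul]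
    exact hpoly _ q
  have hψθ : ψ = affinePoint D θ := eq_affinePoint hψ hs (h := h') hh hθ
  have hθ0 : θ ≠ 0 := by simpa using hne 0
  have hex (x : C.subscheme.functionField) : ∃ a b : X.functionField,
      x = algebraMap _ _ a + algebraMap _ _ b * θ := by
    have hli : LinearIndependent X.functionField ![1, θ] := by
      rw [LinearIndependent.pair_iff]
      intro s t e
      rw [Algebra.smul_def, Algebra.smul_def, mul_one] at e
      have ht : t = 0 := by
        by_contra ht
        refine hne (-s / t) ?_
        have : algebraMap _ C.subscheme.functionField t ≠ 0 := by simpa using ht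
        rw [map_div₀, map_neg, eq_div_iff this]
        linear_combination e
      subst ht
      exact ⟨by simpa using e, rfl⟩
    have := Module.finite_of_finrank_pos (hrank ▸ two_pos)
    have hspan := hli.span_eq_top_of_card_eq_finrank' (by rw [hrank]; rfl)
    have hx : x ∈ Submodule.span X.functionField (Set.range ![1, θ]) := by
      rw [hspan]; trivial
    rw [Matrix.range_cons, Matrix.range_cons, Matrix.range_empty, Set.union_empty,
      Set.singleton_union, Submodule.mem_span_pair] at hx
    obtain ⟨a, b, rfl⟩ := hx
    exact ⟨a, b, by rw [Algebra.smul_def, Algebra.smul_def, mul_one]⟩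
  have hquad : algebraMap _ _ g₀ * θ ^ 2 + algebraMap _ _ g₁ * θ + algebraMap _ _ g₂ = 0 := by
    obtain ⟨a, b, c, ha, hb, hc, hmem⟩ := H U h' hh
    have ht := affinePoint_mem_tOpen (D := D) hθ0 (h := h') hh.ne_zero
    have e1 := evalAt_affinePoint_tSec hθ0 (h := h') hh.ne_zero ht
      (.C a + .C b * .X + .C c * .X ^ 2)
    rw [← C.ker_subschemeι_app ⟨_, isAffineOpen_tOpen D U h'⟩, RingHom.mem_ker] at hmem
    have ht' : ⊤ ≤ ψ ⁻¹ᵁ tOpen D U h' := hψθ ▸ ht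
    rw [← evalAt_congr hψθ ht' ht, evalAt_comp _ _ _ ht' ht'] at e1
    erw [hmem] at e1
    rw [map_zero] at e1
    simp only [Polynomial.eval₂_add, Polynomial.eval₂_mul, Polynomial.eval₂_C, Polynomial.eval₂_X,
      Polynomial.eval₂_pow, germMap_apply, ha, hb, hc, map_mul, map_pow] at e1
    have hhL' : algebraMap X.functionField C.subscheme.functionField h'.1 ≠ 0 := hhL
    field_simp at e1
    linear_combination -e1
  -- Without the quadratic term the equation would either express θ in k(X) or be identically zero.
  have hg0 : g₀ ≠ 0 := by
    rintro rfl
    rw [map_zero, zero_mul, zero_add] at hquad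
    have h1 : g₁ = 0 := by
      by_contra h1
      refine hne (-g₂ / g₁) ?_
      have : algebraMap _ C.subscheme.functionField g₁ ≠ 0 := by simpa using h1
      rw [map_div₀, map_neg, eq_div_iff this]
      linear_combination hquad
    subst h1
    exact hg ⟨rfl, rfl, by simpa using hquad⟩
  -- A nonzero global function is a constant, so it has order zero everywhere and its inverse is
  -- regular.
  have hinv : g₀⁻¹ ∈ (0 : Divisor X).sections ⊤ := by
    obtain ⟨c, hc0, rfl, hc⟩ := exists_sq_of_mem_sections_zero p hg₀ hg0
    intro _ x _
    rw [ord_inv' (pow_ne_zero 2 hc0), pow_two, Scheme.ord_mul hc0 hc0, hc]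
    simp
  refine ⟨_, inferInstance, inferInstance, genericMap C.subscheme, _, _,
    isSqrtCover_of_affinePoint (isUnit_two_sections p h2) hψθ hne hex
      (β := g₀⁻¹ * g₁) (α := g₀⁻¹ * g₂) ?_ ?_ ?_ fun U h hh ↦ ?_⟩
  · have : algebraMap _ C.subscheme.functionField g₀ ≠ 0 := by simpa using hg0
    simp only [map_mul, map_inv₀]
    field_simp
    linear_combination hquad
  · simpa using mul_mem_sections hinv hg₁
  · simpa using mul_mem_sections hinv hg₂
  · obtain ⟨a, b, c, ha, -, -, hmem⟩ := H U h hh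
    obtain ⟨e, he⟩ := exists_germ_eq_of_mem_sections U.1.toOpens (sections_anti _ le_top hinv)
    have hea : e * a = 1 := by
      apply X.germToFunctionField_injective U.1.toOpens
      rw [map_mul, map_one, he, ha, inv_mul_cancel₀ hg0]
    -- Multiplying a + bX + cX² by e = g₀⁻¹ makes the constant term 1.
    refine ⟨.C (e * b) + .C (e * c) * .X, ?_⟩
    convert Ideal.mul_mem_left _ (tSec D U h (.C e)) hmem using 1
    rw [← map_mul]
    congr 1
    have hea' : Polynomial.C e * Polynomial.C a = 1 := by rw [← map_mul, hea, map_one]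
    simp only [map_mul]
    linear_combination -hea'

end CurvesToCovers
-- The closure of a field-valued point
section Closure
variable {S : Scheme.{u}} {L : Type u} [Field L] (ψ : Spec (.of L) ⟶ S)

instance : QuasiCompact ψ :=
  ⟨fun _ _ _ ↦ (Set.subsingleton_of_subsingleton (α := Spec (.of L))).finite.isCompact⟩

/-- It has a dense field-valued point, hence is irreducible. It is reduced because the kernel of a
map to a reduced ring is radical. -/
instance : IsIntegral ψ.ker.subscheme := by
  have : IrreducibleSpace ψ.ker.subscheme := irreducibleSpace_of_isDominant ψ.toImage
  have (i : ψ.ker.subschemeCover.openCover.I₀) :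
      IsReduced (ψ.ker.subschemeCover.openCover.X i) := by
    let W : S.affineOpens := i
    have : _root_.IsReduced (Γ(S, W.1) ⧸ ψ.ker.ideal W) := by
      rw [← Ideal.isRadical_iff_quotient_reduced, ψ.ker_apply]
      rintro x ⟨n, hn⟩
      rw [RingHom.mem_ker, map_pow] at hn
      exact eq_zero_of_pow_eq_zero hn
    exact inferInstanceAs (IsReduced (Spec (.of (Γ(S, W.1) ⧸ ψ.ker.ideal W))))
  have : IsReduced ψ.ker.subscheme := .of_openCover _ ψ.ker.subschemeCover.openCover
  exact isIntegral_of_irreducibleSpace_of_isReduced _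

theorem mem_ker_iff_evalAt_eq_zero {W : S.affineOpens} (h : ⊤ ≤ ψ ⁻¹ᵁ W.1) (a : Γ(S, W.1)) :
    a ∈ ψ.ker.ideal W ↔ evalAt ψ W.1 h a = 0 := by
  rw [ψ.ker_apply, RingHom.mem_ker]
  have h1 : evalAt ψ W.1 h a = (Scheme.ΓSpecIso (.of L)).hom
      ((Spec (.of L)).presheaf.map (homOfLE h).op (ψ.app W.1 a)) := rfl
  rw [h1]
  have e : ψ ⁻¹ᵁ W.1 = ⊤ := top_le_iff.mp h
  have : IsIso (homOfLE h) := ⟨homOfLE e.le, rfl, rfl⟩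
  have h2 := ConcreteCategory.bijective_of_isIso (Scheme.ΓSpecIso (.of L)).hom
  have h3 := ConcreteCategory.bijective_of_isIso
    ((Spec (.of L)).presheaf.map (homOfLE h).op)
  rw [map_eq_zero_iff _ h2.1, map_eq_zero_iff _ h3.1]

end Closure

/-! ### The closure of the point t/s = √f is a curve in |2X₁| -/

section CoversToCurves
variable {X : Scheme.{u}} [IsNonsingularCurve X] {D : Divisor X} {U : ChartIndex X}
variable {L : Type u} [Field L] [Algebra X.functionField L] {θ : L} {f : X.functionField}

theorem exists_germ_eq_mul_sq (hf : f ∈ ((-2 : ℤ) • D).sections ⊤) {h : X.functionField}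
    (hh : IsGenerator D U.1.toOpens h) :
    ∃ d : Γ(X, U.1.toOpens), X.germToFunctionField _ d = f * h ^ 2 := by
  obtain ⟨d, rfl⟩ := (hh.exists_eq_germ_mul (-2)).mp (sections_anti _ le_top hf)
  have := hh.ne_zero
  exact ⟨d, by field_simp⟩

/-- At the point, X = s/(ht) takes the value 1/(hθ), and (hθ)² = d, so 1 - dX² vanishes. -/
theorem tSec_mem_ker (hθ0 : θ ≠ 0) (hθ : θ ^ 2 = algebraMap _ _ f) {h : D.sections U.1.toOpens}
    (hh : IsGenerator D U.1.toOpens h.1) {d : Γ(X, U.1.toOpens)}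
    (hd : X.germToFunctionField _ d = f * h.1 ^ 2) :
    tSec D U h (1 + .X * (-.C d * .X)) ∈ (affinePoint D θ).ker.ideal ⟨_, isAffineOpen_tOpen D U h⟩ := by
  have ht := affinePoint_mem_tOpen (D := D) hθ0 hh.ne_zero
  rw [mem_ker_iff_evalAt_eq_zero _ ht]
  refine (evalAt_affinePoint_tSec hθ0 hh.ne_zero ht _).trans ?_
  have h1 : algebraMap X.functionField L h.1 ≠ 0 := by simpa using hh.ne_zero
  simp only [Polynomial.eval₂_add, Polynomial.eval₂_one, Polynomial.eval₂_mul, Polynomial.eval₂_neg,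
    Polynomial.eval₂_X, Polynomial.eval₂_C, germMap_apply, hd, map_mul, map_pow, ← hθ]
  field_simp
  ring

/-- Divide by the monic polynomial X² - d, which vanishes at hθ. A linear remainder vanishing there
must be zero because θ is not in k(X). -/
theorem sSec_mem_ker_iff (hne : ∀ a : X.functionField, θ ≠ algebraMap _ _ a)
    (hθ : θ ^ 2 = algebraMap _ _ f) {h : D.sections U.1.toOpens}
    (hh : IsGenerator D U.1.toOpens h.1) {d : Γ(X, U.1.toOpens)}
    (hd : X.germToFunctionField _ d = f * h.1 ^ 2) (q : Polynomial Γ(X, U.1.toOpens)) :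
    sSec D U h q ∈ (affinePoint D θ).ker.ideal ⟨_, isAffineOpen_sOpen D U⟩ ↔
      ∃ r, q = (.X ^ 2 - .C d) * r := by
  have hs := affinePoint_mem_sOpen (D := D) θ U
  rw [mem_ker_iff_evalAt_eq_zero _ hs]
  have e := evalAt_affinePoint_sSec θ hs h q
  refine (Eq.congr_left e).trans ?_
  have hzero : (Polynomial.X ^ 2 - Polynomial.C d).eval₂ (germMap _ L)
      (algebraMap _ L h.1 * θ) = 0 := by
    simp only [Polynomial.eval₂_sub, Polynomial.eval₂_X_pow, Polynomial.eval₂_C, germMap_apply, hd,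
      map_mul, map_pow, ← hθ]
    ring
  constructor
  · intro hq
    have hm : (Polynomial.X ^ 2 - Polynomial.C d).Monic := Polynomial.monic_X_pow_sub_C d two_ne_zero
    refine ⟨q /ₘ (.X ^ 2 - .C d), ?_⟩
    have hqd := Polynomial.modByMonic_add_div q (.X ^ 2 - .C d)
    obtain ⟨b, c, hbc⟩ := Polynomial.exists_eq_X_add_C_of_natDegree_le_one
      (p := q %ₘ (.X ^ 2 - .C d)) (by
        have := Polynomial.natDegree_modByMonic_lt q hm (by
          intro h1
          have := congrArg Polynomial.natDegree h1
          rw [Polynomial.natDegree_X_pow_sub_C, Polynomial.natDegree_one] at this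
          exact absurd this two_ne_zero)
        rw [Polynomial.natDegree_X_pow_sub_C] at this
        omega)
    have h0 : germMap U.1.toOpens L b * (algebraMap _ L h.1 * θ) + germMap U.1.toOpens L c = 0 := by
      rw [← hqd, Polynomial.eval₂_add, Polynomial.eval₂_mul, hzero, hbc] at hq
      simpa using hq
    have hh0 := hh.ne_zero
    have hb : X.germToFunctionField _ b = 0 := by
      by_contra hb
      refine hne (-X.germToFunctionField _ c / (X.germToFunctionField _ b * h.1)) ?_
      have h1 : algebraMap _ L (X.germToFunctionField _ b * h.1) ≠ 0 := by
        rw [map_ne_zero]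
        exact mul_ne_zero hb hh0
      rw [map_div₀, map_neg, eq_div_iff h1, map_mul]
      rw [germMap_apply, germMap_apply] at h0
      linear_combination h0
    have hc : X.germToFunctionField _ c = 0 := by
      rw [germMap_apply, germMap_apply, hb, map_zero, zero_mul, zero_add] at h0
      simpa using h0
    rw [map_eq_zero_iff _ (X.germToFunctionField_injective _)] at hb hc
    rw [hb, hc, map_zero, zero_mul, zero_add] at hbc
    rw [hbc, zero_add] at hqd
    exact hqd.symm
  · rintro ⟨r, rfl⟩
    rw [Polynomial.eval₂_mul, hzero, zero_mul]

theorem ratVar_sq_ne (f : X.functionField) : ratVar X ^ 2 ≠ algebraMap _ _ f := by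
  intro h
  have h1 : (Polynomial.X ^ 2 : Polynomial X.functionField) = .C f :=
    aeval_ratVar_injective (by rw [map_pow, Polynomial.aeval_X, Polynomial.aeval_C, h])
  have h2 := congrArg Polynomial.natDegree h1
  rw [Polynomial.natDegree_X_pow, Polynomial.natDegree_C] at h2
  exact two_ne_zero h2

theorem evalAt_affinePoint_ratVar_tSec {h : D.sections U.1.toOpens}
    (hh : IsGenerator D U.1.toOpens h.1) {d : Γ(X, U.1.toOpens)}
    (hd : X.germToFunctionField _ d = f * h.1 ^ 2)
    (ht : ⊤ ≤ affinePoint D (ratVar X) ⁻¹ᵁ tOpen D U h) :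
    evalAt _ _ ht (tSec D U h (1 + .X * (-.C d * .X))) = 1 - algebraMap _ _ f / ratVar X ^ 2 := by
  rw [evalAt_affinePoint_tSec ratVar_ne_zero hh.ne_zero]
  have h1 : algebraMap X.functionField (RatField X) h.1 ≠ 0 := by simpa using hh.ne_zero
  have h2 := ratVar_ne_zero (X := X)
  simp only [Polynomial.eval₂_add, Polynomial.eval₂_one, Polynomial.eval₂_mul, Polynomial.eval₂_neg,
    Polynomial.eval₂_X, Polynomial.eval₂_C, germMap_apply, hd, map_mul, map_pow]
  field_simp
  ring

/-- With τ = t/s, the rational function φ = 1 - f/τ² has divisor C - 2X₁. In the chart s ≠ 0 the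
ideals of C and 2X₁ are generated by (ht/s)² - d = (ht/s)²φ and by (ht/s)². Near points of s = 0
both ideals are trivial and φ is invertible. -/
theorem ker_affinePoint_mem_linearSystem (hne : ∀ a : X.functionField, θ ≠ algebraMap _ _ a)
    (hθ : θ ^ 2 = algebraMap _ _ f) (hf : f ∈ ((-2 : ℤ) • D).sections ⊤) :
    (affinePoint D θ).ker ∈ linearSystemTwoXOne D := by
  have hθ0 : θ ≠ 0 := by simpa using hne 0
  let ψ := affinePoint D (ratVar X)
  let φ : RatField X := 1 - algebraMap _ _ f / ratVar X ^ 2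
  have hτ : ratVar X ^ 2 ≠ 0 := pow_ne_zero 2 ratVar_ne_zero
  have hφ : φ ≠ 0 := by
    intro h
    rw [sub_eq_zero, eq_div_iff hτ, one_mul] at h
    exact ratVar_sq_ne f h
  have hφτ : ratVar X ^ 2 * φ = ratVar X ^ 2 - algebraMap _ _ f := by
    rw [mul_sub, mul_one, mul_div_cancel₀ _ hτ]
  let I := (affinePoint D θ).ker
  let J := sectionOne D ^ 2
  let T := {W : (ruledSurface D).affineOpens // ∀ h : ⊤ ≤ ψ ⁻¹ᵁ W.1,
    (∀ a ∈ J.ideal W, ∃ b ∈ I.ideal W, evalAt ψ _ h b = evalAt ψ _ h a * φ) ∧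
    ∀ b ∈ I.ideal W, ∃ a ∈ J.ideal W, evalAt ψ _ h b = evalAt ψ _ h a * φ}
  refine idealSheafIso_of_cover ψ φ hφ (fun W : T ↦ W.1) ?_ (fun W h ↦ (W.2 h).1)
    (fun W h ↦ (W.2 h).2)
  rw [← top_le_iff]
  intro z _
  obtain ⟨U, h, hh, hz⟩ := exists_mem_sOpen_or_mem_tOpen D z
  obtain ⟨d, hd⟩ := exists_germ_eq_mul_sq hf hh
  by_cases hzs : z ∈ sOpen D U
  · refine Opens.mem_iSup.mpr ⟨⟨⟨_, isAffineOpen_sOpen D U⟩, fun hs ↦ ?_⟩, hzs⟩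
    have key (q : Polynomial Γ(X, U.1.toOpens)) :
        evalAt ψ _ hs (sSec D U h ((.X ^ 2 - .C d) * q)) =
          evalAt ψ _ hs (sSec D U h (.X ^ 2 * q)) * φ := by
      rw [evalAt_affinePoint_sSec, evalAt_affinePoint_sSec]
      simp only [Polynomial.eval₂_mul, Polynomial.eval₂_sub, Polynomial.eval₂_X_pow,
        Polynomial.eval₂_C, germMap_apply, hd, map_mul, map_pow]
      linear_combination (-algebraMap _ (RatField X) h.1 ^ 2 * q.eval₂ (germMap _ (RatField X))
        (algebraMap _ _ h.1 * ratVar X)) * hφτ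
    constructor
    · intro a ha
      obtain ⟨q, rfl⟩ := (mem_sectionOne_sq hh).mp ha
      exact ⟨_, (sSec_mem_ker_iff hne hθ hh hd _).mpr ⟨q, rfl⟩, key q⟩
    · intro b hb
      obtain ⟨q, rfl⟩ := sSec_surjective hh b
      obtain ⟨r, rfl⟩ := (sSec_mem_ker_iff hne hθ hh hd _).mp hb
      exact ⟨_, (mem_sectionOne_sq hh).mpr ⟨r, rfl⟩, key r⟩
  -- At a point of s = 0 the function X = s/(ht) vanishes, so 1 - dX² does not. Where this function
  -- is invertible it equals φ and belongs to the ideal of C, which is therefore the unit ideal.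
  · have hzt := hz.resolve_left hzs
    let W : (ruledSurface D).affineOpens := ⟨_, isAffineOpen_tOpen D U h⟩
    let e : Γ(ruledSurface D, W.1) := tSec D U h (1 + .X * (-.C d * .X))
    have hze : z ∈ (ruledSurface D).basicOpen e := by
      have h1 : z ∉ (ruledSurface D).basicOpen (tSec D U h Polynomial.X) := by
        rw [basicOpen_tSec_X]
        exact fun h ↦ hzs h.1
      have h2 : (1 : Γ(ruledSurface D, W.1)) = e + tSec D U h .X * tSec D U h (.C d * .X) := by
        rw [← map_mul, ← map_add, ← map_one (tSec D U h)]
        congr 1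
        ring
      have h3 : z ∈ (ruledSurface D).basicOpen (1 : Γ(ruledSurface D, W.1)) := by
        rw [Scheme.basicOpen_of_isUnit _ isUnit_one]
        exact hzt
      rw [h2] at h3
      rcases Scheme.basicOpen_add_le _ _ _ h3 with h4 | h4
      · exact h4
      · rw [Scheme.basicOpen_mul] at h4
        exact absurd h4.1 h1
    refine Opens.mem_iSup.mpr ⟨⟨(ruledSurface D).affineBasicOpen (U := W) e, fun ht ↦ ?_⟩, hze⟩
    have hJ : J.ideal ((ruledSurface D).affineBasicOpen (U := W) e) = ⊤ :=
      sectionOne_sq_ideal_eq_top (((ruledSurface D).basicOpen_le e).trans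
        (tOpen_le_infinityCompl h))
    let e' : Γ(ruledSurface D, ((ruledSurface D).affineBasicOpen (U := W) e).1) := (ruledSurface D).presheaf.map (homOfLE ((ruledSurface D).basicOpen_le e)).op e
    have hu : IsUnit e' := RingedSpace.isUnit_res_basicOpen _ e
    have he' : e' ∈ I.ideal ((ruledSurface D).affineBasicOpen (U := W) e) := by
      rw [← I.map_ideal_basicOpen]
      exact Ideal.mem_map_of_mem _ (tSec_mem_ker hθ0 hθ hh hd)
    have hev : evalAt ψ _ ht e' = φ :=
      (evalAt_res ψ ht (affinePoint_mem_tOpen ratVar_ne_zero hh.ne_zero) _ e).trans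
        (evalAt_affinePoint_ratVar_tSec hh hd _)
    constructor
    · intro a _
      exact ⟨a * e', Ideal.mul_mem_left _ _ he', by rw [map_mul, hev]⟩
    · intro b _
      obtain ⟨c, hc⟩ := hu.exists_left_inv
      refine ⟨b * c, by rw [hJ]; trivial, ?_⟩
      rw [← hev, ← map_mul, mul_assoc, hc, mul_one]

theorem isSqrtCover_ker_affinePoint (h2 : ∀ U : X.Opens, IsUnit (2 : Γ(X, U)))
    (hne : ∀ a : X.functionField, θ ≠ algebraMap _ _ a)
    (hex : ∀ x : L, ∃ a b : X.functionField, x = algebraMap _ _ a + algebraMap _ _ b * θ)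
    (hθ : θ ^ 2 = algebraMap _ _ f) (hf : f ∈ ((-2 : ℤ) • D).sections ⊤) :
    IsSqrtCover D (restrictedRuling (affinePoint D θ).ker) (affinePoint D θ).toImage θ f := by
  have hθ0 : θ ≠ 0 := by simpa using hne 0
  have H := isSqrtCover_of_affinePoint h2 (C := (affinePoint D θ).ker) (α := -f) (β := 0)
    (ψ := (affinePoint D θ).toImage) (affinePoint D θ).toImage_imageι hne hex
    (by rw [hθ, map_zero, map_neg]; ring) (zero_mem _) (neg_mem hf) (fun U h hh ↦ by
      obtain ⟨d, hd⟩ := exists_germ_eq_mul_sq hf hh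
      exact ⟨_, tSec_mem_ker hθ0 hθ hh hd⟩)
  simpa using H

end CoversToCurves
-- Existence and uniqueness of the double cover with given branch points
section Main
variable {X : Scheme.{u}} [IsNonsingularCurve X] {D : Divisor X}

theorem Divisor.ofPoints_apply (B : Finset (PrimeDivisor X)) (x : PrimeDivisor X) [Decidable (x ∈ B)] :
    Divisor.ofPoints B x = if x ∈ B then 1 else 0 := by
  classical
  rw [Divisor.ofPoints, Finsupp.finsetSum_apply]
  simp only [Finsupp.single_apply, Finset.sum_ite_eq']
  congr

/-- A nonsquare f makes X² - f irreducible, so adjoining its root gives a quadratic field extension,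
and the curve is the closure of the point with t/s equal to that root. -/
theorem exists_isSqrtCover_of_not_isSquare (h2 : ∀ U : X.Opens, IsUnit (2 : Γ(X, U)))
    {f : X.functionField} (hf : f ∈ ((-2 : ℤ) • D).sections ⊤) (hsq : ∀ g, g ^ 2 ≠ f) :
    ∃ C ∈ linearSystemTwoXOne D, ∃ (L : Type u) (_ : Field L) (_ : Algebra X.functionField L)
      (ψ : Spec (.of L) ⟶ C.subscheme) (ρ : L), IsSqrtCover D (restrictedRuling C) ψ ρ f := by
  let P : Polynomial X.functionField := .X ^ 2 - .C f
  have : Fact (Irreducible P) := ⟨X_pow_sub_C_irreducible_of_prime Nat.prime_two hsq⟩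
  have hθ : AdjoinRoot.root P ^ 2 = algebraMap X.functionField (AdjoinRoot P) f := by
    have h := AdjoinRoot.eval₂_root P
    rw [Polynomial.eval₂_sub, Polynomial.eval₂_X_pow, Polynomial.eval₂_C, sub_eq_zero] at h
    exact h
  have hne (a : X.functionField) : AdjoinRoot.root P ≠ algebraMap _ _ a := by
    intro h
    rw [h, ← map_pow] at hθ
    exact hsq a ((algebraMap X.functionField (AdjoinRoot P)).injective hθ)
  refine ⟨_, ker_affinePoint_mem_linearSystem hne hθ hf, AdjoinRoot P, inferInstance, inferInstance,
    _, _, isSqrtCover_ker_affinePoint h2 hne (fun x ↦ ?_) hθ hf⟩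
  obtain ⟨q, rfl⟩ := AdjoinRoot.mk_surjective x
  obtain ⟨a, b, h⟩ := exists_eval₂_eq_of_sq (algebraMap X.functionField (AdjoinRoot P))
    (y := AdjoinRoot.root P) (a₀ := -f) (b₀ := 0) (by rw [hθ, map_neg, map_zero]; ring) q
  refine ⟨a, b, h ▸ ?_⟩
  rw [← AdjoinRoot.aeval_eq, Polynomial.aeval_def]

namespace IsSqrtCover
variable {C : Scheme.{u}} {γ : C ⟶ X} {L : Type u} [Field L]
  [Algebra X.functionField L] {ψ : Spec (.of L) ⟶ C} {ρ : L} {δ : X.functionField}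

theorem branchLocus_eq (H : IsSqrtCover D γ ψ ρ δ) (h2 : ∀ U : X.Opens, IsUnit (2 : Γ(X, U)))
    {B : Finset (PrimeDivisor X)}
    (hδ : ∀ x : PrimeDivisor X, Scheme.ord δ x.1 = Divisor.ofPoints B x + 2 * D x) :
    branchLocus γ = Subtype.val '' (B : Set (PrimeDivisor X)) := by
  classical
  ext x
  rw [H.mem_branchLocus_iff h2]
  constructor
  · rintro ⟨hx, h⟩
    have h1 := hδ ⟨x, hx⟩
    rw [Divisor.ofPoints_apply] at h1
    refine ⟨⟨x, hx⟩, ?_, rfl⟩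
    by_contra hB
    rw [if_neg (by simpa using hB)] at h1
    change Scheme.ord δ x = _ at h1
    omega
  · rintro ⟨x, hx, rfl⟩
    have h1 := hδ x
    rw [Divisor.ofPoints_apply, if_pos (by simpa using hx)] at h1
    exact ⟨x.2, by rw [h1]; simp⟩

/-- The divisor div δ - 2D is effective and at least 1 at the points of B, while div f - 2D is
exactly B. So δ/f has no poles, and a nonzero global function is the square of a constant. -/
theorem exists_sq_mul_eq {k : Type u} [Field k] [IsAlgClosed k] (h2 : (2 : k) ≠ 0)
    (p : X ⟶ Spec (.of k)) [IsProper p] (H : IsSqrtCover D γ ψ ρ δ) {B : Finset (PrimeDivisor X)}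
    (hγ : branchLocus γ = Subtype.val '' (B : Set (PrimeDivisor X))) {f : X.functionField}
    (hf0 : f ≠ 0) (hf : ∀ x : PrimeDivisor X, Scheme.ord f x.1 = Divisor.ofPoints B x + 2 * D x) :
    ∃ c : X.functionField, c ≠ 0 ∧ c ^ 2 * f = δ ∧ ∀ x, Scheme.ord c x = 0 := by
  classical
  have hmem : δ * f⁻¹ ∈ (0 : Divisor X).sections ⊤ := by
    intro _ x _
    rw [Scheme.ord_mul H.ne_zero (inv_ne_zero hf0), ord_inv' hf0, hf, Divisor.ofPoints_apply,
      Finsupp.zero_apply]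
    have h1 := H.nonneg_ord x
    split_ifs with hx
    · have h3 : x.1 ∈ branchLocus γ := hγ ▸ ⟨x, hx, rfl⟩
      obtain ⟨_, h4⟩ := (H.mem_branchLocus_iff (isUnit_two_sections p h2) x.1).mp h3
      change 1 ≤ Scheme.ord δ x.1 - 2 * D x at h4
      omega
    · omega
  obtain ⟨c, hc0, hc, hc'⟩ := exists_sq_of_mem_sections_zero p hmem
    (mul_ne_zero H.ne_zero (inv_ne_zero hf0))
  exact ⟨c, hc0, by rw [hc, inv_mul_cancel_right₀ hf0], hc'⟩

end IsSqrtCover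

/-- If f = g², then 2 ord g = B + 2(K - b) at each point, where B is 0 or 1. Parity forces B = 0, so
g⁻¹ has order exactly -(K - b) and is a nonzero section of O(K - b), contradicting nonspeciality. -/
theorem sq_ne_of_isNonspecial {k : Type u} [Field k] {p : X ⟶ Spec (.of k)} {K b : Divisor X}
    (hK : IsCanonicalDivisor p K) (hb : IsNonspecial p b) {B : Finset (PrimeDivisor X)}
    {f : X.functionField} (hf0 : f ≠ 0)
    (hf : ∀ x : PrimeDivisor X, Scheme.ord f x.1 = Divisor.ofPoints B x + 2 * (K - b) x)
    (g : X.functionField) : g ^ 2 ≠ f := by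
  classical
  rintro rfl
  have hg0 : g ≠ 0 := fun h ↦ hf0 (by rw [h, zero_pow two_ne_zero])
  have h1 : g⁻¹ ∈ (K - b).sections ⊤ := by
    intro _ x _
    have h2 := hf x
    rw [pow_two, Scheme.ord_mul hg0 hg0, Divisor.ofPoints_apply] at h2
    rw [ord_inv' hg0]
    split_ifs at h2 <;> omega
  rw [hb K hK, AddSubgroup.mem_bot] at h1
  exact inv_ne_zero hg0 h1

end Main
end RuledDoubleCover

open RuledDoubleCover
theorem mainTheorem7 {k : Type u} [Field k] [IsAlgClosed k] (h2 : (2 : k) ≠ 0)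
    {X : Scheme.{u}} [IsNonsingularCurve X] (p : X ⟶ Spec (.of k)) [IsProper p]
    (K b : Divisor X) (hK : IsCanonicalDivisor p K) (hb : IsNonspecial p b)
    (hdeg : 2 * (genus p : ℤ) - 2 ≤ b.degree)
    (B : Finset (PrimeDivisor X))
    (hB : LinearlyEquivalent (Divisor.ofPoints B) (2 • b - 2 • K)) :
    (∃ C : (ruledSurface (K - b)).IdealSheafData,
      IsNonsingularCurve C.subscheme ∧ IsDoubleCoverWithBranch C B) ∧
    ∀ C C' : (ruledSurface (K - b)).IdealSheafData,
      IsDoubleCoverWithBranch C B → IsDoubleCoverWithBranch C' B →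
        ∃ e : C.subscheme ≅ C'.subscheme, e.hom ≫ restrictedRuling C' = restrictedRuling C := by
  classical
  obtain ⟨f, hf0, hf'⟩ := hB
  have hf (x : PrimeDivisor X) :
      Scheme.ord f x.1 = Divisor.ofPoints B x + 2 * (K - b) x := by
    rw [hf']
    rw [Finsupp.sub_apply, Finsupp.sub_apply, Finsupp.smul_apply, Finsupp.smul_apply, nsmul_eq_mul,
      nsmul_eq_mul]
    push_cast
    ring
  have h2' := isUnit_two_sections p h2
  refine ⟨?_, fun C C' H H' ↦ ?_⟩
  -- As a section of O(-2D), f has divisor of zeros B, which is effective; that B is reduced gives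
  -- nonsingularity below.
  · have hmem : f ∈ ((-2 : ℤ) • (K - b)).sections ⊤ := by
      intro _ x _
      rw [hf, Finsupp.smul_apply, smul_eq_mul, Divisor.ofPoints_apply]
      split_ifs <;> omega
    obtain ⟨C, hC, L, _, _, ψ, ρ, H⟩ :=
      exists_isSqrtCover_of_not_isSquare h2' hmem (sq_ne_of_isNonspecial hK hb hf0 hf)
    refine ⟨C, H.isNonsingularCurve h2' fun x ↦ ?_, hC, H.isIntegral, H.isTwoToOne,
      H.branchLocus_eq h2' hf⟩
    rw [hf, Divisor.ofPoints_apply]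
    split_ifs <;> omega
  · have := H.isIntegral
    have := H'.isIntegral
    obtain ⟨L, _, _, ψ, ρ, δ, hγ⟩ := exists_isSqrtCover h2 p H.mem_linearSystem H.isTwoToOne
    obtain ⟨L', _, _, ψ', ρ', δ', hγ'⟩ := exists_isSqrtCover h2 p H'.mem_linearSystem H'.isTwoToOne
    obtain ⟨c, hc0, hc, hc'⟩ := hγ.exists_sq_mul_eq h2 p H.branchLocus_eq hf0 hf
    obtain ⟨d, hd0, hd, hd'⟩ := hγ'.exists_sq_mul_eq h2 p H'.branchLocus_eq hf0 hf
    -- From δ = c²f and δ' = d²f follows δ' = (d/c)²δ, with d/c of order zero everywhere.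
    refine hγ.exists_iso hγ' (d * c⁻¹) ?_ fun x ↦ ?_
    · rw [← hc, ← hd]
      field_simp
    · rw [Scheme.ord_mul hd0 (inv_ne_zero hc0), ord_inv' hc0, hc', hd']
      simp
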